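/- Let $I=[0,2\pi)$, and on $I$ let $\omega(x)=\sin\frac x2$, $\omega'(x)=\frac12\cos\frac x2$ for $x\neq 0$ and $\omega'(0)=0$. Put $$F_\pm(x,y)=\Bigl(\cos\tfrac x2+\cos\tfrac y2\Bigr)^2\pm 4\sin\tfrac x2\sin\tfrac y2,\qquad K_1(x,y)=\frac{4\cdot\mathbf 1(F_-(x,y)>0)}{\sqrt{F_-(x,y)}},\qquad K_2(x,y)=\frac{2}{\sqrt{F_+(x,y)}},\qquad V(x)=\int_I K_2(x,y)\,dy .$$ Let $L=V+K_1-2K_2$ be the linearized collision operator of the FPU-$\beta$ chain in the kinetic limit, where $V$ acts by multiplication and $K_1,K_2$ act as integral operators, and let $\tilde L=\omega L\omega$, that is, $$(\tilde L f)(x)=\omega(x)\Bigl[V(x)\omega(x)f(x)+\int_I K_1(x,y)\,\omega(y)f(y)\,dy-2\int_I K_2(x,y)\,\omega(y)f(y)\,dy\Bigr].$$ For every $f\in L^2(I)$ (complex-valued functions, Lebesgue measure) these integrals converge absolutely for almost every $x\in I$, and the formula defines a unique bounded linear operator $\tilde L$ on $L^2(I)$, which is positive (self-adjoint with $\langle f,\tilde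 Lf\rangle\ge 0$); in particular $\lambda+\tilde L$ is invertible for every $\lambda>0$. Let $$R(\lambda)=\bigl\langle\omega',(\lambda+\tilde L)^{-1}\omega'\bigr\rangle\quad(\lambda>0),\qquad C(t)=\bigl\langle\omega',e^{-|t|\tilde L}\omega'\bigr\rangle\quad(t\in\mathbb R),$$ where $C$ is the kinetic energy current correlation function. Then there is a constant $0<c_0<\infty$ such that $$\lim_{\lambda\to0^+}\lambda^{2/5}R(\lambda)=c_0\qquad\text{and}\qquad \lim_{t\to\infty}t^{3/5}C(t)=\frac{c_0}{\Gamma(2/5)} .$$ Consequently the integrated correlations satisfy $$\lim_{t\to\infty}t^{-2/5}\int_0^tC(s)\,ds=\frac{c_0}{\Gamma(7/5)},$$ and for all $D_0\in\mathbb R$ and $\chi>0$ the energy spread $D(t)=D_0+\frac1\chi\int_0^t ds\int_0^t ds'\,C(s-s')$ is superdiffusive with $$\lim_{t\to\infty}t^{-(1+2/5)}D(t)=\frac{2c_0}{\chi\,\Gamma(12/5)}>0,$$ that is, $D(t)$ grows like $t^{1+\alpha}$ with conductivity exponent $\alpha=\frac25$. -/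

import Mathlib

open MeasureTheory Filter Topology
open scoped InnerProductSpace

namespace FPU

/-- The basic periodic cell `I = [0, 2π)`. -/
def I : Set ℝ := Set.Ico 0 (2 * Real.pi)

/-- The complex Hilbert space `L²(I)` with respect to Lebesgue measure. -/
abbrev L2I : Type := Lp ℂ 2 (volume.restrict I)

/-- The dispersion relation `ω(x) = |sin (x/2)|`, which equals `sin (x/2)` on `I`. -/
noncomputable def omega (x : ℝ) : ℝ := |Real.sin (x / 2)|

/-- The derivative `ω'` on the cell `I`: `ω'(x) = (1/2) cos (x/2)` for `x ≠ 0`,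
and `ω'(0) = 0` by convention. -/
noncomputable def omegaDeriv (x : ℝ) : ℝ := if x = 0 then 0 else (1 / 2) * Real.cos (x / 2)

/-- `F₊(x,y) = (cos (x/2) + cos (y/2))² + 4 sin (x/2) sin (y/2)`. -/
noncomputable def Fplus (x y : ℝ) : ℝ :=
  (Real.cos (x / 2) + Real.cos (y / 2)) ^ 2 + 4 * Real.sin (x / 2) * Real.sin (y / 2)

/-- `F₋(x,y) = (cos (x/2) + cos (y/2))² - 4 sin (x/2) sin (y/2)`. -/
noncomputable def Fminus (x y : ℝ) : ℝ :=
  (Real.cos (x / 2) + Real.cos (y / 2)) ^ 2 - 4 * Real.sin (x / 2) * Real.sin (y / 2)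

/-- The integral kernel `K₁(x,y) = 4 · 1(F₋(x,y) > 0) / √F₋(x,y)`. -/
noncomputable def K1 (x y : ℝ) : ℝ :=
  if 0 < Fminus x y then 4 / Real.sqrt (Fminus x y) else 0

/-- The integral kernel `K₂(x,y) = 2 / √F₊(x,y)`. -/
noncomputable def K2 (x y : ℝ) : ℝ := 2 / Real.sqrt (Fplus x y)

/-- The multiplication function `V(x) = ∫_I K₂(x,y) dy`. -/
noncomputable def V (x : ℝ) : ℝ := ∫ y in I, K2 x y

/-- The linearized collision operator `L = V + K₁ - 2 K₂`, acting on functions. -/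
noncomputable def collisionL (g : ℝ → ℂ) (x : ℝ) : ℂ :=
  (V x : ℂ) * g x + (∫ y in I, (K1 x y : ℂ) * g y) - 2 * ∫ y in I, (K2 x y : ℂ) * g y

/-- `L̃ = ω L ω`, with `ω` acting by multiplication. -/
noncomputable def collisionLtilde (f : ℝ → ℂ) (x : ℝ) : ℂ :=
  (omega x : ℂ) * collisionL (fun y => (omega y : ℂ) * f y) x

/-- `Lt` is the bounded operator `L̃ = ω L ω` on all of `L²(I)`: for every `f ∈ L²(I)` the integrals
defining `(L̃ f)(x)` converge absolutely for almost every `x ∈ I`, and they give `Lt f`.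
Such an `Lt` is unique, since its values are prescribed almost everywhere. -/
structure IsLtilde (Lt : L2I →L[ℂ] L2I) : Prop where
  integrable_V : ∀ᵐ x ∂(volume.restrict I), Integrable (fun y => K2 x y) (volume.restrict I)
  integrable_K1 : ∀ f : L2I, ∀ᵐ x ∂(volume.restrict I),
    Integrable (fun y => (K1 x y : ℂ) * ((omega y : ℂ) * f y)) (volume.restrict I)
  integrable_K2 : ∀ f : L2I, ∀ᵐ x ∂(volume.restrict I),
    Integrable (fun y => (K2 x y : ℂ) * ((omega y : ℂ) * f y)) (volume.restrict I)
  apply_ae : ∀ f : L2I, ∀ᵐ x ∂(volume.restrict I), Lt f x = collisionLtilde f x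

theorem memLp_omegaDeriv : MemLp (fun x => (omegaDeriv x : ℂ)) 2 (volume.restrict I) := by
  have : IsFiniteMeasure (volume.restrict I) := by
    unfold I; infer_instance
  have hm : Measurable omegaDeriv :=
    Measurable.ite (measurableSet_singleton (0 : ℝ)) measurable_const (by fun_prop)
  refine MemLp.of_bound (C := 1)
    (Complex.measurable_ofReal.comp hm).aestronglyMeasurable (Eventually.of_forall fun x => ?_)
  have h := Real.abs_cos_le_one (x / 2)
  rw [Complex.norm_real, Real.norm_eq_abs]
  unfold omegaDeriv
  split_ifs
  · simp
  · rw [abs_mul, abs_of_pos (by norm_num : (0 : ℝ) < 1 / 2)]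
    linarith

/-- `ω'` as a vector of `L²(I)`. -/
noncomputable def omegaPrime : L2I := memLp_omegaDeriv.toLp _

/-- `R(r) = ⟨ω', (r + L̃)⁻¹ ω'⟩`. `Ring.inverse` is the inverse of an invertible operator. -/
noncomputable def resolventR (Lt : L2I →L[ℂ] L2I) (r : ℝ) : ℂ :=
  ⟪omegaPrime, Ring.inverse ((r : ℂ) • (1 : L2I →L[ℂ] L2I) + Lt) omegaPrime⟫_ℂ

/-- The kinetic energy current correlation `C(t) = ⟨ω', exp (-|t| L̃) ω'⟩`. -/
noncomputable def corrC (Lt : L2I →L[ℂ] L2I) (t : ℝ) : ℂ :=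
  ⟪omegaPrime, NormedSpace.exp (-((|t| : ℝ) : ℂ) • Lt) omegaPrime⟫_ℂ

/-- The energy spread with initial value `D₀`, normalization `χ` and current correlation `C`:
`D(t) = D₀ + χ⁻¹ ∫₀ᵗ ds ∫₀ᵗ ds' C(s - s')`. -/
noncomputable def energySpread (D₀ χ : ℝ) (C : ℝ → ℂ) (t : ℝ) : ℂ :=
  (D₀ : ℂ) + (χ : ℂ)⁻¹ * ∫ s in (0 : ℝ)..t, ∫ s' in (0 : ℝ)..t, C (s - s')

end FPU

/-! In half-angle variables a collision turns `a, b` into `c, d` with a + b = c + d - π and sin a +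
sin b = sin c + sin d. For given a ≠ c there is exactly one such `b` and `d`, and there F₊(a, c) =
(cos b - cos d)² and F₋(a, b) = (cos c - cos d)². The kernels are therefore Jacobian factors: for
fixed a the map c ↦ d preserves K₂(a, c) dc, and c ↦ b pushes K₂(a, c) dc forward to K₁(a, b) db. On
L²(V dx) this makes the form of L equal to ‖D g‖², where D (`collOp`) is half of the collision
difference in L²(K₂ dx dz). Since ω²V is bounded, L̃ = (Dω)*(Dω) is bounded and positive
(`inner_collOp`, `Ltilde_apply_ae`).

Both ω' and the operator respect the reflection x ↦ 2π - x, under which ω' is odd. On odd functions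
D has a spectral gap in L²(V dx) (`exists_collOp_gap`). Indeed V + K₁ - 2K₂ is coercive up to a
Hilbert-Schmidt term, because K₁ has row integral exactly V and a fixed fraction of it can be
cancelled by part of 2K₂. The gap then follows by weak compactness, as the only odd collision
invariant is zero. An invariant of finite norm is continuous by averaging the collision equation,
and a functional equation kills the continuous odd ones (`IsOddInvariant.eq_zero`).

The gap permits replacing the resolvent equation by its multiplicative part. With ψ = ω'/(r + ω²V),
the residual of ψ is measured in the norm dual to multiplication by ω, and it changes ⟨ω', ·⟩ by
only o(r^(-2/5)) (`exists_norm_resolventR_sub_le`). What remains is ∫ ω'²/(r + ω²V). Collisions near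
the opposite corner, at distance x^(1/3), make V(x) of order x^(-1/3). Hence ω²V is of order
x^(5/3), and the substitution r = m⁵, x = 2m³ξ gives the power r^(-2/5) with an explicit constant
(`tendsto_lossResolvent`).

Finally R is the Laplace transform of C, which is nonnegative and decreasing because L̃ is positive.
Karamata's theorem for monotone densities gives the decay of C, and two integrations of power
asymptotics give the conductivity and the energy spread. -/

namespace FPU

/-! ### Geometry of collisions in half-angle variables -/

open Real Set

/-- The angle `m` with `sin m = tan (|c - a| / 2) cos ((a + c) / 2)`. -/
noncomputable def midAngle (a c : ℝ) : ℝ :=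
  arcsin (tan (|c - a| / 2) * cos ((a + c) / 2))

/-- In half-angle variables, the momentum of the collision partner of `a` when `a` is scattered
into `c`. -/
noncomputable def partnerHalf (a c : ℝ) : ℝ :=
  if a < c then (c - a) / 2 + midAngle a c else π - (a - c) / 2 + midAngle a c

/-- The polynomial `F₊` in half-angle variables. -/
noncomputable def FplusHalf (a c : ℝ) : ℝ := (cos a + cos c) ^ 2 + 4 * sin a * sin c

/-- The polynomial `F₋` in half-angle variables. -/
noncomputable def FminusHalf (a b : ℝ) : ℝ := (cos a + cos b) ^ 2 - 4 * sin a * sin b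

/-- A non-trivial collision `a, b → c, d` in half-angle variables, ordered so that `a < c`. -/
structure Collision (a b c d : ℝ) : Prop where
  ha : a ∈ Ioo 0 π
  hb : b ∈ Ioo 0 π
  hc : c ∈ Ioo 0 π
  hd : d ∈ Ioo 0 π
  lt : a < c
  momentum : a + b = c + d - π
  energy : sin a + sin b = sin c + sin d

theorem midAngle_comm (a c : ℝ) : midAngle a c = midAngle c a := by
  unfold midAngle; rw [abs_sub_comm, add_comm]

section lt

variable {a c : ℝ}

theorem abs_cos_half_add_lt (ha : a ∈ Ioo 0 π) (hc : c ∈ Ioo 0 π) (h : a < c) :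
    |cos ((a + c) / 2)| < cos ((c - a) / 2) := by
  obtain ⟨ha0, ha1⟩ := ha
  obtain ⟨hc0, hc1⟩ := hc
  rw [abs_lt]
  constructor
  · rw [← cos_pi_sub]
    apply cos_lt_cos_of_nonneg_of_le_pi <;> linarith
  · apply cos_lt_cos_of_nonneg_of_le_pi <;> linarith

theorem cos_half_sub_pos (ha : a ∈ Ioo 0 π) (hc : c ∈ Ioo 0 π) : 0 < cos ((c - a) / 2) := by
  obtain ⟨ha0, ha1⟩ := ha
  obtain ⟨hc0, hc1⟩ := hc
  exact cos_pos_of_mem_Ioo ⟨by linarith, by linarith⟩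

theorem sin_half_sub_pos (ha : a ∈ Ioo 0 π) (hc : c ∈ Ioo 0 π) (h : a < c) :
    0 < sin ((c - a) / 2) := by
  obtain ⟨ha0, ha1⟩ := ha
  obtain ⟨hc0, hc1⟩ := hc
  exact sin_pos_of_pos_of_lt_pi (by linarith) (by linarith)

/-- With δ = (c - a) / 2 and σ = (a + c) / 2, the bound |cos σ| < cos δ holds because both angles
are interior. Besides making the arcsine genuine, it gives |`midAngle`| < δ, and this keeps b = δ +
m and d = π - δ + m inside (0, π). -/
theorem abs_tan_mul_cos_lt (ha : a ∈ Ioo 0 π) (hc : c ∈ Ioo 0 π) (h : a < c) :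
    |tan ((c - a) / 2) * cos ((a + c) / 2)| < sin ((c - a) / 2) := by
  have h1 := abs_cos_half_add_lt ha hc h
  have h2 := cos_half_sub_pos ha hc
  have h3 := sin_half_sub_pos ha hc h
  rw [tan_eq_sin_div_cos, abs_mul, abs_of_pos (div_pos h3 h2), div_mul_eq_mul_div, div_lt_iff₀ h2]
  exact mul_lt_mul_of_pos_left h1 h3

theorem midAngle_of_lt (h : a < c) :
    midAngle a c = arcsin (tan ((c - a) / 2) * cos ((a + c) / 2)) := by
  unfold midAngle; rw [abs_of_pos (sub_pos.2 h)]

theorem sin_midAngle (ha : a ∈ Ioo 0 π) (hc : c ∈ Ioo 0 π) (h : a < c) :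
    sin (midAngle a c) = tan ((c - a) / 2) * cos ((a + c) / 2) := by
  have h1 := abs_lt.1 ((abs_tan_mul_cos_lt ha hc h).trans_le (sin_le_one _))
  rw [midAngle_of_lt h, sin_arcsin h1.1.le h1.2.le]

theorem abs_midAngle_lt (ha : a ∈ Ioo 0 π) (hc : c ∈ Ioo 0 π) (h : a < c) :
    |midAngle a c| < (c - a) / 2 := by
  have h1 := abs_lt.1 (abs_tan_mul_cos_lt ha hc h)
  obtain ⟨ha0, ha1⟩ := ha
  obtain ⟨hc0, hc1⟩ := hc
  rw [midAngle_of_lt h, abs_lt]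
  constructor
  · rw [lt_arcsin_iff_sin_lt' ⟨by linarith, by linarith⟩, sin_neg]
    exact h1.1
  · rw [arcsin_lt_iff_lt_sin' ⟨by linarith, by linarith⟩]
    exact h1.2

theorem midAngle_relation (ha : a ∈ Ioo 0 π) (hc : c ∈ Ioo 0 π) (h : a < c) :
    sin (midAngle a c) * cos ((c - a) / 2) = sin ((c - a) / 2) * cos ((a + c) / 2) := by
  rw [sin_midAngle ha hc h, tan_eq_sin_div_cos]
  have := (cos_half_sub_pos ha hc).ne'
  field_simp

theorem cos_midAngle_pos (ha : a ∈ Ioo 0 π) (hc : c ∈ Ioo 0 π) (h : a < c) :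
    0 < cos (midAngle a c) := by
  have h1 := abs_lt.1 (abs_midAngle_lt ha hc h)
  obtain ⟨ha0, ha1⟩ := ha
  obtain ⟨hc0, hc1⟩ := hc
  exact cos_pos_of_mem_Ioo ⟨by linarith, by linarith⟩

theorem partnerHalf_of_lt (h : a < c) : partnerHalf a c = (c - a) / 2 + midAngle a c := by
  unfold partnerHalf; rw [if_pos h]

theorem partnerHalf_of_gt (h : a < c) : partnerHalf c a = π - (c - a) / 2 + midAngle a c := by
  unfold partnerHalf; rw [if_neg (not_lt.2 h.le), midAngle_comm]

/-- Momentum holds by construction. By sum-to-product, energy conservation reads sin δ cos σ = sin m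
cos δ, which is the relation defining the angle m. -/
theorem collision_partnerHalf (ha : a ∈ Ioo 0 π) (hc : c ∈ Ioo 0 π) (h : a < c) :
    Collision a (partnerHalf a c) c (partnerHalf c a) := by
  have h1 := abs_lt.1 (abs_midAngle_lt ha hc h)
  have h2 := midAngle_relation ha hc h
  have ha' := ha
  have hc' := hc
  obtain ⟨ha0, ha1⟩ := ha'
  obtain ⟨hc0, hc1⟩ := hc'
  rw [partnerHalf_of_lt h, partnerHalf_of_gt h]
  refine ⟨ha, ⟨by linarith, by linarith⟩, hc, ⟨by linarith, by linarith⟩, h, by ring, ?_⟩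
  have e1 : sin c - sin a = 2 * sin ((c - a) / 2) * cos ((c + a) / 2) := sin_sub_sin c a
  have e2 : sin ((c - a) / 2 + midAngle a c) - sin (π - (c - a) / 2 + midAngle a c)
      = 2 * (sin (midAngle a c) * cos ((c - a) / 2)) := by
    rw [show π - (c - a) / 2 + midAngle a c = π - ((c - a) / 2 - midAngle a c) by ring, sin_pi_sub,
      sin_add, sin_sub]
    ring
  rw [h2, add_comm a c] at e2
  linarith

end lt

namespace Collision

variable {a b c d : ℝ}

/-- Momentum with the shift by π forces each incoming angle below each outgoing one, so the order
field survives both exchange symmetries. -/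
theorem lt' (h : Collision a b c d) : a < d := by
  have := h.momentum; have := h.hc.2; have := h.hb.1; linarith

theorem swap (h : Collision a b c d) : Collision a b d c :=
  ⟨h.ha, h.hb, h.hd, h.hc, h.lt', by linarith [h.momentum], by linarith [h.energy]⟩

theorem symm (h : Collision a b c d) : Collision b a c d :=
  ⟨h.hb, h.ha, h.hc, h.hd, by linarith [h.momentum, h.hd.2, h.ha.1],
    by linarith [h.momentum], by linarith [h.energy]⟩

theorem partner_lt (h : Collision a b c d) : b < d := h.symm.lt'

/-- The angle b - δ lies in [-π/2, π/2] and its sine is fixed by the conservation laws, so the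
arcsine recovers it and the partners are unique. -/
theorem eq_partnerHalf (h : Collision a b c d) :
    b = partnerHalf a c ∧ d = partnerHalf c a := by
  have hlt := h.lt
  have h1 := collision_partnerHalf h.ha h.hc hlt
  have hm := h.momentum
  have key : b - (c - a) / 2 = midAngle a c := by
    have hcos := cos_half_sub_pos h.ha h.hc
    rw [midAngle_of_lt hlt, eq_comm]
    refine arcsin_eq_of_sin_eq ?_ ⟨by linarith [h.hb.1, h.hc.2, h.ha.1], by
      linarith [h.hd.2, h.ha.1, h.hc.2]⟩
    rw [tan_eq_sin_div_cos, div_mul_eq_mul_div, eq_div_iff hcos.ne']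
    have e1 : sin c - sin a = 2 * sin ((c - a) / 2) * cos ((c + a) / 2) := sin_sub_sin c a
    have e2 : sin b - sin d = 2 * (sin (b - (c - a) / 2) * cos ((c - a) / 2)) := by
      have h3 : sin d = sin ((c - a) / 2 - (b - (c - a) / 2)) := by
        rw [← sin_pi_sub]; congr 1; linarith
      have h4 : sin b = sin ((c - a) / 2 + (b - (c - a) / 2)) := by congr 1; ring
      rw [h3, h4, sin_add, sin_sub ((c - a) / 2) (b - (c - a) / 2)]
      ring
    rw [add_comm c a] at e1
    linarith [h.energy]
  have hb : b = partnerHalf a c := by rw [partnerHalf_of_lt hlt]; linarith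
  refine ⟨hb, ?_⟩
  have := h1.momentum
  rw [← hb] at this
  linarith

theorem cos_lt_cos (h : Collision a b c d) : cos d < cos b :=
  cos_lt_cos_of_nonneg_of_le_pi h.hb.1.le h.hd.2.le h.partner_lt

theorem cos_lt_cos' (h : Collision a b c d) : cos c < cos b := h.swap.cos_lt_cos

/-- On the collision manifold the square root in K₂ is rational in the cosines. It is the
denominator met when the conservation laws are differentiated in `c` at fixed `a`. -/
theorem FplusHalf_eq (h : Collision a b c d) : FplusHalf a c = (cos b - cos d) ^ 2 := by
  have hr := midAngle_relation h.ha h.hc h.lt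
  obtain ⟨hb, hd⟩ := h.eq_partnerHalf
  rw [partnerHalf_of_lt h.lt] at hb
  rw [partnerHalf_of_gt h.lt] at hd
  set m := midAngle a c
  set δ := (c - a) / 2 with hδ
  set σ := (a + c) / 2 with hσ
  have ea : a = σ - δ := by rw [hσ, hδ]; ring
  have ec : c = σ + δ := by rw [hσ, hδ]; ring
  have ed : d = π - (δ - m) := by rw [hd]; ring
  unfold FplusHalf
  rw [hb, ed, cos_pi_sub]
  clear_value m δ σ
  rw [ea, ec, cos_sub, cos_add, sin_sub, sin_add, cos_add, cos_sub]
  have e1 : (cos m * cos δ) ^ 2 = cos δ ^ 2 - (sin δ * cos σ) ^ 2 := by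
    rw [← hr, mul_pow, mul_pow, cos_sq' m]; ring
  have s1 := sin_sq_add_cos_sq σ
  have s2 := sin_sq_add_cos_sq δ
  have : (cos δ * cos m - sin δ * sin m - -(cos δ * cos m + sin δ * sin m)) ^ 2
      = 4 * (cos m * cos δ) ^ 2 := by ring
  rw [this, e1]
  have s3 : sin σ ^ 2 = 1 - cos σ ^ 2 := by linarith
  linear_combination (4 * cos δ ^ 2) * s3

/-- With s, t, r the half sum a + b, half difference a - b and half difference c - d, energy
conservation becomes sin s cos t = cos s cos r; the rest is algebra. -/
theorem FminusHalf_eq (h : Collision a b c d) : FminusHalf a b = (cos c - cos d) ^ 2 := by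
  have hm := h.momentum
  have he := h.energy
  have e1 : sin a + sin b = 2 * sin ((a + b) / 2) * cos ((a - b) / 2) := by
    rw [show a = (a + b) / 2 + (a - b) / 2 by ring, show b = (a + b) / 2 - (a - b) / 2 by ring,
      sin_add, sin_sub]
    ring_nf
  set s := (a + b) / 2 with hs
  set t := (a - b) / 2 with ht
  set r := (c - d) / 2 with hr
  have ea : a = s + t := by rw [hs, ht]; ring
  have eb : b = s - t := by rw [hs, ht]; ring
  have ec : c = (s + r) + π / 2 := by rw [hs, hr]; linarith
  have ed : d = (s - r) + π / 2 := by rw [hs, hr]; linarith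
  have key : sin s * cos t = cos s * cos r := by
    have : sin c + sin d = 2 * (cos s * cos r) := by
      rw [ec, ed, sin_add_pi_div_two, sin_add_pi_div_two, cos_add, cos_sub]; ring
    linarith
  clear_value s t r
  unfold FminusHalf
  rw [ec, ed, cos_add_pi_div_two, cos_add_pi_div_two, ea, eb, cos_add, cos_sub, sin_add, sin_sub,
    sin_add, sin_sub]
  have e2 : (cos s * sin r) ^ 2 = cos s ^ 2 - (sin s * cos t) ^ 2 := by
    rw [key, mul_pow, mul_pow, sin_sq r]; ring
  have s1 := sin_sq_add_cos_sq s
  have s2 := sin_sq_add_cos_sq t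
  have : (-(sin s * cos r + cos s * sin r) - -(sin s * cos r - cos s * sin r)) ^ 2
      = 4 * (cos s * sin r) ^ 2 := by ring
  rw [this, e2]
  have s3 : sin t ^ 2 = 1 - cos t ^ 2 := by linarith
  linear_combination (4 * cos s ^ 2) * s3

theorem partnerHalf_left (h : Collision a b c d) :
    partnerHalf a d = b ∧ partnerHalf d a = c :=
  ⟨h.swap.eq_partnerHalf.1.symm, h.swap.eq_partnerHalf.2.symm⟩

/-- The relation `sin b = tan δ (√F₊ + cos a + cos c) / 2`, with `tan δ` written as
`(cos a - cos c) / (sin a + sin c)`. -/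
theorem sin_partner_mul (h : Collision a b c d) :
    2 * sin b * (sin a + sin c) = (cos a - cos c) * ((cos b - cos d) + (cos a + cos c)) := by
  have hr := midAngle_relation h.ha h.hc h.lt
  obtain ⟨hb, hd⟩ := h.eq_partnerHalf
  rw [partnerHalf_of_lt h.lt] at hb
  rw [partnerHalf_of_gt h.lt] at hd
  set m := midAngle a c
  set δ := (c - a) / 2 with hδ
  set σ := (a + c) / 2 with hσ
  have ea : a = σ - δ := by rw [hσ, hδ]; ring
  have ec : c = σ + δ := by rw [hσ, hδ]; ring
  have ed : d = π - (δ - m) := by rw [hd]; ring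
  rw [hb, ed, cos_pi_sub]
  clear_value m δ σ
  rw [ea, ec, cos_sub, cos_add, sin_sub, sin_add, cos_add, cos_sub, sin_add]
  linear_combination (4 * sin σ * cos δ) * hr

/-- The relation `sin d = tan δ (√F₊ - cos a - cos c) / 2`, with `tan δ` written as
`(cos a - cos c) / (sin a + sin c)`. -/
theorem sin_partner_mul' (h : Collision a b c d) :
    2 * sin d * (sin a + sin c) = (cos a - cos c) * ((cos b - cos d) - (cos a + cos c)) := by
  have h1 := h.sin_partner_mul
  have h2 := h.energy
  have s1 := sin_sq_add_cos_sq a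
  have s2 := sin_sq_add_cos_sq c
  linear_combination h1 - 2 * (sin a + sin c) * h2 + 2 * s1 - 2 * s2

end Collision

section mirror

variable {a c : ℝ}

/-- The reflection a ↦ π - a exchanges the two branches of `partnerHalf`. It fails at a = c, which
the definition assigns to the second branch. It lets later statements be proved for a < c only. -/
theorem partnerHalf_mirror (h : a ≠ c) :
    partnerHalf (π - a) (π - c) = π - partnerHalf a c := by
  have e : midAngle (π - a) (π - c) = -midAngle a c := by
    unfold midAngle
    rw [← arcsin_neg, show π - c - (π - a) = -(c - a) by ring, abs_neg,
      show (π - a + (π - c)) / 2 = π - (a + c) / 2 by ring, cos_pi_sub, mul_neg]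
  unfold partnerHalf
  rw [e]
  rcases lt_or_gt_of_ne h with h | h
  · rw [if_neg (by linarith), if_pos h]; ring
  · rw [if_pos (by linarith), if_neg (by linarith)]; ring

theorem partnerHalf_mem (ha : a ∈ Ioo 0 π) (hc : c ∈ Ioo 0 π) (h : a ≠ c) :
    partnerHalf a c ∈ Ioo 0 π := by
  rcases lt_or_gt_of_ne h with h | h
  · exact (collision_partnerHalf ha hc h).hb
  · exact (collision_partnerHalf hc ha h).hd

theorem pi_sub_mem (ha : a ∈ Ioo 0 π) : π - a ∈ Ioo 0 π :=
  ⟨by linarith [ha.2], by linarith [ha.1]⟩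

/-- The two outgoing particles are interchangeable: scattering into `d` instead of `c` involves the
same partner, and doing it twice returns `c`. -/
theorem partnerHalf_relations (ha : a ∈ Ioo 0 π) (hc : c ∈ Ioo 0 π) (h : a ≠ c) :
    a ≠ partnerHalf c a ∧ partnerHalf a (partnerHalf c a) = partnerHalf a c ∧
      partnerHalf (partnerHalf c a) a = c := by
  rcases lt_or_gt_of_ne h with h | h
  · have hcol := collision_partnerHalf ha hc h
    exact ⟨hcol.lt'.ne, hcol.partnerHalf_left⟩
  · have hcol := collision_partnerHalf (pi_sub_mem ha) (pi_sub_mem hc) (by linarith)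
    have h1 := hcol.lt'.ne
    obtain ⟨h2, h3⟩ := hcol.partnerHalf_left
    rw [partnerHalf_mirror h.ne] at h1 h2 h3
    have h4 : a ≠ partnerHalf c a := fun h' => h1 (by rw [← h'])
    rw [partnerHalf_mirror h4, partnerHalf_mirror h.ne'] at h2
    rw [partnerHalf_mirror h4.symm] at h3
    exact ⟨h4, by linarith, by linarith⟩

end mirror

end FPU

/-! ### The kernels as Jacobians of the collision maps -/

namespace FPU

open Real Set

open scoped ENNReal

/-- The kernel `K₁` in half-angle variables. -/
noncomputable def K1Half (a b : ℝ) : ℝ := if 0 < FminusHalf a b then 4 / √(FminusHalf a b) else 0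

/-- The kernel `K₂` in half-angle variables. -/
noncomputable def K2Half (a b : ℝ) : ℝ := 2 / √(FplusHalf a b)

section fiber

variable {a c : ℝ}

/-- The value is predicted by implicit differentiation: db = dc + dd and cos b db = cos c dc + cos d
dd. The proof differentiates the arcsine formula and matches the two. -/
theorem hasDerivAt_partnerHalf (ha : a ∈ Ioo 0 π) (hc : c ∈ Ioo a π) :
    HasDerivAt (fun c => partnerHalf a c)
      ((cos c - cos (partnerHalf c a)) / (cos (partnerHalf a c) - cos (partnerHalf c a))) c := by
  have hc0 : c ∈ Ioo 0 π := ⟨ha.1.trans hc.1, hc.2⟩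
  have hr := sin_midAngle ha hc0 hc.1
  have hcosm := cos_midAngle_pos ha hc0 hc.1
  have hcosd := cos_half_sub_pos ha hc0
  have hlt := abs_lt.1 ((abs_tan_mul_cos_lt ha hc0 hc.1).trans_le (sin_le_one _))
  have hm := midAngle_of_lt hc.1
  have h1 : HasDerivAt (fun c => tan ((c - a) / 2) * cos ((a + c) / 2))
      (1 / cos ((c - a) / 2) ^ 2 * (1 / 2) * cos ((a + c) / 2)
        + tan ((c - a) / 2) * (-sin ((a + c) / 2) * (1 / 2))) c := by
    have e1 : HasDerivAt (fun c : ℝ => (c - a) / 2) (1 / 2) c :=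
      ((hasDerivAt_id c).sub_const a).div_const 2
    have e2 : HasDerivAt (fun c : ℝ => (a + c) / 2) (1 / 2) c :=
      ((hasDerivAt_id c).const_add a).div_const 2
    exact ((hasDerivAt_tan hcosd.ne').comp c e1).mul ((hasDerivAt_cos _).comp c e2)
  have h2 := (hasDerivAt_arcsin hlt.1.ne' hlt.2.ne).comp c h1
  have h3 : HasDerivAt (fun c : ℝ => (c - a) / 2 +
      arcsin (tan ((c - a) / 2) * cos ((a + c) / 2))) _ c :=
    (((hasDerivAt_id c).sub_const a).div_const 2).add h2
  have h4 : (fun c => partnerHalf a c) =ᶠ[𝓝 c] fun c : ℝ => (c - a) / 2 +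
      arcsin (tan ((c - a) / 2) * cos ((a + c) / 2)) := by
    filter_upwards [lt_mem_nhds hc.1] with y hy
    rw [partnerHalf_of_lt hy, midAngle_of_lt hy]
  refine (h3.congr_of_eventuallyEq h4).congr_deriv ?_
  have e3 : √(1 - (tan ((c - a) / 2) * cos ((a + c) / 2)) ^ 2) = cos (midAngle a c) := by
    rw [← hr, ← cos_sq', sqrt_sq hcosm.le]
  rw [e3, partnerHalf_of_lt hc.1, partnerHalf_of_gt hc.1,
    show π - (c - a) / 2 + midAngle a c = π - ((c - a) / 2 - midAngle a c) by ring, cos_pi_sub]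
  have ec : cos c = cos ((a + c) / 2 + (c - a) / 2) := by congr 1; ring
  rw [ec, cos_add, cos_add, cos_sub, hr, tan_eq_sin_div_cos]
  set m := midAngle a c
  set δ := (c - a) / 2
  set σ := (a + c) / 2
  have s2 := sin_sq_add_cos_sq δ
  have hne : cos δ * cos m - sin δ * (sin δ / cos δ * cos σ)
      - -(cos δ * cos m + sin δ * (sin δ / cos δ * cos σ)) ≠ 0 := by
    have := mul_pos hcosd hcosm
    have e : cos δ * cos m - sin δ * (sin δ / cos δ * cos σ)
      - -(cos δ * cos m + sin δ * (sin δ / cos δ * cos σ)) = 2 * (cos δ * cos m) := by ring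
    rw [e]; positivity
  rw [eq_div_iff hne]
  field_simp
  linear_combination (-2 * cos m * cos δ ^ 2 * cos σ) * s2

theorem hasDerivAt_partnerHalf' (ha : a ∈ Ioo 0 π) (hc : c ∈ Ioo a π) :
    HasDerivAt (fun c => partnerHalf c a)
      ((cos c - cos (partnerHalf a c)) / (cos (partnerHalf a c) - cos (partnerHalf c a))) c := by
  have hc0 : c ∈ Ioo 0 π := ⟨ha.1.trans hc.1, hc.2⟩
  have hcol := collision_partnerHalf ha hc0 hc.1
  have h1 : HasDerivAt (fun c => a + partnerHalf a c - c + π) _ c :=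
    (((hasDerivAt_partnerHalf ha hc).const_add a).sub (hasDerivAt_id c)).add_const π
  have h4 : (fun c => partnerHalf c a) =ᶠ[𝓝 c] fun c => a + partnerHalf a c - c + π := by
    filter_upwards [lt_mem_nhds hc.1] with y hy
    rw [partnerHalf_of_lt hy, partnerHalf_of_gt hy]; ring
  refine (h1.congr_of_eventuallyEq h4).congr_deriv ?_
  have := hcol.cos_lt_cos
  rw [div_sub_one (by linarith)]
  congr 1; ring

theorem image_partnerHalf (ha : a ∈ Ioo 0 π) :
    (fun c => partnerHalf c a) '' Ioo a π = Ioo a π := by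
  have key : ∀ c ∈ Ioo a π, partnerHalf c a ∈ Ioo a π := fun c hc =>
    have h := collision_partnerHalf ha ⟨ha.1.trans hc.1, hc.2⟩ hc.1
    ⟨h.lt', h.hd.2⟩
  refine Subset.antisymm (image_subset_iff.2 key) fun c hc => ⟨_, key c hc, ?_⟩
  exact (collision_partnerHalf ha ⟨ha.1.trans hc.1, hc.2⟩ hc.1).partnerHalf_left.2

theorem injOn_partnerHalf (ha : a ∈ Ioo 0 π) :
    InjOn (fun c => partnerHalf c a) (Ioo a π) := by
  intro c hc c' hc' h
  have h1 := (collision_partnerHalf ha ⟨ha.1.trans hc.1, hc.2⟩ hc.1).partnerHalf_left.2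
  have h2 := (collision_partnerHalf ha ⟨ha.1.trans hc'.1, hc'.2⟩ hc'.1).partnerHalf_left.2
  rw [← h1, ← h2]
  simp only at h
  rw [h]

theorem Collision.K2Half_eq {a b c d : ℝ} (h : Collision a b c d) :
    K2Half a c = 2 / (cos b - cos d) := by
  unfold K2Half
  rw [h.FplusHalf_eq, sqrt_sq (sub_pos.2 h.cos_lt_cos).le]

theorem Collision.FminusHalf_pos {a b c d : ℝ} (h : Collision a b c d) (hcd : c ≠ d) :
    0 < FminusHalf a b := by
  rw [h.FminusHalf_eq]
  have : cos c - cos d ≠ 0 := fun h' =>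
    hcd (injOn_cos ⟨h.hc.1.le, h.hc.2.le⟩ ⟨h.hd.1.le, h.hd.2.le⟩ (sub_eq_zero.1 h'))
  positivity

theorem Collision.K1Half_eq {a b c d : ℝ} (h : Collision a b c d) (hcd : c ≠ d) :
    K1Half a b = 4 / |cos c - cos d| := by
  unfold K1Half
  rw [if_pos (h.FminusHalf_pos hcd), h.FminusHalf_eq, sqrt_sq_eq_abs]

/-- The involution c ↦ d has |dd/dc| = (cos b - cos c) / (cos b - cos d), while K₂(a, c) = 2 / (cos
b - cos d) and K₂(a, d) = 2 / (cos b - cos c). Hence K₂(a, d) dd = K₂(a, c) dc. -/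
theorem lintegral_K2Half_exchange_right (ha : a ∈ Ioo 0 π) (φ : ℝ → ℝ≥0∞) :
    ∫⁻ c in Ioo a π, ENNReal.ofReal (K2Half a c) * φ (partnerHalf c a)
      = ∫⁻ c in Ioo a π, ENNReal.ofReal (K2Half a c) * φ c := by
  conv_rhs => rw [← image_partnerHalf ha]
  rw [lintegral_image_eq_lintegral_abs_deriv_mul measurableSet_Ioo
    (fun c hc => (hasDerivAt_partnerHalf' ha hc).hasDerivWithinAt) (injOn_partnerHalf ha)]
  refine setLIntegral_congr_fun measurableSet_Ioo fun c hc => ?_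
  have h := collision_partnerHalf ha ⟨ha.1.trans hc.1, hc.2⟩ hc.1
  rw [← mul_assoc, ← ENNReal.ofReal_mul (abs_nonneg _), h.K2Half_eq, h.swap.K2Half_eq]
  congr 2
  have h1 := sub_pos.2 h.cos_lt_cos
  have h2 := sub_pos.2 h.cos_lt_cos'
  rw [abs_div, abs_of_pos h1, abs_sub_comm, abs_of_pos h2]
  field_simp

/-- Monotonicity leaves at most one fixed point c = d, so the degenerate collisions are negligible
in the change of variables to `b`. -/
theorem strictAntiOn_partnerHalf (ha : a ∈ Ioo 0 π) :
    StrictAntiOn (fun c => partnerHalf c a) (Ioo a π) := by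
  refine strictAntiOn_of_deriv_neg (convex_Ioo a π)
    (fun c hc => (hasDerivAt_partnerHalf' ha hc).continuousAt.continuousWithinAt) fun c hc => ?_
  rw [interior_Ioo] at hc
  rw [(hasDerivAt_partnerHalf' ha hc).deriv]
  have h := collision_partnerHalf ha ⟨ha.1.trans hc.1, hc.2⟩ hc.1
  exact div_neg_of_neg_of_pos (sub_neg.2 h.cos_lt_cos') (sub_pos.2 h.cos_lt_cos)

/-- The sum of the outgoing angles and the sum of their sines determine cos((c - d) / 2), hence the
unordered outgoing pair. -/
theorem Collision.eq_of_eq {a b c d c' d' : ℝ} (h : Collision a b c d)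
    (h' : Collision a b c' d') : c = c' ∨ c = d' := by
  have h1 := h.momentum
  have h2 := h'.momentum
  have h3 := h.energy
  have h4 := h'.energy
  have f1 : sin c + sin d = 2 * sin ((c + d) / 2) * cos ((c - d) / 2) := by
    simpa [← sub_eq_add_neg] using sin_sub_sin c (-d)
  have f2 : sin c' + sin d' = 2 * sin ((c + d) / 2) * cos ((c' - d') / 2) := by
    have : c + d = c' + d' := by linarith
    rw [this]
    simpa [← sub_eq_add_neg] using sin_sub_sin c' (-d')
  have hs : 0 < sin ((c + d) / 2) := by
    have := h.hc; have := h.hd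
    exact sin_pos_of_pos_of_lt_pi (by linarith [h.hc.1, h.hd.1]) (by linarith [h.hc.2, h.hd.2])
  have f3 : cos ((c - d) / 2) = cos ((c' - d') / 2) := by
    have : 2 * sin ((c + d) / 2) * cos ((c - d) / 2)
      = 2 * sin ((c + d) / 2) * cos ((c' - d') / 2) := by rw [← f1, ← f2]; linarith
    exact mul_left_cancel₀ (by positivity) this
  rw [← cos_abs ((c - d) / 2), ← cos_abs ((c' - d') / 2)] at f3
  have f4 : |(c - d) / 2| = |(c' - d') / 2| := by
    have b1 : |(c - d) / 2| ≤ π := abs_le.2 ⟨by linarith [h.hc.1, h.hd.2, h.hd.1, h.hc.2],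
      by linarith [h.hc.1, h.hd.2, h.hd.1, h.hc.2]⟩
    have b2 : |(c' - d') / 2| ≤ π := abs_le.2 ⟨by linarith [h'.hc.1, h'.hd.2, h'.hd.1, h'.hc.2],
      by linarith [h'.hc.1, h'.hd.2, h'.hd.1, h'.hc.2]⟩
    exact injOn_cos ⟨abs_nonneg _, b1⟩ ⟨abs_nonneg _, b2⟩ f3
  rcases abs_eq_abs.1 f4 with h5 | h5
  · left; linarith
  · right; linarith

theorem FminusHalf_eq_cos (a b : ℝ) :
    FminusHalf a b
      = 4 * (cos ((a + b) / 2) ^ 2 - (sin ((a + b) / 2) * cos ((a - b) / 2)) ^ 2) := by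
  set s := (a + b) / 2 with hs
  set t := (a - b) / 2 with ht
  have ea : a = s + t := by rw [hs, ht]; ring
  have eb : b = s - t := by rw [hs, ht]; ring
  clear_value s t
  unfold FminusHalf
  rw [ea, eb, cos_add, cos_sub, sin_add, sin_sub]
  have s1 := sin_sq_add_cos_sq s
  have s2 := sin_sq_add_cos_sq t
  have s3 : sin t ^ 2 = 1 - cos t ^ 2 := by linarith
  linear_combination (4 * cos s ^ 2) * s3

/-- The outgoing pair must be (a + b + π) / 2 ∓ r with cos r = k. Positivity of F₋ says exactly k <
1, and k is large enough that r < (π - a - b) / 2, which keeps the pair in range. -/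
theorem exists_collision {a b : ℝ} (ha : a ∈ Ioo 0 π) (hb : b ∈ Ioo 0 π) (hab : a + b < π)
    (hF : 0 < FminusHalf a b) : ∃ c d, Collision a b c d ∧ c < d := by
  obtain ⟨ha0, ha1⟩ := ha
  obtain ⟨hb0, hb1⟩ := hb
  have hcs : 0 < cos ((a + b) / 2) := cos_pos_of_mem_Ioo ⟨by linarith, by linarith⟩
  have hsn : 0 < sin ((a + b) / 2) := sin_pos_of_pos_of_lt_pi (by linarith) (by linarith)
  have hct : 0 < cos ((a - b) / 2) := cos_pos_of_mem_Ioo ⟨by linarith, by linarith⟩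
  rw [FminusHalf_eq_cos] at hF
  have h1 : sin ((a + b) / 2) * cos ((a - b) / 2) < cos ((a + b) / 2) :=
    lt_of_pow_lt_pow_left₀ 2 hcs.le (by linarith)
  set k := sin ((a + b) / 2) * cos ((a - b) / 2) / cos ((a + b) / 2) with hk
  have hk0 : 0 < k := by positivity
  have hk1 : k < 1 := (div_lt_one hcs).2 h1
  set r := arccos k with hr
  have hr0 : 0 < r := arccos_pos.2 hk1
  have hcr : cos r = k := cos_arccos (by linarith) hk1.le
  have hrlt : r < (π - a - b) / 2 := by
    by_contra! hle
    have := cos_le_cos_of_nonneg_of_le_pi (by linarith) (arccos_le_pi k) hle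
    rw [← hr, hcr, show (π - a - b) / 2 = π / 2 - (a + b) / 2 by ring, cos_pi_div_two_sub, hk,
      div_le_iff₀ hcs] at this
    have h2 : cos ((a + b) / 2) < cos ((a - b) / 2) := by
      rw [← cos_abs ((a - b) / 2)]
      refine cos_lt_cos_of_nonneg_of_le_pi (abs_nonneg _) (by linarith) (abs_lt.2 ⟨?_, ?_⟩)
        <;> linarith
    exact absurd this (not_le.2 (mul_lt_mul_of_pos_left h2 hsn))
  refine ⟨(a + b + π) / 2 - r, (a + b + π) / 2 + r,
    ⟨⟨ha0, ha1⟩, ⟨hb0, hb1⟩, ⟨by linarith, by linarith⟩, ⟨by linarith, by linarith⟩,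
      by linarith, by ring, ?_⟩, by linarith⟩
  have e1 : sin a + sin b = 2 * sin ((a + b) / 2) * cos ((a - b) / 2) := by
    simpa [← sub_eq_add_neg] using sin_sub_sin a (-b)
  rw [e1, sin_sub, sin_add, hcr, show (a + b + π) / 2 = (a + b) / 2 + π / 2 by ring,
    sin_add_pi_div_two, hk]
  field_simp
  ring

/-- On one branch, c < d or d < c, the map c ↦ b is injective with Jacobian |cos c - cos d| / (cos b
- cos d). It turns K₂ dc into 2 / |cos c - cos d| db, which is half of K₁. -/
theorem lintegral_K2Half_partner_aux (ha : a ∈ Ioo 0 π) (φ : ℝ → ℝ≥0∞) {s : Set ℝ}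
    (hs : MeasurableSet s) (hsub : s ⊆ Ioo a π) (hinj : InjOn (fun c => partnerHalf a c) s)
    (hne : ∀ c ∈ s, c ≠ partnerHalf c a)
    (himage : (fun c => partnerHalf a c) '' s
      = {b | b ∈ Ioo 0 (π - a) ∧ 0 < FminusHalf a b}) :
    ∫⁻ c in s, ENNReal.ofReal (K2Half a c) * φ (partnerHalf a c)
      = ∫⁻ b in {b | b ∈ Ioo 0 (π - a) ∧ 0 < FminusHalf a b},
        ENNReal.ofReal (K1Half a b / 2) * φ b := by
  rw [← himage, lintegral_image_eq_lintegral_abs_deriv_mul hs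
    (fun c hc => (hasDerivAt_partnerHalf ha (hsub hc)).hasDerivWithinAt) hinj]
  refine setLIntegral_congr_fun hs fun c hc => ?_
  have h := collision_partnerHalf ha ⟨ha.1.trans (hsub hc).1, (hsub hc).2⟩ (hsub hc).1
  rw [← mul_assoc, ← ENNReal.ofReal_mul (abs_nonneg _), h.K2Half_eq, h.K1Half_eq (hne c hc)]
  congr 2
  have h1 := sub_pos.2 h.cos_lt_cos
  have h2 : |cos c - cos (partnerHalf c a)| ≠ 0 := by
    have := h.FminusHalf_pos (hne c hc)
    rw [h.FminusHalf_eq] at this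
    exact abs_ne_zero.2 fun h' => by rw [h'] at this; simp at this
  rw [abs_div, abs_of_pos h1]
  field_simp
  norm_num

theorem image_partnerHalf_lt (ha : a ∈ Ioo 0 π) :
    (fun c => partnerHalf a c) '' {c | c ∈ Ioo a π ∧ c < partnerHalf c a}
      = {b | b ∈ Ioo 0 (π - a) ∧ 0 < FminusHalf a b} := by
  ext b
  simp only [mem_image, mem_ofPred_eq]
  constructor
  · rintro ⟨c, ⟨hc, hlt⟩, rfl⟩
    have h := collision_partnerHalf ha ⟨ha.1.trans hc.1, hc.2⟩ hc.1
    exact ⟨⟨h.hb.1, by linarith [h.momentum, h.hc.2, h.hd.2]⟩, h.FminusHalf_pos hlt.ne⟩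
  · rintro ⟨hb, hF⟩
    obtain ⟨c, d, h, hlt⟩ := exists_collision ha ⟨hb.1, by linarith [hb.2, ha.1]⟩
      (by linarith [hb.2]) hF
    refine ⟨c, ⟨⟨h.lt, h.hc.2⟩, ?_⟩, h.eq_partnerHalf.1.symm⟩
    rw [← h.eq_partnerHalf.2]; exact hlt

theorem image_partnerHalf_gt (ha : a ∈ Ioo 0 π) :
    (fun c => partnerHalf a c) '' {c | c ∈ Ioo a π ∧ partnerHalf c a < c}
      = {b | b ∈ Ioo 0 (π - a) ∧ 0 < FminusHalf a b} := by
  ext b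
  simp only [mem_image, mem_ofPred_eq]
  constructor
  · rintro ⟨c, ⟨hc, hlt⟩, rfl⟩
    have h := collision_partnerHalf ha ⟨ha.1.trans hc.1, hc.2⟩ hc.1
    exact ⟨⟨h.hb.1, by linarith [h.momentum, h.hc.2, h.hd.2]⟩, h.FminusHalf_pos hlt.ne'⟩
  · rintro ⟨hb, hF⟩
    obtain ⟨c, d, h, hlt⟩ := exists_collision ha ⟨hb.1, by linarith [hb.2, ha.1]⟩
      (by linarith [hb.2]) hF
    refine ⟨d, ⟨⟨h.lt', h.hd.2⟩, ?_⟩, h.swap.eq_partnerHalf.1.symm⟩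
    rw [← h.swap.eq_partnerHalf.2]; exact hlt

section measurability

variable {α : Type*} [MeasurableSpace α] {f g : α → ℝ}

@[fun_prop]
theorem measurable_midAngle (hf : Measurable f) (hg : Measurable g) :
    Measurable fun x => midAngle (f x) (g x) := by
  unfold midAngle
  have : Measurable tan := by
    have : tan = fun x => sin x / cos x := funext tan_eq_sin_div_cos
    rw [this]; fun_prop
  exact measurable_arcsin.comp ((this.comp (by fun_prop)).mul (by fun_prop))

@[fun_prop]
theorem measurable_partnerHalf (hf : Measurable f) (hg : Measurable g) :
    Measurable fun x => partnerHalf (f x) (g x) := by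
  unfold partnerHalf
  exact Measurable.ite (measurableSet_lt hf hg) (by fun_prop) (by fun_prop)

@[fun_prop]
theorem measurable_FminusHalf (hf : Measurable f) (hg : Measurable g) :
    Measurable fun x => FminusHalf (f x) (g x) := by
  unfold FminusHalf; fun_prop

@[fun_prop]
theorem measurable_FplusHalf (hf : Measurable f) (hg : Measurable g) :
    Measurable fun x => FplusHalf (f x) (g x) := by
  unfold FplusHalf; fun_prop

@[fun_prop]
theorem measurable_K2Half (hf : Measurable f) (hg : Measurable g) :
    Measurable fun x => K2Half (f x) (g x) := by
  unfold K2Half; fun_prop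

@[fun_prop]
theorem measurable_K1Half (hf : Measurable f) (hg : Measurable g) :
    Measurable fun x => K1Half (f x) (g x) := by
  unfold K1Half
  exact Measurable.ite (measurableSet_lt measurable_const (by fun_prop)) (by fun_prop)
    (by fun_prop)

end measurability

/-- Each admissible `b` is reached once from c < d and once from d < c. The two halves add up to K₁,
which accounts for the 4 in K₁ against the 2 in K₂. -/
theorem lintegral_K2Half_partner_right (ha : a ∈ Ioo 0 π) (φ : ℝ → ℝ≥0∞) :
    ∫⁻ c in Ioo a π, ENNReal.ofReal (K2Half a c) * φ (partnerHalf a c)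
      = ∫⁻ b in Ioo 0 (π - a), ENNReal.ofReal (K1Half a b) * φ b := by
  have hmeas : Measurable fun c => partnerHalf c a :=
    measurable_partnerHalf measurable_id measurable_const
  have hF : Measurable fun b => FminusHalf a b :=
    measurable_FminusHalf measurable_const measurable_id
  let B : Set ℝ := {b | b ∈ Ioo 0 (π - a) ∧ 0 < FminusHalf a b}
  let s₁ : Set ℝ := {c | c ∈ Ioo a π ∧ c < partnerHalf c a}
  let s₂ : Set ℝ := {c | c ∈ Ioo a π ∧ partnerHalf c a < c}
  have m1 : MeasurableSet s₁ := measurableSet_Ioo.inter (measurableSet_lt measurable_id hmeas)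
  have m2 : MeasurableSet s₂ := measurableSet_Ioo.inter (measurableSet_lt hmeas measurable_id)
  have mB : MeasurableSet B := measurableSet_Ioo.inter (measurableSet_lt measurable_const hF)
  have hcol : ∀ {c}, c ∈ Ioo a π → Collision a (partnerHalf a c) c (partnerHalf c a) :=
    fun hc => collision_partnerHalf ha ⟨ha.1.trans hc.1, hc.2⟩ hc.1
  have hsame : ∀ {c c'}, c ∈ Ioo a π → c' ∈ Ioo a π → partnerHalf a c = partnerHalf a c' →
      c = c' ∨ c = partnerHalf c' a ∧ c' = partnerHalf c a := by
    intro c c' hc hc' h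
    have h1 := hcol hc
    have h2 := hcol hc'
    rw [← h] at h2
    rcases h1.eq_of_eq h2 with h3 | h3
    · exact Or.inl h3
    · exact Or.inr ⟨h3, by linarith [h1.momentum, h2.momentum]⟩
  have hnull : Ioo a π =ᵐ[volume] (s₁ ∪ s₂ : Set ℝ) := by
    have hsub : Set.Subsingleton {c | c ∈ Ioo a π ∧ partnerHalf c a = c} := by
      rintro c ⟨hc, h1⟩ c' ⟨hc', h2⟩
      by_contra hne
      rcases lt_or_gt_of_ne hne with hlt | hlt
      · have h3 : partnerHalf c' a < partnerHalf c a := strictAntiOn_partnerHalf ha hc hc' hlt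
        linarith
      · have h3 : partnerHalf c a < partnerHalf c' a := strictAntiOn_partnerHalf ha hc' hc hlt
        linarith
    have h0 : ∀ᵐ c, c ∉ {c | c ∈ Ioo a π ∧ partnerHalf c a = c} :=
      measure_eq_zero_iff_ae_notMem.1 (hsub.measure_zero volume)
    filter_upwards [h0] with c hc
    refine propext ⟨fun h => ?_, fun h => ?_⟩
    · rcases lt_trichotomy c (partnerHalf c a) with h1 | h1 | h1
      · exact Or.inl ⟨h, h1⟩
      · exact absurd ⟨h, h1.symm⟩ hc
      · exact Or.inr ⟨h, h1⟩
    · rcases h with h | h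
      · exact h.1
      · exact h.1
  have hdisj : Disjoint s₁ s₂ := Set.disjoint_left.2 fun c h1 h2 => lt_asymm h1.2 h2.2
  have i1 := lintegral_K2Half_partner_aux ha φ m1 (fun c hc => hc.1) (fun c hc c' hc' h => by
    rcases hsame hc.1 hc'.1 h with h3 | ⟨h3, h4⟩
    · exact h3
    · exact absurd (hc.2.trans_eq h4.symm) (lt_asymm (hc'.2.trans_eq h3.symm)))
    (fun c hc => hc.2.ne) (image_partnerHalf_lt ha)
  have i2 := lintegral_K2Half_partner_aux ha φ m2 (fun c hc => hc.1) (fun c hc c' hc' h => by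
    rcases hsame hc.1 hc'.1 h with h3 | ⟨h3, h4⟩
    · exact h3
    · exact absurd (h4.trans_lt hc.2) (lt_asymm (h3.trans_lt hc'.2)))
    (fun c hc => hc.2.ne') (image_partnerHalf_gt ha)
  have e1 : ∀ b, ENNReal.ofReal (K1Half a b) * φ b = ENNReal.ofReal (K1Half a b / 2) * φ b
      + ENNReal.ofReal (K1Half a b / 2) * φ b := fun b => by
    have h0 : 0 ≤ K1Half a b / 2 := by unfold K1Half; split_ifs <;> positivity
    rw [← add_mul, ← ENNReal.ofReal_add h0 h0, add_halves]
  have e2 : ∫⁻ b in Ioo 0 (π - a), ENNReal.ofReal (K1Half a b) * φ b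
      = ∫⁻ b in B, ENNReal.ofReal (K1Half a b) * φ b := by
    rw [← lintegral_indicator measurableSet_Ioo, ← lintegral_indicator mB]
    refine lintegral_congr fun b => ?_
    by_cases hb : b ∈ Ioo 0 (π - a)
    · by_cases hF : 0 < FminusHalf a b
      · rw [indicator_of_mem hb, indicator_of_mem (show b ∈ B from ⟨hb, hF⟩)]
      · rw [indicator_of_mem hb, indicator_of_notMem (fun h : b ∈ B => hF h.2)]
        simp [K1Half, hF]
    · rw [indicator_of_notMem hb, indicator_of_notMem (fun h : b ∈ B => hb h.1)]
  calc _ = ∫⁻ c in s₁ ∪ s₂, ENNReal.ofReal (K2Half a c) * φ (partnerHalf a c) :=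
        setLIntegral_congr hnull
    _ = _ := lintegral_union m2 hdisj
    _ = ∫⁻ b in B, ENNReal.ofReal (K1Half a b) * φ b := by
        rw [i1, i2, ← two_mul, ← lintegral_const_mul' _ _ (by simp)]
        refine lintegral_congr fun b => ?_
        rw [e1, two_mul]
    _ = _ := e2.symm

end fiber

end FPU

/-! ### Mirror symmetry and return to the variables of the cell -/

namespace FPU

open Real Set

open scoped ENNReal

theorem lintegral_Ioo_reflect (p q r : ℝ) (G : ℝ → ℝ≥0∞) :
    ∫⁻ c in Ioo p q, G c = ∫⁻ c in Ioo (r - q) (r - p), G (r - c) := by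
  have h1 : (fun c => r - c) '' Ioo (r - q) (r - p) = Ioo p q := by
    rw [image_const_sub_Ioo]; congr 1 <;> ring
  rw [← h1, lintegral_image_eq_lintegral_abs_deriv_mul measurableSet_Ioo
    (f := fun c => r - c)
    (f' := fun _ => -1) (fun c _ => ((hasDerivAt_id c).const_sub r).hasDerivWithinAt)
    (fun c _ c' _ h => by simpa using h)]
  simp

theorem lintegral_Ioo_split {p q r : ℝ} (h1 : p < q) (h2 : q < r) (G : ℝ → ℝ≥0∞) :
    ∫⁻ c in Ioo p r, G c = (∫⁻ c in Ioo p q, G c) + ∫⁻ c in Ioo q r, G c := by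
  have h0 : ∀ᵐ c : ℝ, c ≠ q := by simp [ae_iff]
  have : Ioo p r =ᵐ[volume] (Ioo p q ∪ Ioo q r : Set ℝ) := by
    filter_upwards [h0] with c hc
    refine propext ⟨fun h => ?_, fun h => ?_⟩
    · rcases lt_or_gt_of_ne hc with h' | h'
      · exact Or.inl ⟨h.1, h'⟩
      · exact Or.inr ⟨h', h.2⟩
    · rcases h with h | h
      · exact ⟨h.1, h.2.trans h2⟩
      · exact ⟨h1.trans h.1, h.2⟩
  rw [setLIntegral_congr this, lintegral_union measurableSet_Ioo]
  exact Set.disjoint_left.2 fun c h h' => lt_asymm h.2 h'.1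

theorem FplusHalf_mirror (a c : ℝ) : FplusHalf (π - a) (π - c) = FplusHalf a c := by
  unfold FplusHalf; simp only [cos_pi_sub, sin_pi_sub]; ring

theorem FminusHalf_mirror (a c : ℝ) : FminusHalf (π - a) (π - c) = FminusHalf a c := by
  unfold FminusHalf; simp only [cos_pi_sub, sin_pi_sub]; ring

theorem K2Half_mirror (a c : ℝ) : K2Half (π - a) (π - c) = K2Half a c := by
  unfold K2Half; rw [FplusHalf_mirror]

theorem K1Half_mirror (a c : ℝ) : K1Half (π - a) (π - c) = K1Half a c := by
  unfold K1Half; rw [FminusHalf_mirror]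

theorem lintegral_K2Half_exchange {a : ℝ} (ha : a ∈ Ioo 0 π) (φ : ℝ → ℝ≥0∞) :
    ∫⁻ c in Ioo 0 π, ENNReal.ofReal (K2Half a c) * φ (partnerHalf c a)
      = ∫⁻ c in Ioo 0 π, ENNReal.ofReal (K2Half a c) * φ c := by
  rw [lintegral_Ioo_split ha.1 ha.2, lintegral_Ioo_split ha.1 ha.2,
    lintegral_K2Half_exchange_right ha, lintegral_Ioo_reflect 0 a π, lintegral_Ioo_reflect 0 a π]
  congr 1
  have h := lintegral_K2Half_exchange_right (pi_sub_mem ha) fun c => φ (π - c)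
  rw [sub_zero]
  convert h using 1
  · refine setLIntegral_congr_fun measurableSet_Ioo fun c hc => ?_
    have h1 := partnerHalf_mirror (a := c) (c := π - a) hc.1.ne'
    have h2 := K2Half_mirror a (π - c)
    rw [sub_sub_cancel] at h1 h2
    rw [h1, h2]
  · refine setLIntegral_congr_fun measurableSet_Ioo fun c hc => ?_
    have h2 := K2Half_mirror a (π - c)
    rw [sub_sub_cancel] at h2
    rw [h2]

/-- Outgoing c > a produces b < π - a. The mirror image of that case shows that c < a produces b > π
- a, so the two splittings match in reversed order. -/
theorem lintegral_K2Half_partner {a : ℝ} (ha : a ∈ Ioo 0 π) (φ : ℝ → ℝ≥0∞) :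
    ∫⁻ c in Ioo 0 π, ENNReal.ofReal (K2Half a c) * φ (partnerHalf a c)
      = ∫⁻ b in Ioo 0 π, ENNReal.ofReal (K1Half a b) * φ b := by
  have ha' := pi_sub_mem ha
  rw [lintegral_Ioo_split ha.1 ha.2, lintegral_Ioo_split ha'.1 ha'.2,
    lintegral_K2Half_partner_right ha, add_comm, lintegral_Ioo_reflect 0 a π,
    lintegral_Ioo_reflect (π - a) π π]
  congr 1
  have h := lintegral_K2Half_partner_right ha' fun c => φ (π - c)
  rw [sub_zero, sub_self]
  convert h using 1
  · refine setLIntegral_congr_fun measurableSet_Ioo fun c hc => ?_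
    have h1 := partnerHalf_mirror (a := π - a) (c := c) hc.1.ne
    have h2 := K2Half_mirror a (π - c)
    rw [sub_sub_cancel] at h1 h2
    rw [h1, h2]
  · refine setLIntegral_congr_fun measurableSet_Ioo fun c hc => ?_
    have h2 := K1Half_mirror a (π - c)
    rw [sub_sub_cancel] at h2
    rw [h2]

/-- Lebesgue measure on the basic cell. -/
noncomputable abbrev volI : Measure ℝ := volume.restrict I

theorem volI_eq : volI = volume.restrict (Ioo 0 (2 * π)) :=
  Measure.restrict_congr_set Ioo_ae_eq_Ico.symm

theorem ae_volI_mem : ∀ᵐ x ∂volI, x ∈ Ioo 0 (2 * π) := by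
  rw [volI_eq]; exact ae_restrict_mem measurableSet_Ioo

theorem lintegral_volI (G : ℝ → ℝ≥0∞) :
    ∫⁻ x, G x ∂volI = 2 * ∫⁻ c in Ioo 0 π, G (2 * c) := by
  have h1 : (fun c => 2 * c) '' Ioo 0 π = Ioo 0 (2 * π) := by
    rw [image_mul_left_Ioo two_pos, mul_zero]
  have h2 := lintegral_image_eq_lintegral_abs_deriv_mul measurableSet_Ioo
    (f' := fun _ => 2) (fun c _ => ((hasDerivAt_id c).const_mul 2).hasDerivWithinAt.congr_deriv
      (mul_one (2 : ℝ))) (s := Ioo 0 π) (fun c _ c' _ h => by simpa using h) G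
  rw [volI_eq, ← lintegral_const_mul' _ _ (by simp)]
  simp only [id] at h2
  rw [h1] at h2
  rw [h2]
  simp

/-- The momentum of the collision partner of `x` when `x` is scattered into `z`. -/
noncomputable def partner (x z : ℝ) : ℝ := 2 * partnerHalf (x / 2) (z / 2)

theorem half_mem {x : ℝ} (hx : x ∈ Ioo 0 (2 * π)) : x / 2 ∈ Ioo 0 π :=
  ⟨by linarith [hx.1], by linarith [hx.2]⟩

theorem K2_eq_half (x y : ℝ) : K2 x y = K2Half (x / 2) (y / 2) := rfl

theorem K1_eq_half (x y : ℝ) : K1 x y = K1Half (x / 2) (y / 2) := rfl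

theorem partner_mem {x z : ℝ} (hx : x ∈ Ioo 0 (2 * π)) (hz : z ∈ Ioo 0 (2 * π)) (h : x ≠ z) :
    partner x z ∈ Ioo 0 (2 * π) := by
  have := partnerHalf_mem (half_mem hx) (half_mem hz) (fun h' => h (by linarith))
  exact ⟨by unfold partner; linarith [this.1], by unfold partner; linarith [this.2]⟩

theorem partner_relations {x z : ℝ} (hx : x ∈ Ioo 0 (2 * π)) (hz : z ∈ Ioo 0 (2 * π))
    (h : x ≠ z) : x ≠ partner z x ∧ partner x (partner z x) = partner x z ∧
      partner (partner z x) x = z := by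
  obtain ⟨h1, h2, h3⟩ := partnerHalf_relations (half_mem hx) (half_mem hz)
    (fun h' => h (by linarith))
  unfold partner
  simp only [mul_div_cancel_left₀ _ (two_ne_zero' ℝ)]
  exact ⟨fun h' => h1 (by linarith), by rw [h2], by linarith⟩

theorem lintegral_K2_exchange {x : ℝ} (hx : x ∈ Ioo 0 (2 * π)) (φ : ℝ → ℝ≥0∞) :
    ∫⁻ z, ENNReal.ofReal (K2 x z) * φ (partner z x) ∂volI
      = ∫⁻ z, ENNReal.ofReal (K2 x z) * φ z ∂volI := by
  have := lintegral_K2Half_exchange (half_mem hx) fun c => φ (2 * c)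
  rw [lintegral_volI, lintegral_volI]
  simp only [K2_eq_half, partner, mul_div_cancel_left₀ _ (two_ne_zero' ℝ)]
  rw [this]

theorem lintegral_K2_partner {x : ℝ} (hx : x ∈ Ioo 0 (2 * π)) (φ : ℝ → ℝ≥0∞) :
    ∫⁻ z, ENNReal.ofReal (K2 x z) * φ (partner x z) ∂volI
      = ∫⁻ y, ENNReal.ofReal (K1 x y) * φ y ∂volI := by
  have := lintegral_K2Half_partner (half_mem hx) fun c => φ (2 * c)
  rw [lintegral_volI, lintegral_volI]
  simp only [K2_eq_half, K1_eq_half, partner, mul_div_cancel_left₀ _ (two_ne_zero' ℝ)]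
  rw [this]

section measurability

variable {α : Type*} [MeasurableSpace α] {f g : α → ℝ}

@[fun_prop]
theorem measurable_partner (hf : Measurable f) (hg : Measurable g) :
    Measurable fun x => partner (f x) (g x) := by
  unfold partner; fun_prop

@[fun_prop]
theorem measurable_K2 (hf : Measurable f) (hg : Measurable g) :
    Measurable fun x => K2 (f x) (g x) := by
  simp only [K2_eq_half]; fun_prop

@[fun_prop]
theorem measurable_K1 (hf : Measurable f) (hg : Measurable g) :
    Measurable fun x => K1 (f x) (g x) := by
  simp only [K1_eq_half]; fun_prop

@[fun_prop]
theorem measurable_Fminus (hf : Measurable f) (hg : Measurable g) :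
    Measurable fun x => Fminus (f x) (g x) := by
  unfold Fminus; fun_prop

@[fun_prop]
theorem measurable_omega (hf : Measurable f) : Measurable fun x => omega (f x) := by
  have : Measurable omega := by unfold omega; fun_prop
  exact this.comp hf

end measurability

theorem K1_nonneg (x y : ℝ) : 0 ≤ K1 x y := by unfold K1; split_ifs <;> positivity

theorem K2_nonneg (x y : ℝ) : 0 ≤ K2 x y := by unfold K2; positivity

theorem K1_comm (x y : ℝ) : K1 x y = K1 y x := by
  have : Fminus x y = Fminus y x := by unfold Fminus; ring
  unfold K1; rw [this]

theorem Fminus_comm (x y : ℝ) : Fminus x y = Fminus y x := by unfold Fminus; ring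

theorem K2_comm (x y : ℝ) : K2 x y = K2 y x := by
  have : Fplus x y = Fplus y x := by unfold Fplus; ring
  unfold K2; rw [this]

end FPU

/-! ### Pointwise bounds on the kernels -/

namespace FPU

open Real Set

open scoped ENNReal

theorem rpow_neg_pow_eq {t r : ℝ} (ht : 0 < t) (n m : ℕ) (h : r * n = m) :
    (t ^ (-r)) ^ n = 1 / t ^ m := by
  rw [← rpow_natCast, ← rpow_mul ht.le, neg_mul, h, rpow_neg ht.le, rpow_natCast, one_div]

section pointwise

variable {a c : ℝ}

theorem FplusHalf_comm (a c : ℝ) : FplusHalf a c = FplusHalf c a := by unfold FplusHalf; ring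

theorem four_mul_sin_le_FplusHalf (a c : ℝ) : 4 * (sin a * sin c) ≤ FplusHalf a c := by
  unfold FplusHalf; nlinarith [sq_nonneg (cos a + cos c)]

theorem FplusHalf_pos (ha : a ∈ Ioo 0 π) (hc : c ∈ Ioo 0 π) : 0 < FplusHalf a c :=
  (by have := sin_pos_of_mem_Ioo ha; have := sin_pos_of_mem_Ioo hc; positivity :
    0 < 4 * (sin a * sin c)).trans_le (four_mul_sin_le_FplusHalf a c)

theorem K2Half_pos (ha : a ∈ Ioo 0 π) (hc : c ∈ Ioo 0 π) : 0 < K2Half a c := by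
  have := FplusHalf_pos ha hc; unfold K2Half; positivity

theorem K2Half_sq (ha : a ∈ Ioo 0 π) (hc : c ∈ Ioo 0 π) :
    K2Half a c ^ 2 = 4 / FplusHalf a c := by
  unfold K2Half; rw [div_pow, sq_sqrt (FplusHalf_pos ha hc).le]; norm_num

theorem K2Half_sq_le (ha : a ∈ Ioo 0 π) (hc : c ∈ Ioo 0 π) :
    K2Half a c ^ 2 ≤ 1 / (sin a * sin c) := by
  have := sin_pos_of_mem_Ioo ha
  have := sin_pos_of_mem_Ioo hc
  rw [K2Half_sq ha hc, div_le_div_iff₀ (FplusHalf_pos ha hc) (by positivity), one_mul]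
  exact four_mul_sin_le_FplusHalf a c

/-- From sin² a - sin² c = (cos c - cos a)(cos c + cos a) one gets (cos a + cos c)² ≥ (sin² a - sin²
c)² / 4. The loss near sin a = sin c is repaired by 4 sin a sin c ≥ 4 (sin a sin c)². -/
theorem sin_pow_four_le_FplusHalf (ha : a ∈ Ioo 0 π) (hc : c ∈ Ioo 0 π) :
    sin c ^ 4 / 4 ≤ FplusHalf a c := by
  have h1 := sin_pos_of_mem_Ioo ha
  have h2 := sin_pos_of_mem_Ioo hc
  have h3 := sin_le_one a
  have h4 := sin_le_one c
  have e1 : (sin a ^ 2 - sin c ^ 2) ^ 2 = (cos c - cos a) ^ 2 * (cos a + cos c) ^ 2 := by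
    rw [sin_sq, sin_sq]; ring
  have e2 : (cos c - cos a) ^ 2 ≤ 4 := by
    have := abs_le.1 (abs_cos_le_one a)
    have := abs_le.1 (abs_cos_le_one c)
    nlinarith
  have e3 : (sin a ^ 2 - sin c ^ 2) ^ 2 ≤ 4 * (cos a + cos c) ^ 2 := by
    rw [e1]; exact mul_le_mul_of_nonneg_right e2 (sq_nonneg _)
  have e4 : (sin a * sin c) ^ 2 ≤ sin a * sin c := by
    have : sin a * sin c ≤ 1 := mul_le_one₀ h3 h2.le h4
    nlinarith [mul_pos h1 h2]
  unfold FplusHalf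
  nlinarith [sq_nonneg (sin a ^ 2), mul_pos h1 h2]

theorem K2Half_le_sin_sq (ha : a ∈ Ioo 0 π) (hc : c ∈ Ioo 0 π) :
    K2Half a c ≤ 4 / sin c ^ 2 := by
  have h2 := sin_pos_of_mem_Ioo hc
  refine le_of_sq_le_sq ?_ (by positivity)
  rw [K2Half_sq ha hc, div_pow, div_le_div_iff₀ (FplusHalf_pos ha hc) (by positivity)]
  nlinarith [sin_pow_four_le_FplusHalf ha hc]

/-- K₂ is singular only near opposite ends of the interval; when the cosines are close, F₊ ≥ 1. -/
theorem K2Half_le_two (ha : a ∈ Ioo 0 π) (hc : c ∈ Ioo 0 π) (h : |cos a - cos c| ≤ 1) :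
    K2Half a c ≤ 2 := by
  have h1 := sin_pos_of_mem_Ioo ha
  have h2 := sin_pos_of_mem_Ioo hc
  have key : 1 ≤ FplusHalf a c := by
    have e4 : (sin a * sin c) ^ 2 ≤ sin a * sin c := by
      have : sin a * sin c ≤ 1 := mul_le_one₀ (sin_le_one a) h2.le (sin_le_one c)
      nlinarith [mul_pos h1 h2]
    have e5 : (cos a - cos c) ^ 2 ≤ 1 := by rw [← sq_abs]; exact pow_le_one₀ (abs_nonneg _) h
    have e6 : (sin a * sin c) ^ 2 = (1 - cos a ^ 2) * (1 - cos c ^ 2) := by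
      rw [mul_pow, sin_sq, sin_sq]
    have e7 := cos_sq_le_one a
    have e8 := cos_sq_le_one c
    unfold FplusHalf
    nlinarith [mul_nonneg (sub_nonneg.2 e7) (sub_nonneg.2 e8), sq_nonneg (cos a), sq_nonneg (cos c),
      mul_nonneg (sq_nonneg (cos a)) (sq_nonneg (cos c))]
  refine le_of_sq_le_sq ?_ (by positivity)
  rw [K2Half_sq ha hc, div_le_iff₀ (by linarith)]
  linarith

/-- Rationalizing, √F₊ - |cos a + cos c| = 4 sin a sin c / (√F₊ + |cos a + cos c|), and the
denominator is at most 2√F₊. -/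
theorem mul_sqrt_FplusHalf (ha : a ∈ Ioo 0 π) (hc : c ∈ Ioo 0 π) :
    sin a * sin c * K2Half a c ≤ √(FplusHalf a c) - |cos a + cos c| := by
  have hF := FplusHalf_pos ha hc
  have h1 := sin_pos_of_mem_Ioo ha
  have h2 := sin_pos_of_mem_Ioo hc
  have hs := sqrt_pos.2 hF
  have e1 : |cos a + cos c| ≤ √(FplusHalf a c) := by
    rw [← sqrt_sq_eq_abs]
    exact sqrt_le_sqrt (by unfold FplusHalf; nlinarith [mul_pos h1 h2])
  have e2 : √(FplusHalf a c) ^ 2 - |cos a + cos c| ^ 2 = 4 * (sin a * sin c) := by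
    rw [sq_sqrt hF.le, sq_abs]; unfold FplusHalf; ring
  unfold K2Half
  rw [mul_div_assoc', div_le_iff₀ hs]
  nlinarith [abs_nonneg (cos a + cos c)]

/-- The partner cannot be too soft: this lower bound on its frequency controls negative powers of ω
at the partner, and through the change of variables the K₁ integrals. -/
theorem sin_partnerHalf_ge (ha : a ∈ Ioo 0 π) (hc : c ∈ Ioo 0 π) (h : a ≠ c) :
    |cos a - cos c| * (sin a * sin c * K2Half a c)
      ≤ 2 * sin (partnerHalf a c) * (sin a + sin c) := by
  have h0 := mul_sqrt_FplusHalf ha hc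
  have h1 := sin_pos_of_mem_Ioo ha
  have h2 := sin_pos_of_mem_Ioo hc
  rcases lt_or_gt_of_ne h with h | h
  · have hcol := collision_partnerHalf ha hc h
    have h3 : cos c < cos a := cos_lt_cos_of_nonneg_of_le_pi ha.1.le hc.2.le h
    rw [hcol.sin_partner_mul, abs_of_pos (sub_pos.2 h3)]
    rw [hcol.FplusHalf_eq, sqrt_sq (sub_pos.2 hcol.cos_lt_cos).le] at h0
    exact mul_le_mul_of_nonneg_left (h0.trans (by linarith [neg_abs_le (cos a + cos c)]))
      (sub_pos.2 h3).le
  · have hcol := collision_partnerHalf hc ha h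
    have h3 : cos a < cos c := cos_lt_cos_of_nonneg_of_le_pi hc.1.le ha.2.le h
    rw [add_comm (sin a), hcol.sin_partner_mul', abs_of_neg (sub_neg.2 h3)]
    rw [FplusHalf_comm, hcol.FplusHalf_eq, sqrt_sq (sub_pos.2 hcol.cos_lt_cos).le] at h0
    rw [neg_sub]
    exact mul_le_mul_of_nonneg_left (h0.trans (by linarith [le_abs_self (cos a + cos c)]))
      (sub_pos.2 h3).le

theorem cos_sub_cos_ge (ha : a ∈ Ioo 0 π) (hc : c ∈ Ioo 0 π) :
    (sin a + sin c) * |a - c| ≤ π * |cos a - cos c| := by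
  wlog h : a ≤ c generalizing a c
  · have := this hc ha (le_of_not_ge h)
    rwa [add_comm, abs_sub_comm, abs_sub_comm (cos a)]
  obtain ⟨ha0, ha1⟩ := ha
  obtain ⟨hc0, hc1⟩ := hc
  have h3 : cos c ≤ cos a := cos_le_cos_of_nonneg_of_le_pi ha0.le hc1.le h
  rw [abs_of_nonpos (by linarith), abs_of_nonneg (by linarith)]
  have e1 : cos a - cos c = 2 * sin ((a + c) / 2) * sin ((c - a) / 2) := by
    rw [cos_sub_cos, show (a - c) / 2 = -((c - a) / 2) by ring, sin_neg]; ring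
  have e2 : sin a + sin c = 2 * sin ((a + c) / 2) * cos ((c - a) / 2) := by
    rw [show (c - a) / 2 = -((a - c) / 2) by ring, cos_neg]
    simpa [← sub_eq_add_neg] using sin_sub_sin a (-c)
  have e3 : 0 < sin ((a + c) / 2) := sin_pos_of_pos_of_lt_pi (by linarith) (by linarith)
  have e4 : 2 / π * ((c - a) / 2) ≤ sin ((c - a) / 2) := mul_le_sin (by linarith) (by linarith)
  have e5 : c - a ≤ π * sin ((c - a) / 2) := by
    have := mul_le_mul_of_nonneg_left e4 pi_pos.le
    have e : π * (2 / π * ((c - a) / 2)) = c - a := by field_simp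
    linarith
  have e6 := cos_le_one ((c - a) / 2)
  have e7 : 0 ≤ cos ((c - a) / 2) := cos_nonneg_of_mem_Icc ⟨by linarith, by linarith⟩
  rw [e1, e2]
  calc 2 * sin ((a + c) / 2) * cos ((c - a) / 2) * -(a - c)
      ≤ 2 * sin ((a + c) / 2) * 1 * (c - a) := by
        rw [neg_sub]; gcongr
    _ ≤ 2 * sin ((a + c) / 2) * 1 * (π * sin ((c - a) / 2)) := by gcongr
    _ = _ := by ring

/-- The right side is integrable in `c` since both exponents exceed -1, and it costs only sin a to
the power -1/2. The power -2/5 on the left is the growth of ω times the approximate resolvent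
solution. -/
theorem K2Half_mul_sin_partner_rpow_le (ha : a ∈ Ioo 0 π) (hc : c ∈ Ioo 0 π) (h : a ≠ c) :
    K2Half a c * sin (partnerHalf a c) ^ (-(2 / 5) : ℝ)
      ≤ 8 * sin a ^ (-(1 / 2) : ℝ) *
        (sin c ^ (-(9 / 10) : ℝ) + |a - c| ^ (-(4 / 5) : ℝ)) := by
  have h1 := sin_pos_of_mem_Ioo ha
  have h2 := sin_pos_of_mem_Ioo hc
  have h1' := sin_le_one a
  have h2' := sin_le_one c
  have hK := K2Half_pos ha hc
  have hb := sin_pos_of_mem_Ioo (partnerHalf_mem ha hc h)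
  have hge := sin_partnerHalf_ge ha hc h
  have hac : 0 < |a - c| := abs_pos.2 (sub_ne_zero.2 h)
  have hsq := K2Half_sq_le ha hc
  set K := K2Half a c
  set b := sin (partnerHalf a c)
  set p := sin a
  set q := sin c
  have hX10 : (K * b ^ (-(2 / 5) : ℝ)) ^ 10 = K ^ 10 / b ^ 4 := by
    rw [mul_pow, rpow_neg_pow_eq hb 10 4 (by norm_num), mul_one_div]
  have hp10 : (p ^ (-(1 / 2) : ℝ)) ^ 10 = 1 / p ^ 5 :=
    rpow_neg_pow_eq h1 10 5 (by norm_num)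
  have hq10 : (q ^ (-(9 / 10) : ℝ)) ^ 10 = 1 / q ^ 9 :=
    rpow_neg_pow_eq h2 10 9 (by norm_num)
  -- Away from the diagonal `b` is at least a multiple of p q K / (p + q), and tenth powers clear
  -- all exponents. Near the diagonal K ≤ 2 and `b` is at least a multiple of |a - c| p q K.
  rcases le_total 1 |cos a - cos c| with hcos | hcos
  · have hge1 : p * q * K ≤ 2 * b * (p + q) :=
      le_trans (by nlinarith [mul_pos (mul_pos h1 h2) hK]) hge
    suffices K * b ^ (-(2 / 5) : ℝ) ≤ 8 * p ^ (-(1 / 2) : ℝ) * q ^ (-(9 / 10) : ℝ) by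
      refine this.trans ?_
      gcongr
      exact le_add_of_nonneg_right (by positivity)
    refine le_of_pow_le_pow_left₀ (n := 10) (by norm_num) (by positivity) ?_
    rw [hX10, mul_pow, mul_pow, hp10, hq10]
    rcases le_total p q with hpq | hpq
    · have e1 : p * K / 4 ≤ b := by
        have : p * q * K ≤ 4 * b * q := by nlinarith
        have : p * K * q ≤ 4 * b * q := by linarith
        linarith [le_of_mul_le_mul_right this h2]
      have e2 : K ^ 2 * (p * q) ≤ 1 := by rwa [le_div_iff₀ (by positivity)] at hsq
      have e3 : K * q ^ 2 ≤ 4 := by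
        have := K2Half_le_sin_sq ha hc
        rwa [le_div_iff₀ (by positivity)] at this
      have e4 : K ^ 6 * (p * q ^ 9) ≤ 4 ^ 4 := by
        have : (K * q ^ 2) ^ 4 ≤ 4 ^ 4 := pow_le_pow_left₀ (by positivity) e3 4
        calc K ^ 6 * (p * q ^ 9) = (K ^ 2 * (p * q)) * (K * q ^ 2) ^ 4 := by ring
          _ ≤ 1 * 4 ^ 4 := by gcongr
          _ = _ := by ring
      calc K ^ 10 / b ^ 4 ≤ K ^ 10 / (p * K / 4) ^ 4 := by gcongr
        _ = 4 ^ 4 * (K ^ 6 * (p * q ^ 9)) / (p ^ 5 * q ^ 9) := by field_simp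
        _ ≤ 4 ^ 4 * 4 ^ 4 / (p ^ 5 * q ^ 9) := by gcongr
        _ ≤ 8 ^ 10 / (p ^ 5 * q ^ 9) := by gcongr; norm_num
        _ = _ := by field_simp
    · have e1 : q * K / 4 ≤ b := by
        have : q * K * p ≤ 4 * b * p := by nlinarith
        linarith [le_of_mul_le_mul_right this h1]
      have e2 : K ^ 2 * (p * q) ≤ 1 := by rwa [le_div_iff₀ (by positivity)] at hsq
      have e4 : K ^ 6 * (p ^ 5 * q ^ 5) ≤ 1 := by
        calc K ^ 6 * (p ^ 5 * q ^ 5) = (K ^ 2 * (p * q)) ^ 3 * (p * q) ^ 2 := by ring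
          _ ≤ 1 ^ 3 * 1 ^ 2 := by
            gcongr
            exact mul_le_one₀ h1' h2.le h2'
          _ = _ := by ring
      calc K ^ 10 / b ^ 4 ≤ K ^ 10 / (q * K / 4) ^ 4 := by gcongr
        _ = 4 ^ 4 * (K ^ 6 * (p ^ 5 * q ^ 5)) / (p ^ 5 * q ^ 9) := by field_simp
        _ ≤ 4 ^ 4 * 1 / (p ^ 5 * q ^ 9) := by gcongr
        _ ≤ 8 ^ 10 / (p ^ 5 * q ^ 9) := by gcongr; norm_num
        _ = _ := by field_simp
  · have hK2 : K ≤ 2 := K2Half_le_two ha hc hcos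
    have hcs := cos_sub_cos_ge ha hc
    have e1 : |a - c| * (p * q) * K / 8 ≤ b := by
      have e2 : (p + q) * |a - c| ≤ 4 * |cos a - cos c| :=
        hcs.trans (by gcongr; exact pi_le_four)
      have e3 : (p + q) * (|a - c| * (p * q) * K) ≤ (p + q) * (8 * b) :=
        calc (p + q) * (|a - c| * (p * q) * K) = ((p + q) * |a - c|) * (p * q * K) := by ring
          _ ≤ (4 * |cos a - cos c|) * (p * q * K) := by gcongr
          _ ≤ 4 * (2 * b * (p + q)) := by linarith
          _ = _ := by ring
      linarith [le_of_mul_le_mul_left e3 (by positivity)]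
    have e5 : (K * b ^ (-(2 / 5) : ℝ)) ^ 5 = K ^ 5 / b ^ 2 := by
      rw [mul_pow, rpow_neg_pow_eq hb 5 2 (by norm_num), mul_one_div]
    have e6 : ∀ t : ℝ, 0 < t → (t ^ (-(2 / 5) : ℝ)) ^ 5 = 1 / t ^ 2 := fun t ht =>
      rpow_neg_pow_eq ht 5 2 (by norm_num)
    have e7 : K * b ^ (-(2 / 5) : ℝ) ≤
        8 * (p ^ (-(2 / 5) : ℝ) * (q ^ (-(2 / 5) : ℝ) * |a - c| ^ (-(2 / 5) : ℝ))) := by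
      refine le_of_pow_le_pow_left₀ (n := 5) (by norm_num) (by positivity) ?_
      rw [e5, mul_pow, mul_pow, mul_pow, e6 p h1, e6 q h2, e6 _ hac]
      calc K ^ 5 / b ^ 2 ≤ K ^ 5 / (|a - c| * (p * q) * K / 8) ^ 2 := by gcongr
        _ = 8 ^ 2 * K ^ 3 / (p ^ 2 * q ^ 2 * |a - c| ^ 2) := by
          field_simp
        _ ≤ 8 ^ 2 * 2 ^ 3 / (p ^ 2 * q ^ 2 * |a - c| ^ 2) := by gcongr
        _ ≤ 8 ^ 5 / (p ^ 2 * q ^ 2 * |a - c| ^ 2) := by gcongr; norm_num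
        _ = _ := by field_simp
    have e8 : p ^ (-(2 / 5) : ℝ) ≤ p ^ (-(1 / 2) : ℝ) :=
      rpow_le_rpow_of_exponent_ge h1 h1' (by norm_num)
    have e9 : q ^ (-(4 / 5) : ℝ) ≤ q ^ (-(9 / 10) : ℝ) :=
      rpow_le_rpow_of_exponent_ge h2 h2' (by norm_num)
    have e10 : ∀ t : ℝ, 0 < t → (t ^ (-(2 / 5) : ℝ)) ^ 2 = t ^ (-(4 / 5) : ℝ) := fun t ht => by
      rw [← rpow_natCast, ← rpow_mul ht.le]
      norm_num
    have e11 : q ^ (-(2 / 5) : ℝ) * |a - c| ^ (-(2 / 5) : ℝ)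
        ≤ q ^ (-(9 / 10) : ℝ) + |a - c| ^ (-(4 / 5) : ℝ) := by
      have := two_mul_le_add_sq (q ^ (-(2 / 5) : ℝ)) (|a - c| ^ (-(2 / 5) : ℝ))
      rw [e10 q h2, e10 _ hac] at this
      have : 0 < q ^ (-(2 / 5) : ℝ) * |a - c| ^ (-(2 / 5) : ℝ) := by positivity
      linarith
    calc _ ≤ _ := e7
      _ ≤ 8 * (p ^ (-(1 / 2) : ℝ) * (q ^ (-(9 / 10) : ℝ) + |a - c| ^ (-(4 / 5) : ℝ))) := by
        gcongr
      _ = _ := by ring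

theorem K2Half_mul_sin_rpow_le (ha : a ∈ Ioo 0 π) (hc : c ∈ Ioo 0 π) :
    K2Half a c * sin c ^ (-(2 / 5) : ℝ) ≤ sin a ^ (-(1 / 2) : ℝ) * sin c ^ (-(9 / 10) : ℝ) := by
  have h1 := sin_pos_of_mem_Ioo ha
  have h2 := sin_pos_of_mem_Ioo hc
  have e : K2Half a c ≤ sin a ^ (-(1 / 2) : ℝ) * sin c ^ (-(1 / 2) : ℝ) := by
    refine le_of_sq_le_sq ((K2Half_sq_le ha hc).trans_eq ?_) (by positivity)
    rw [mul_pow, ← rpow_natCast, ← rpow_natCast, ← rpow_mul h1.le, ← rpow_mul h2.le]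
    norm_num [rpow_neg_one]
    ring
  calc _ ≤ (sin a ^ (-(1 / 2) : ℝ) * sin c ^ (-(1 / 2) : ℝ)) * sin c ^ (-(2 / 5) : ℝ) := by gcongr
    _ = _ := by rw [mul_assoc, ← rpow_add h2]; norm_num

/-- The bounds K c² ≤ 16 and K √(sin a · c) ≤ 2 add up. Their balance at c of order (sin a)^(1/3)
produces the exponent -1/3 of V. -/
theorem K2Half_le_profile (ha : a ∈ Ioo 0 π) (hc : c ∈ Ioc 0 (π / 2)) :
    K2Half a c ≤ 32 / (c ^ 2 + √(sin a * c)) := by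
  have hc' : c ∈ Ioo 0 π := ⟨hc.1, by linarith [hc.2, pi_pos]⟩
  have h0 := hc.1
  have h1 := sin_pos_of_mem_Ioo ha
  have h2 := sin_pos_of_mem_Ioo hc'
  have hK := K2Half_pos ha hc'
  have e1 : c / 2 ≤ sin c := by
    refine le_trans ?_ (mul_le_sin hc.1.le hc.2)
    rw [div_mul_eq_mul_div, le_div_iff₀ pi_pos]
    nlinarith [pi_le_four]
  have e3 : K2Half a c * c ^ 2 ≤ 16 := by
    have := K2Half_le_sin_sq ha hc'
    rw [le_div_iff₀ (by positivity)] at this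
    have : K2Half a c * (c / 2) ^ 2 ≤ K2Half a c * sin c ^ 2 := by gcongr
    linarith
  have e4 : K2Half a c * √(sin a * c) ≤ 2 := by
    refine le_of_sq_le_sq ?_ (by norm_num)
    rw [mul_pow, sq_sqrt (by positivity)]
    have := K2Half_sq_le ha hc'
    rw [le_div_iff₀ (by positivity)] at this
    have e : K2Half a c ^ 2 * (sin a * (c / 2)) ≤ K2Half a c ^ 2 * (sin a * sin c) := by gcongr
    linarith
  rw [le_div_iff₀ (by positivity)]
  linarith

end pointwise

end FPU

/-! ### Integral bounds: the collision rate is of order ω^(-1/3) -/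

namespace FPU

open Real Set

open scoped ENNReal

theorem exists_eq_ofReal {A : ℝ≥0∞} (h : A < ⊤) : ∃ r : ℝ, 0 ≤ r ∧ A = ENNReal.ofReal r :=
  ⟨A.toReal, ENNReal.toReal_nonneg, (ENNReal.ofReal_toReal h.ne).symm⟩

theorem lintegral_Ioo_rpow_lt_top {κ : ℝ} (hκ : κ < 1) (M : ℝ) :
    ∫⁻ c in Ioo 0 M, ENNReal.ofReal (c ^ (-κ)) < ⊤ := by
  rcases le_or_gt M 0 with hM | hM
  · simp [Ioo_eq_empty (not_lt.2 hM)]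
  have h : IntegrableOn (fun c : ℝ => c ^ (-κ)) (Ioo 0 M) := by
    have := intervalIntegral.intervalIntegrable_rpow' (a := 0) (b := M) (r := -κ) (by linarith)
    rw [intervalIntegrable_iff_integrableOn_Ioo_of_le hM.le] at this
    exact this
  exact h.lintegral_lt_top

theorem lintegral_sin_rpow_lt_top {κ : ℝ} (hκ0 : 0 ≤ κ) (hκ : κ < 1) :
    ∫⁻ c in Ioo 0 π, ENNReal.ofReal (sin c ^ (-κ)) < ⊤ := by
  have hp := pi_pos
  have key : ∫⁻ c in Ioo 0 (π / 2), ENNReal.ofReal (sin c ^ (-κ)) < ⊤ := by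
    have h1 : ∫⁻ c in Ioo 0 (π / 2), ENNReal.ofReal (sin c ^ (-κ))
        ≤ ∫⁻ c in Ioo 0 (π / 2), ENNReal.ofReal ((2 / π) ^ (-κ)) * ENNReal.ofReal (c ^ (-κ)) := by
      refine setLIntegral_mono' measurableSet_Ioo fun c hc => ?_
      rw [← ENNReal.ofReal_mul (by positivity), ← mul_rpow (by positivity) hc.1.le]
      refine ENNReal.ofReal_le_ofReal ?_
      have h0 := hc.1
      exact rpow_le_rpow_of_nonpos (by positivity) (mul_le_sin hc.1.le hc.2.le) (by linarith)
    refine h1.trans_lt ?_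
    rw [lintegral_const_mul' _ _ (by simp)]
    exact ENNReal.mul_lt_top (by simp) (lintegral_Ioo_rpow_lt_top hκ _)
  rw [lintegral_Ioo_split (by linarith : 0 < π / 2) (by linarith)]
  refine ENNReal.add_lt_top.2 ⟨key, ?_⟩
  rw [lintegral_Ioo_reflect (π / 2) π π, sub_self, show π - π / 2 = π / 2 by ring]
  simpa only [sin_pi_sub] using key

theorem exists_lintegral_abs_sub_rpow_le :
    ∃ C : ℝ, 0 ≤ C ∧ ∀ a ∈ Ioo 0 π,
      ∫⁻ c in Ioo 0 π, ENNReal.ofReal (|a - c| ^ (-(4 / 5) : ℝ)) ≤ ENNReal.ofReal C := by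
  have h0 := lintegral_Ioo_rpow_lt_top (κ := 4 / 5) (by norm_num) π
  set A := ∫⁻ c in Ioo 0 π, ENNReal.ofReal (c ^ (-(4 / 5) : ℝ))
  refine ⟨(A + A).toReal, ENNReal.toReal_nonneg, fun a ha => ?_⟩
  rw [ENNReal.ofReal_toReal (ENNReal.add_lt_top.2 ⟨h0, h0⟩).ne, lintegral_Ioo_split ha.1 ha.2]
  refine add_le_add ?_ ?_
  · rw [lintegral_Ioo_reflect 0 a a, sub_self, sub_zero]
    calc _ = ∫⁻ c in Ioo 0 a, ENNReal.ofReal (c ^ (-(4 / 5) : ℝ)) := by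
          refine setLIntegral_congr_fun measurableSet_Ioo fun c hc => ?_
          simp only [sub_sub_cancel, abs_of_pos hc.1]
      _ ≤ A := lintegral_mono_set (Ioo_subset_Ioo_right ha.2.le)
  · rw [lintegral_Ioo_reflect a π (a + π), lintegral_Ioo_reflect _ _ π,
      show π - (a + π - a) = 0 by ring, show π - (a + π - π) = π - a by ring]
    calc _ = ∫⁻ c in Ioo 0 (π - a), ENNReal.ofReal (c ^ (-(4 / 5) : ℝ)) := by
          refine setLIntegral_congr_fun measurableSet_Ioo fun c hc => ?_
          simp only [show a - (a + π - (π - c)) = -c by ring, abs_neg, abs_of_pos hc.1]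
      _ ≤ A := lintegral_mono_set (Ioo_subset_Ioo_right (by linarith [ha.1]))

theorem integrableOn_profile : IntegrableOn (fun τ : ℝ => 1 / (τ ^ 2 + √τ)) (Ioi 0) := by
  have hm : Measurable fun τ : ℝ => 1 / (τ ^ 2 + √τ) := by fun_prop
  rw [← Ioc_union_Ioi_eq_Ioi (zero_le_one' ℝ)]
  refine IntegrableOn.union ?_ ?_
  · have h := intervalIntegral.intervalIntegrable_rpow' (a := 0) (b := 1) (r := -(1 / 2))
      (by norm_num)
    rw [intervalIntegrable_iff_integrableOn_Ioc_of_le zero_le_one] at h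
    refine h.mono' hm.aestronglyMeasurable ((ae_restrict_mem measurableSet_Ioc).mono fun τ hτ => ?_)
    have h0 := hτ.1
    rw [norm_of_nonneg (by positivity), rpow_neg h0.le, ← sqrt_eq_rpow, ← one_div]
    gcongr
    exact le_add_of_nonneg_left (by positivity)
  · have h := integrableOn_Ioi_rpow_of_lt (a := -2) (by norm_num) zero_lt_one
    refine h.mono' hm.aestronglyMeasurable ((ae_restrict_mem measurableSet_Ioi).mono fun τ hτ => ?_)
    have h0 : 0 < τ := zero_lt_one.trans hτ
    rw [norm_of_nonneg (by positivity), rpow_neg h0.le, ← one_div]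
    norm_cast
    gcongr
    exact le_add_of_nonneg_right (by positivity)

theorem lintegral_Ioi_scale {k : ℝ} (hk : 0 < k) (G : ℝ → ℝ≥0∞) :
    ∫⁻ c in Ioi 0, G c = ENNReal.ofReal k * ∫⁻ τ in Ioi 0, G (k * τ) := by
  have h1 : (fun c => k * c) '' Ioi 0 = Ioi 0 := by
    rw [image_mul_left_Ioi hk, mul_zero]
  conv_lhs => rw [← h1]
  rw [lintegral_image_eq_lintegral_abs_deriv_mul measurableSet_Ioi (f := fun c => k * c)
    (f' := fun _ => k) (fun c _ => ((hasDerivAt_id c).const_mul k).hasDerivWithinAt.congr_deriv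
      (mul_one k)) (fun c _ c' _ h => by simpa [hk.ne'] using h),
    lintegral_const_mul' _ _ (by simp), abs_of_pos hk]

theorem rpow_third_pow {s : ℝ} (hs : 0 < s) : (s ^ (1 / 3 : ℝ)) ^ 3 = s := by
  rw [← rpow_natCast, ← rpow_mul hs.le]; norm_num

/-- With sin a = k³ and c = kτ both terms of the denominator scale like k². The integral over `c` is
thus a constant times k / k² = (sin a)^(-1/3). -/
theorem profile_scale {k τ : ℝ} (hk : 0 < k) :
    32 / ((k * τ) ^ 2 + √(k ^ 3 * (k * τ))) = 32 / k ^ 2 * (1 / (τ ^ 2 + √τ)) := by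
  rw [show k ^ 3 * (k * τ) = (k ^ 2) ^ 2 * τ by ring, sqrt_mul (by positivity),
    sqrt_sq (by positivity), show (k * τ) ^ 2 + k ^ 2 * √τ = k ^ 2 * (τ ^ 2 + √τ) by ring,
    div_mul_div_comm, mul_one]

theorem lintegral_profile {s : ℝ} (hs : 0 < s) :
    ∫⁻ c in Ioi 0, ENNReal.ofReal (32 / (c ^ 2 + √(s * c)))
      = ENNReal.ofReal (32 * s ^ (-(1 / 3) : ℝ)) *
        ∫⁻ τ in Ioi 0, ENNReal.ofReal (1 / (τ ^ 2 + √τ)) := by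
  have hk : 0 < s ^ (1 / 3 : ℝ) := by positivity
  have h3 := rpow_third_pow hs
  rw [rpow_neg hs.le]
  set k := s ^ (1 / 3 : ℝ)
  rw [lintegral_Ioi_scale hk, ← h3]
  simp_rw [profile_scale hk]
  simp_rw [fun τ => ENNReal.ofReal_mul (p := 32 / k ^ 2) (q := τ) (by positivity)]
  rw [lintegral_const_mul' _ _ (by simp), ← mul_assoc, ← ENNReal.ofReal_mul hk.le]
  congr 2
  field_simp

theorem lintegral_K2Half_Ioo_half_le {a : ℝ} (ha : a ∈ Ioo 0 π) :
    ∫⁻ c in Ioo 0 (π / 2), ENNReal.ofReal (K2Half a c) ≤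
      ENNReal.ofReal (32 * sin a ^ (-(1 / 3) : ℝ)) *
        ∫⁻ τ in Ioi 0, ENNReal.ofReal (1 / (τ ^ 2 + √τ)) := by
  rw [← lintegral_profile (sin_pos_of_mem_Ioo ha)]
  calc _ ≤ ∫⁻ c in Ioo 0 (π / 2), ENNReal.ofReal (32 / (c ^ 2 + √(sin a * c))) :=
        setLIntegral_mono' measurableSet_Ioo fun c hc =>
          ENNReal.ofReal_le_ofReal (K2Half_le_profile ha ⟨hc.1, hc.2.le⟩)
    _ ≤ _ := lintegral_mono_set Ioo_subset_Ioi_self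

theorem exists_lintegral_K2Half_le :
    ∃ C : ℝ, 0 < C ∧ ∀ a ∈ Ioo 0 π,
      ∫⁻ c in Ioo 0 π, ENNReal.ofReal (K2Half a c) ≤ ENNReal.ofReal (C * sin a ^ (-(1 / 3) : ℝ)) := by
  have hp := pi_pos
  have hG : ∫⁻ τ in Ioi 0, ENNReal.ofReal (1 / (τ ^ 2 + √τ)) < ⊤ :=
    integrableOn_profile.lintegral_lt_top
  obtain ⟨A, hA0, hA⟩ := exists_eq_ofReal hG
  refine ⟨64 * (A + 1), by positivity, fun a ha => ?_⟩
  have hs := sin_pos_of_mem_Ioo ha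
  have h1 := lintegral_K2Half_Ioo_half_le ha
  have h2 := lintegral_K2Half_Ioo_half_le (pi_sub_mem ha)
  rw [sin_pi_sub, hA] at h2
  rw [hA] at h1
  rw [lintegral_Ioo_split (by linarith : 0 < π / 2) (by linarith),
    lintegral_Ioo_reflect (π / 2) π π, sub_self, show π - π / 2 = π / 2 by ring]
  have e : ∀ c, K2Half a (π - c) = K2Half (π - a) c := fun c => by
    rw [← K2Half_mirror a, sub_sub_cancel]
  simp_rw [e]
  refine (add_le_add h1 h2).trans ?_
  rw [← ENNReal.ofReal_mul (by positivity),
    ← ENNReal.ofReal_add (by positivity) (by positivity)]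
  refine ENNReal.ofReal_le_ofReal ?_
  have : 0 < sin a ^ (-(1 / 3) : ℝ) := by positivity
  nlinarith

theorem exists_lintegral_K2Half_sin_le :
    ∃ C : ℝ, 0 < C ∧ ∀ a ∈ Ioo 0 π,
      ∫⁻ c in Ioo 0 π, ENNReal.ofReal (K2Half a c) * ENNReal.ofReal (sin c ^ (-(2 / 5) : ℝ))
        ≤ ENNReal.ofReal (C * sin a ^ (-(1 / 2) : ℝ)) := by
  have hA := lintegral_sin_rpow_lt_top (κ := 9 / 10) (by norm_num) (by norm_num)
  obtain ⟨A, hA0, hA⟩ := exists_eq_ofReal hA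
  refine ⟨A + 1, by positivity, fun a ha => ?_⟩
  have hs := sin_pos_of_mem_Ioo ha
  calc _ ≤ ∫⁻ c in Ioo 0 π, ENNReal.ofReal (sin a ^ (-(1 / 2) : ℝ)) *
        ENNReal.ofReal (sin c ^ (-(9 / 10) : ℝ)) := by
        refine setLIntegral_mono' measurableSet_Ioo fun c hc => ?_
        rw [← ENNReal.ofReal_mul (K2Half_pos ha hc).le, ← ENNReal.ofReal_mul (by positivity)]
        exact ENNReal.ofReal_le_ofReal (K2Half_mul_sin_rpow_le ha hc)
    _ = ENNReal.ofReal (sin a ^ (-(1 / 2) : ℝ)) * ENNReal.ofReal A := by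
        rw [lintegral_const_mul' _ _ ENNReal.ofReal_ne_top, hA]
    _ ≤ _ := by
        rw [← ENNReal.ofReal_mul (by positivity)]
        refine ENNReal.ofReal_le_ofReal ?_
        have : 0 < sin a ^ (-(1 / 2) : ℝ) := by positivity
        nlinarith

/-- The K₁ integral is rewritten as a K₂ integral of the function at the partner, so the inverse
square root singularity of K₁ is never estimated directly. -/
theorem exists_lintegral_K1Half_sin_le :
    ∃ C : ℝ, 0 < C ∧ ∀ a ∈ Ioo 0 π,
      ∫⁻ c in Ioo 0 π, ENNReal.ofReal (K1Half a c) * ENNReal.ofReal (sin c ^ (-(2 / 5) : ℝ))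
        ≤ ENNReal.ofReal (C * sin a ^ (-(1 / 2) : ℝ)) := by
  have hA := lintegral_sin_rpow_lt_top (κ := 9 / 10) (by norm_num) (by norm_num)
  obtain ⟨B, hB0, hB⟩ := exists_lintegral_abs_sub_rpow_le
  obtain ⟨A, hA0, hA⟩ := exists_eq_ofReal hA
  refine ⟨8 * (A + B + 1), by positivity, fun a ha => ?_⟩
  have hs := sin_pos_of_mem_Ioo ha
  rw [← lintegral_K2Half_partner ha fun c => ENNReal.ofReal (sin c ^ (-(2 / 5) : ℝ))]
  have hne : ∀ᵐ c ∂volume.restrict (Ioo 0 π), a ≠ c :=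
    ae_restrict_of_ae (by simp [ae_iff])
  calc _ ≤ ∫⁻ c in Ioo 0 π, ENNReal.ofReal (8 * sin a ^ (-(1 / 2) : ℝ)) *
        (ENNReal.ofReal (sin c ^ (-(9 / 10) : ℝ)) + ENNReal.ofReal (|a - c| ^ (-(4 / 5) : ℝ))) := by
        refine lintegral_mono_ae ?_
        filter_upwards [hne, ae_restrict_mem measurableSet_Ioo] with c hac hc
        have hsc := sin_pos_of_mem_Ioo hc
        rw [← ENNReal.ofReal_mul (K2Half_pos ha hc).le, ← ENNReal.ofReal_add (by positivity)
          (by positivity), ← ENNReal.ofReal_mul (by positivity)]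
        exact ENNReal.ofReal_le_ofReal (K2Half_mul_sin_partner_rpow_le ha hc hac)
    _ = ENNReal.ofReal (8 * sin a ^ (-(1 / 2) : ℝ)) *
        (ENNReal.ofReal A + ∫⁻ c in Ioo 0 π, ENNReal.ofReal (|a - c| ^ (-(4 / 5) : ℝ))) := by
        rw [lintegral_const_mul' _ _ ENNReal.ofReal_ne_top, lintegral_add_left (by fun_prop), hA]
    _ ≤ ENNReal.ofReal (8 * sin a ^ (-(1 / 2) : ℝ)) * (ENNReal.ofReal A + ENNReal.ofReal B) := by
        gcongr; exact hB a ha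
    _ ≤ _ := by
        rw [← ENNReal.ofReal_add (by positivity) hB0,
          ← ENNReal.ofReal_mul (by positivity)]
        refine ENNReal.ofReal_le_ofReal ?_
        have : 0 < sin a ^ (-(1 / 2) : ℝ) := by positivity
        nlinarith

theorem FminusHalf_le_FplusHalf {a c : ℝ} (ha : a ∈ Ioo 0 π) (hc : c ∈ Ioo 0 π) :
    FminusHalf a c ≤ FplusHalf a c := by
  have := mul_pos (sin_pos_of_mem_Ioo ha) (sin_pos_of_mem_Ioo hc)
  unfold FminusHalf FplusHalf; linarith

/-- At c = π - u with u a large multiple of (sin a)^(1/3), the term (cos a - cos u)², of order u⁴,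
dominates 4 sin a sin u. Hence F₋ > 0, while F₊ is still only of order u⁴. -/
theorem FminusHalf_pos_of_small {a u : ℝ} (ha : a ∈ Ioc 0 (π / 2)) (hu : u ∈ Ioo 0 1)
    (h2 : 2 * sin a ≤ sin u) (h3 : 32 * sin a ≤ sin u ^ 3) :
    0 < FminusHalf a (π - u) ∧ K2Half a (π - u) ≥ 1 / u ^ 2 := by
  have hpi := pi_gt_three
  have hu' : u ∈ Ioo 0 π := ⟨hu.1, by linarith [hu.2]⟩
  have ha' : a ∈ Ioo 0 π := ⟨ha.1, by linarith [ha.2]⟩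
  have s1 := sin_pos_of_mem_Ioo ha'
  have s2 := sin_pos_of_mem_Ioo hu'
  have hca : 0 ≤ cos a := cos_nonneg_of_mem_Icc ⟨by linarith [ha.1], ha.2⟩
  have hcu : 0 < cos u := cos_pos_of_mem_Ioo ⟨by linarith [hu.1], by linarith [hu.2]⟩
  have e1 : (cos a - cos u) * (cos a + cos u) = sin u ^ 2 - sin a ^ 2 := by
    rw [sin_sq, sin_sq]; ring
  have e2 : 3 / 4 * sin u ^ 2 ≤ sin u ^ 2 - sin a ^ 2 := by nlinarith
  have e3 : 3 / 8 * sin u ^ 2 ≤ cos a - cos u := by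
    by_contra! hlt
    have h5 : cos a + cos u ≤ 2 := by linarith [cos_le_one a, cos_le_one u]
    have h6 : 0 < cos a + cos u := by linarith
    nlinarith
  have e4 : cos a - cos u ≤ u ^ 2 / 2 := by
    have := one_sub_sq_div_two_le_cos (x := u)
    linarith [cos_le_one a]
  have e5 : 4 * sin a * sin u < (cos a - cos u) ^ 2 := by
    have h5 : (3 / 8 * sin u ^ 2) ^ 2 ≤ (cos a - cos u) ^ 2 := by gcongr
    have h6 : 32 * sin a * sin u ≤ sin u ^ 3 * sin u := by gcongr
    nlinarith [mul_pos s1 s2]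
  constructor
  · unfold FminusHalf
    rw [cos_pi_sub, sin_pi_sub, ← sub_eq_add_neg]
    linarith
  · have hpos : 0 < FplusHalf a (π - u) := FplusHalf_pos ha' (pi_sub_mem hu')
    have h0 := hu.1
    unfold K2Half
    rw [ge_iff_le, div_le_div_iff₀ (by positivity) (by positivity), one_mul]
    refine sqrt_le_iff.2 ⟨by positivity, ?_⟩
    unfold FplusHalf
    rw [cos_pi_sub, sin_pi_sub, ← sub_eq_add_neg]
    have h7 : (cos a - cos u) ^ 2 ≤ (u ^ 2 / 2) ^ 2 := by
      have : 0 ≤ cos a - cos u := le_trans (by positivity) e3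
      gcongr
    nlinarith [sq_nonneg (u ^ 2)]

theorem lintegral_ge_of_Ioo {f : ℝ → ℝ≥0∞} {p q m : ℝ} (hm : 0 ≤ m)
    (hf : ∀ c ∈ Ioo p q, ENNReal.ofReal m ≤ f c) (s : Set ℝ) (hs : Ioo p q ⊆ s) :
    ENNReal.ofReal (m * (q - p)) ≤ ∫⁻ c in s, f c :=
  calc ENNReal.ofReal (m * (q - p)) = ∫⁻ _ in Ioo p q, ENNReal.ofReal m := by
        rw [setLIntegral_const, volume_Ioo, ENNReal.ofReal_mul hm]
    _ ≤ ∫⁻ c in Ioo p q, f c := setLIntegral_mono' measurableSet_Ioo hf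
    _ ≤ _ := lintegral_mono_set hs

/-- Restricting to F₋ > 0 makes this more than a lower bound on V: it measures how much of 2K₂ lies
under K₁, which later gives coercivity. -/
theorem lintegral_K2Half_Fminus_ge_aux {a : ℝ} (ha : a ∈ Ioc 0 (π / 2)) :
    ENNReal.ofReal (1 / 160 * sin a ^ (-(1 / 3) : ℝ)) ≤
      ∫⁻ c in Ioo 0 π, if 0 < FminusHalf a c then ENNReal.ofReal (K2Half a c) else 0 := by
  have hpi := pi_gt_three
  have hpi' := pi_le_four
  have ha' : a ∈ Ioo 0 π := ⟨ha.1, by linarith [ha.2]⟩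
  have s1 := sin_pos_of_mem_Ioo ha'
  have hk : 0 < sin a ^ (1 / 3 : ℝ) := by positivity
  have h3 := rpow_third_pow s1
  have hk1 : sin a ^ (1 / 3 : ℝ) ≤ 1 := rpow_le_one s1.le (sin_le_one _) (by norm_num)
  rw [rpow_neg s1.le]
  set k := sin a ^ (1 / 3 : ℝ)
  -- For small k the window π - 16k < c < π - 8k has length 8k and K₂ ≥ 1 / (256 k²) on it. For
  -- larger k the fixed window (0, 1/5), where K₂ ≥ 1/2, suffices because 1 / k < 16.
  rcases le_or_gt k (1 / 16) with hk2 | hk2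
  · have hle : 1 / 160 * k⁻¹ ≤ 1 / (256 * k ^ 2) * ((π - 8 * k) - (π - 16 * k)) := by
      rw [show (π - 8 * k) - (π - 16 * k) = 8 * k by ring]
      field_simp
      norm_num
    refine (ENNReal.ofReal_le_ofReal hle).trans
      (lintegral_ge_of_Ioo (by positivity) (fun c hc => ?_) _
        (Ioo_subset_Ioo (by linarith) (by linarith)))
    set u := π - c with hu
    have hc' : c = π - u := by rw [hu]; ring
    have hu1 : 8 * k < u := by linarith [hc.2]
    have hu2 : u < 16 * k := by linarith [hc.1]
    have hu0 : 0 < u := by linarith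
    have e1 : u / 2 ≤ sin u := by
      refine le_trans ?_ (mul_le_sin hu0.le (by linarith))
      rw [div_mul_eq_mul_div, le_div_iff₀ pi_pos]
      nlinarith
    have e0 : 4 * k ≤ sin u := by linarith
    have e2 : (4 * k) ^ 3 ≤ sin u ^ 3 := by gcongr
    have e3 : k ^ 3 ≤ k := pow_le_of_le_one hk.le hk1 (by norm_num)
    obtain ⟨f1, f2⟩ := FminusHalf_pos_of_small (u := u) ha ⟨hu0, by linarith⟩ (by linarith)
      (by rw [← h3]; nlinarith [pow_pos hk 3])
    rw [hc', if_pos f1]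
    refine ENNReal.ofReal_le_ofReal (le_trans ?_ f2)
    gcongr
    calc u ^ 2 ≤ (16 * k) ^ 2 := by gcongr
      _ = _ := by ring
  · have hle : 1 / 160 * k⁻¹ ≤ 1 / 2 * (1 / 5 - 0) := by
      have : k⁻¹ < 16 := by rw [inv_lt_comm₀ hk (by norm_num)]; linarith
      linarith
    refine (ENNReal.ofReal_le_ofReal hle).trans
      (lintegral_ge_of_Ioo (by positivity) (fun c hc => ?_) _
        (Ioo_subset_Ioo le_rfl (by linarith)))
    have hc' : c ∈ Ioo 0 π := ⟨hc.1, by linarith [hc.2]⟩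
    have s2 := sin_pos_of_mem_Ioo hc'
    have s3 : sin c ≤ 1 / 5 := (sin_le hc.1.le).trans hc.2.le
    have hca : 0 ≤ cos a := cos_nonneg_of_mem_Icc ⟨by linarith [ha.1], ha.2⟩
    have hcc : 0 < cos c := cos_pos_of_mem_Ioo ⟨by linarith [hc.1], by linarith [hc.2]⟩
    have hF : 0 < FminusHalf a c := by
      unfold FminusHalf
      nlinarith [sin_sq_add_cos_sq c, mul_nonneg hca hcc.le, sin_le_one a, sq_nonneg (cos a)]
    rw [if_pos hF]
    refine ENNReal.ofReal_le_ofReal ?_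
    unfold K2Half
    rw [div_le_div_iff₀ (by norm_num) (sqrt_pos.2 (FplusHalf_pos ha' hc')), one_mul]
    refine sqrt_le_iff.2 ⟨by norm_num, ?_⟩
    unfold FplusHalf
    nlinarith [cos_le_one a, cos_le_one c, sin_le_one a, sin_le_one c]

theorem lintegral_K2Half_Fminus_ge {a : ℝ} (ha : a ∈ Ioo 0 π) :
    ENNReal.ofReal (1 / 160 * sin a ^ (-(1 / 3) : ℝ)) ≤
      ∫⁻ c in Ioo 0 π, if 0 < FminusHalf a c then ENNReal.ofReal (K2Half a c) else 0 := by
  rcases le_or_gt a (π / 2) with h | h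
  · exact lintegral_K2Half_Fminus_ge_aux ⟨ha.1, h⟩
  · have := lintegral_K2Half_Fminus_ge_aux (a := π - a) ⟨by linarith [ha.2], by linarith⟩
    rw [sin_pi_sub, lintegral_Ioo_reflect 0 π π, sub_self, sub_zero] at this
    simpa only [FminusHalf_mirror, K2Half_mirror] using this

end FPU

/-! ### Bounds on the cell for ω, V and the kernels -/

namespace FPU

open Real Set

open scoped ENNReal

theorem omega_eq {x : ℝ} (hx : x ∈ Ioo 0 (2 * π)) : omega x = sin (x / 2) :=
  abs_of_pos (sin_pos_of_mem_Ioo (half_mem hx))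

theorem omega_pos {x : ℝ} (hx : x ∈ Ioo 0 (2 * π)) : 0 < omega x := by
  rw [omega_eq hx]; exact sin_pos_of_mem_Ioo (half_mem hx)

theorem omega_nonneg (x : ℝ) : 0 ≤ omega x := abs_nonneg _

theorem omega_le_one (x : ℝ) : omega x ≤ 1 := abs_sin_le_one _

theorem lintegral_omega_rpow_lt_top {κ : ℝ} (hκ0 : 0 ≤ κ) (hκ : κ < 1) :
    ∫⁻ x, ENNReal.ofReal (omega x ^ (-κ)) ∂volI < ⊤ := by
  rw [lintegral_volI]
  refine ENNReal.mul_lt_top (by simp) ((lintegral_sin_rpow_lt_top hκ0 hκ).trans_le' ?_)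
  refine setLIntegral_mono' measurableSet_Ioo fun c hc => le_of_eq ?_
  rw [omega, mul_div_cancel_left₀ _ (two_ne_zero' ℝ), abs_of_pos (sin_pos_of_mem_Ioo hc)]

theorem integrable_omega_rpow {κ : ℝ} (hκ0 : 0 ≤ κ) (hκ : κ < 1) :
    Integrable (fun x => omega x ^ (-κ)) volI := by
  have hm : Measurable fun x => omega x ^ (-κ) := by fun_prop
  refine ⟨hm.aestronglyMeasurable, ?_⟩
  rw [hasFiniteIntegral_iff_ofReal (Eventually.of_forall fun x => rpow_nonneg (omega_nonneg x) _)]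
  exact lintegral_omega_rpow_lt_top hκ0 hκ

theorem exists_lintegral_K2_le :
    ∃ C : ℝ, 0 < C ∧ ∀ x ∈ Ioo 0 (2 * π),
      ∫⁻ z, ENNReal.ofReal (K2 x z) ∂volI ≤ ENNReal.ofReal (C * omega x ^ (-(1 / 3) : ℝ)) := by
  obtain ⟨C, hC0, hC⟩ := exists_lintegral_K2Half_le
  refine ⟨2 * C, by positivity, fun x hx => ?_⟩
  rw [lintegral_volI, omega_eq hx, mul_assoc, ENNReal.ofReal_mul two_pos.le]
  simp only [K2_eq_half, mul_div_cancel_left₀ _ (two_ne_zero' ℝ), ENNReal.ofReal_ofNat]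
  gcongr
  exact hC _ (half_mem hx)

theorem exists_lintegral_kernel_omega_le :
    ∃ C : ℝ, 0 < C ∧ ∀ x ∈ Ioo 0 (2 * π),
      ∫⁻ z, ENNReal.ofReal (K1 x z) * ENNReal.ofReal (omega z ^ (-(2 / 5) : ℝ)) ∂volI
        ≤ ENNReal.ofReal (C * omega x ^ (-(1 / 2) : ℝ)) ∧
      ∫⁻ z, ENNReal.ofReal (K2 x z) * ENNReal.ofReal (omega z ^ (-(2 / 5) : ℝ)) ∂volI
        ≤ ENNReal.ofReal (C * omega x ^ (-(1 / 2) : ℝ)) := by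
  obtain ⟨C, hC0, hC⟩ := exists_lintegral_K1Half_sin_le
  obtain ⟨D, hD0, hD⟩ := exists_lintegral_K2Half_sin_le
  have key : ∀ k : ℝ → ℝ,
      ∫⁻ c in Ioo 0 π, ENNReal.ofReal (k c) * ENNReal.ofReal (omega (2 * c) ^ (-(2 / 5) : ℝ))
      = ∫⁻ c in Ioo 0 π, ENNReal.ofReal (k c) * ENNReal.ofReal (sin c ^ (-(2 / 5) : ℝ)) :=
    fun k => setLIntegral_congr_fun measurableSet_Ioo fun c hc => by
      rw [omega, mul_div_cancel_left₀ _ (two_ne_zero' ℝ), abs_of_pos (sin_pos_of_mem_Ioo hc)]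
  refine ⟨2 * (C + D), by positivity, fun x hx => ⟨?_, ?_⟩⟩
  all_goals
    rw [lintegral_volI, mul_assoc, ENNReal.ofReal_mul two_pos.le]
    simp only [K1_eq_half, K2_eq_half, mul_div_cancel_left₀ _ (two_ne_zero' ℝ),
      ENNReal.ofReal_ofNat]
    have h0 := omega_pos hx
    gcongr
    rw [key]
  · refine (hC _ (half_mem hx)).trans (ENNReal.ofReal_le_ofReal ?_)
    rw [← omega_eq hx]
    gcongr
    linarith
  · refine (hD _ (half_mem hx)).trans (ENNReal.ofReal_le_ofReal ?_)
    rw [← omega_eq hx]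
    gcongr
    linarith

theorem lintegral_K2_Fminus_ge {x : ℝ} (hx : x ∈ Ioo 0 (2 * π)) :
    ENNReal.ofReal (1 / 80 * omega x ^ (-(1 / 3) : ℝ)) ≤
      ∫⁻ z, (if 0 < Fminus x z then ENNReal.ofReal (K2 x z) else 0) ∂volI := by
  have h := lintegral_K2Half_Fminus_ge (half_mem hx)
  have e : ∀ c, Fminus x (2 * c) = FminusHalf (x / 2) c := fun c => by
    unfold Fminus FminusHalf; rw [mul_div_cancel_left₀ _ (two_ne_zero' ℝ)]
  rw [lintegral_volI]
  simp only [e, K2_eq_half, mul_div_cancel_left₀ _ (two_ne_zero' ℝ)]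
  rw [omega_eq hx, show (1 / 80 : ℝ) = 2 * (1 / 160) by norm_num, mul_assoc,
    ENNReal.ofReal_mul two_pos.le, ENNReal.ofReal_ofNat]
  gcongr

theorem K2_sq_le {x y : ℝ} (hx : x ∈ Ioo 0 (2 * π)) (hy : y ∈ Ioo 0 (2 * π)) :
    K2 x y ^ 2 ≤ 1 / (omega x * omega y) := by
  rw [omega_eq hx, omega_eq hy]
  exact K2Half_sq_le (half_mem hx) (half_mem hy)

theorem K2_le {x y : ℝ} (hx : x ∈ Ioo 0 (2 * π)) (hy : y ∈ Ioo 0 (2 * π)) :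
    K2 x y ≤ 4 / omega x ^ 2 := by
  rw [omega_eq hx, K2_comm]
  exact K2Half_le_sin_sq (half_mem hy) (half_mem hx)

theorem K2_pos {x y : ℝ} (hx : x ∈ Ioo 0 (2 * π)) (hy : y ∈ Ioo 0 (2 * π)) : 0 < K2 x y :=
  K2Half_pos (half_mem hx) (half_mem hy)

theorem two_mul_K2_le_K1 {x y : ℝ} (hx : x ∈ Ioo 0 (2 * π)) (hy : y ∈ Ioo 0 (2 * π))
    (h : 0 < Fminus x y) : 2 * K2 x y ≤ K1 x y := by
  have h1 : Fminus x y ≤ Fplus x y := FminusHalf_le_FplusHalf (half_mem hx) (half_mem hy)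
  have h2 := sqrt_pos.2 h
  unfold K1 K2
  rw [if_pos h, mul_div_assoc', show (2 * 2 : ℝ) = 4 by norm_num]
  gcongr

theorem ofReal_V {x : ℝ} (hx : x ∈ Ioo 0 (2 * π)) :
    ENNReal.ofReal (V x) = ∫⁻ z, ENNReal.ofReal (K2 x z) ∂volI := by
  obtain ⟨C, hC0, hC⟩ := exists_lintegral_K2_le
  have hm : Measurable fun z => K2 x z := by fun_prop
  unfold V
  rw [integral_eq_lintegral_of_nonneg_ae (Eventually.of_forall fun z => K2_nonneg x z)
    hm.aestronglyMeasurable, ENNReal.ofReal_toReal]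
  exact ((hC x hx).trans_lt ENNReal.ofReal_lt_top).ne

theorem integrable_K2 {x : ℝ} (hx : x ∈ Ioo 0 (2 * π)) : Integrable (fun z => K2 x z) volI := by
  obtain ⟨C, hC0, hC⟩ := exists_lintegral_K2_le
  have hm : Measurable fun z => K2 x z := by fun_prop
  refine ⟨hm.aestronglyMeasurable, ?_⟩
  rw [hasFiniteIntegral_iff_ofReal (Eventually.of_forall fun z => K2_nonneg x z)]
  exact (hC x hx).trans_lt ENNReal.ofReal_lt_top

theorem V_nonneg (x : ℝ) : 0 ≤ V x := integral_nonneg fun z => K2_nonneg x z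

theorem exists_V_le :
    ∃ C : ℝ, 0 < C ∧ ∀ x ∈ Ioo 0 (2 * π), V x ≤ C * omega x ^ (-(1 / 3) : ℝ) := by
  obtain ⟨C, hC0, hC⟩ := exists_lintegral_K2_le
  refine ⟨C, hC0, fun x hx => ?_⟩
  have := hC x hx
  rw [← ofReal_V hx] at this
  have h0 := omega_pos hx
  exact (ENNReal.ofReal_le_ofReal_iff (by positivity)).1 this

theorem V_ge {x : ℝ} (hx : x ∈ Ioo 0 (2 * π)) : 1 / 80 * omega x ^ (-(1 / 3) : ℝ) ≤ V x := by
  refine (ENNReal.ofReal_le_ofReal_iff (V_nonneg x)).1 ((lintegral_K2_Fminus_ge hx).trans ?_)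
  rw [ofReal_V hx]
  refine lintegral_mono fun z => ?_
  split_ifs
  · rfl
  · exact zero_le

theorem V_pos {x : ℝ} (hx : x ∈ Ioo 0 (2 * π)) : 0 < V x := by
  have h0 := omega_pos hx
  exact (by positivity : 0 < 1 / 80 * omega x ^ (-(1 / 3) : ℝ)).trans_le (V_ge hx)

@[fun_prop]
theorem measurable_V : Measurable V := by
  have h : Measurable fun p : ℝ × ℝ => K2 p.1 p.2 := by fun_prop
  exact (h.stronglyMeasurable.integral_prod_right (ν := volI)).measurable

/-- K₁(x, y) dy is the image of K₂(x, z) dz, so K₁ has total mass V(x) as well. -/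
theorem lintegral_K1 {x : ℝ} (hx : x ∈ Ioo 0 (2 * π)) :
    ∫⁻ y, ENNReal.ofReal (K1 x y) ∂volI = ENNReal.ofReal (V x) := by
  have := lintegral_K2_partner hx fun _ => 1
  simp only [mul_one] at this
  rw [← this, ofReal_V hx]

/-! ### The collision measure, its symmetries and its marginals -/

/-- The measure on the cell with density the collision rate `V`. -/
noncomputable def rateMeasure : Measure ℝ := volI.withDensity fun x => ENNReal.ofReal (V x)

/-- The measure on pairs (incoming momentum, outgoing momentum) with density `K₂`. -/
noncomputable def collisionMeasure : Measure (ℝ × ℝ) :=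
  (volI.prod volI).withDensity fun p => ENNReal.ofReal (K2 p.1 p.2)

theorem lintegral_collisionMeasure {F : ℝ × ℝ → ℝ≥0∞} (hF : Measurable F) :
    ∫⁻ p, F p ∂collisionMeasure
      = ∫⁻ x, ∫⁻ z, ENNReal.ofReal (K2 x z) * F (x, z) ∂volI ∂volI := by
  unfold collisionMeasure
  rw [lintegral_withDensity_eq_lintegral_mul _ (by fun_prop) hF]
  simp only [Pi.mul_apply]
  rw [lintegral_prod _ (by fun_prop)]

theorem lintegral_rateMeasure {F : ℝ → ℝ≥0∞} (hF : Measurable F) :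
    ∫⁻ x, F x ∂rateMeasure = ∫⁻ x, ENNReal.ofReal (V x) * F x ∂volI := by
  unfold rateMeasure
  rw [lintegral_withDensity_eq_lintegral_mul _ (by fun_prop) hF]
  rfl

theorem measurePreserving_of_lintegral {α β : Type*} [MeasurableSpace α] [MeasurableSpace β]
    {μ : Measure α} {ν : Measure β} {f : α → β} (hf : Measurable f)
    (h : ∀ F : β → ℝ≥0∞, Measurable F → ∫⁻ x, F (f x) ∂μ = ∫⁻ y, F y ∂ν) :
    MeasurePreserving f μ ν := by
  refine ⟨hf, Measure.ext fun s hs => ?_⟩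
  rw [← lintegral_indicator_one hs, ← lintegral_indicator_one hs,
    lintegral_map (measurable_one.indicator hs) hf]
  exact h _ (measurable_one.indicator hs)

/-- Time reversal of a collision, expressed by the symmetry of K₂. Together with the exchange of
outgoing particles it makes the distributions of all four momenta equal to V dx. -/
theorem measurePreserving_swap :
    MeasurePreserving Prod.swap collisionMeasure collisionMeasure := by
  refine measurePreserving_of_lintegral measurable_swap fun F hF => ?_
  rw [lintegral_collisionMeasure hF, lintegral_collisionMeasure (F := fun p => F p.swap) (by fun_prop)]
  rw [lintegral_lintegral_swap (by fun_prop)]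
  simp only [Prod.swap_prod_mk, K2_comm]

theorem measurePreserving_exchange :
    MeasurePreserving (fun p : ℝ × ℝ => (p.1, partner p.2 p.1)) collisionMeasure
      collisionMeasure := by
  have hm : Measurable fun p : ℝ × ℝ => (p.1, partner p.2 p.1) := by fun_prop
  refine measurePreserving_of_lintegral hm fun F hF => ?_
  rw [lintegral_collisionMeasure hF, lintegral_collisionMeasure (F := fun p => F (p.1, partner p.2 p.1)) (by fun_prop)]
  refine lintegral_congr_ae (ae_volI_mem.mono fun x hx => ?_)
  exact lintegral_K2_exchange hx fun z => F (x, z)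

theorem measurePreserving_fst : MeasurePreserving Prod.fst collisionMeasure rateMeasure := by
  refine measurePreserving_of_lintegral measurable_fst fun F hF => ?_
  rw [lintegral_collisionMeasure (F := fun p => F p.1) (by fun_prop), lintegral_rateMeasure hF]
  refine lintegral_congr_ae (ae_volI_mem.mono fun x hx => ?_)
  simp only
  rw [lintegral_mul_const _ (by fun_prop), ofReal_V hx]

theorem measurePreserving_snd : MeasurePreserving Prod.snd collisionMeasure rateMeasure :=
  measurePreserving_fst.comp measurePreserving_swap

theorem measurePreserving_partner' :
    MeasurePreserving (fun p : ℝ × ℝ => partner p.2 p.1) collisionMeasure rateMeasure :=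
  measurePreserving_snd.comp measurePreserving_exchange

theorem measurePreserving_partner :
    MeasurePreserving (fun p : ℝ × ℝ => partner p.1 p.2) collisionMeasure rateMeasure :=
  measurePreserving_partner'.comp measurePreserving_swap

theorem rateMeasure_absolutelyContinuous : rateMeasure ≪ volI :=
  withDensity_absolutelyContinuous _ _

theorem absolutelyContinuous_rateMeasure : volI ≪ rateMeasure := by
  refine withDensity_absolutelyContinuous' (by fun_prop) (ae_volI_mem.mono fun x hx => ?_)
  simpa using V_pos hx

theorem map_partner_withDensity {x : ℝ} (hx : x ∈ Ioo 0 (2 * π)) :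
    MeasurePreserving (fun z => partner x z)
      (volI.withDensity fun z => ENNReal.ofReal (K2 x z))
      (volI.withDensity fun y => ENNReal.ofReal (K1 x y)) := by
  have hm : Measurable fun z => partner x z := by fun_prop
  refine measurePreserving_of_lintegral hm fun F hF => ?_
  rw [lintegral_withDensity_eq_lintegral_mul _ (by fun_prop) hF,
    lintegral_withDensity_eq_lintegral_mul _ (by fun_prop) (g := fun z => F (partner x z))
      (by fun_prop)]
  exact lintegral_K2_partner hx F

theorem map_exchange_withDensity {x : ℝ} (hx : x ∈ Ioo 0 (2 * π)) :
    MeasurePreserving (fun z => partner z x)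
      (volI.withDensity fun z => ENNReal.ofReal (K2 x z))
      (volI.withDensity fun y => ENNReal.ofReal (K2 x y)) := by
  have hm : Measurable fun z => partner z x := by fun_prop
  refine measurePreserving_of_lintegral hm fun F hF => ?_
  rw [lintegral_withDensity_eq_lintegral_mul _ (by fun_prop) hF,
    lintegral_withDensity_eq_lintegral_mul _ (by fun_prop) (g := fun z => F (partner z x))
      (by fun_prop)]
  exact lintegral_K2_exchange hx F

end FPU

/-! ### The quadratic form of the collision operator -/

namespace FPU

open Real Set

open scoped ENNReal ComplexConjugate

/-- The collision difference `g₀ + g₁ - g₂ - g₃`. -/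
noncomputable def collisionDiff (g : ℝ → ℂ) (p : ℝ × ℝ) : ℂ :=
  g p.1 + g (partner p.1 p.2) - g p.2 - g (partner p.2 p.1)

/-- The Hilbert space `L²(V dx)`. -/
abbrev RateL2 : Type := Lp ℂ 2 rateMeasure

/-- The Hilbert space of square integrable functions on the collision manifold. -/
abbrev CollL2 : Type := Lp ℂ 2 collisionMeasure

/-- Half of the collision difference, as a bounded operator. -/
noncomputable def collOp : RateL2 →L[ℂ] CollL2 :=
  (1 / 2 : ℂ) •
    ((Lp.compMeasurePreservingₗᵢ ℂ _ measurePreserving_fst).toContinuousLinearMap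
    + (Lp.compMeasurePreservingₗᵢ ℂ _ measurePreserving_partner).toContinuousLinearMap
    - (Lp.compMeasurePreservingₗᵢ ℂ _ measurePreserving_snd).toContinuousLinearMap
    - (Lp.compMeasurePreservingₗᵢ ℂ _ measurePreserving_partner').toContinuousLinearMap)

theorem collOp_coe (g : RateL2) :
    collOp g =ᵐ[collisionMeasure] fun p => (1 / 2 : ℂ) * collisionDiff g p := by
  have h0 := Lp.coeFn_compMeasurePreserving g measurePreserving_fst
  have h1 := Lp.coeFn_compMeasurePreserving g measurePreserving_partner
  have h2 := Lp.coeFn_compMeasurePreserving g measurePreserving_snd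
  have h3 := Lp.coeFn_compMeasurePreserving g measurePreserving_partner'
  set A := Lp.compMeasurePreserving _ measurePreserving_fst g
  set B := Lp.compMeasurePreserving _ measurePreserving_partner g
  set C := Lp.compMeasurePreserving _ measurePreserving_snd g
  set D := Lp.compMeasurePreserving _ measurePreserving_partner' g
  have e : collOp g = (1 / 2 : ℂ) • (A + B - C - D) := rfl
  rw [e]
  filter_upwards [h0, h1, h2, h3, Lp.coeFn_smul (1 / 2 : ℂ) (A + B - C - D),
    Lp.coeFn_sub (A + B - C) D, Lp.coeFn_sub (A + B) C, Lp.coeFn_add A B] with p h0 h1 h2 h3 h4 h5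
    h6 h7
  rw [h4, Pi.smul_apply, h5, Pi.sub_apply, h6, Pi.sub_apply, h7, Pi.add_apply, h0, h1, h2, h3]
  rfl

theorem ae_collisionMeasure_of_ae {P : ℝ → Prop} (h : ∀ᵐ x ∂rateMeasure, P x) :
    ∀ᵐ p ∂collisionMeasure, P p.1 ∧ P (partner p.1 p.2) ∧ P p.2 ∧ P (partner p.2 p.1) := by
  filter_upwards [measurePreserving_fst.quasiMeasurePreserving.ae h,
    measurePreserving_partner.quasiMeasurePreserving.ae h,
    measurePreserving_snd.quasiMeasurePreserving.ae h,
    measurePreserving_partner'.quasiMeasurePreserving.ae h] with p h0 h1 h2 h3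
  exact ⟨h0, h1, h2, h3⟩

theorem collisionMeasure_absolutelyContinuous : collisionMeasure ≪ volI.prod volI :=
  withDensity_absolutelyContinuous _ _

theorem ae_volI_prod :
    ∀ᵐ p ∂(volI.prod volI), p.1 ∈ Ioo 0 (2 * π) ∧ p.2 ∈ Ioo 0 (2 * π) ∧ p.1 ≠ p.2 := by
  have hm : MeasurableSet {p : ℝ × ℝ | p.1 ∈ Ioo 0 (2 * π) ∧ p.2 ∈ Ioo 0 (2 * π) ∧ p.1 ≠ p.2} :=
    (measurableSet_Ioo.preimage measurable_fst).inter
      ((measurableSet_Ioo.preimage measurable_snd).inter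
        (measurableSet_eq_fun measurable_fst measurable_snd).compl)
  rw [Measure.ae_prod_iff_ae_ae hm]
  filter_upwards [ae_volI_mem] with x hx
  have hne : ∀ᵐ z ∂volI, x ≠ z := ae_restrict_of_ae (by simp [ae_iff])
  filter_upwards [ae_volI_mem, hne] with z hz h
  exact ⟨hx, hz, h⟩

theorem ae_collisionMeasure :
    ∀ᵐ p ∂collisionMeasure, p.1 ∈ Ioo 0 (2 * π) ∧ p.2 ∈ Ioo 0 (2 * π) ∧ p.1 ≠ p.2 :=
  collisionMeasure_absolutelyContinuous.ae_le ae_volI_prod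

theorem collisionDiff_swap (g : ℝ → ℂ) (p : ℝ × ℝ) :
    collisionDiff g p.swap = -collisionDiff g p := by
  simp only [collisionDiff, Prod.fst_swap, Prod.snd_swap]; ring

theorem collisionDiff_exchange (g : ℝ → ℂ) :
    ∀ᵐ p ∂collisionMeasure, collisionDiff g (p.1, partner p.2 p.1) = collisionDiff g p := by
  filter_upwards [ae_collisionMeasure] with p ⟨h1, h2, h3⟩
  obtain ⟨-, e1, e2⟩ := partner_relations h1 h2 h3
  simp only [collisionDiff, e1, e2]
  ring

theorem integral_comp_measurePreserving {α β : Type*} [MeasurableSpace α] [MeasurableSpace β]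
    {μ : Measure α} {ν : Measure β} {f : α → β} (hf : MeasurePreserving f μ ν) {F : β → ℂ}
    (hF : AEStronglyMeasurable F ν) : ∫ x, F (f x) ∂μ = ∫ y, F y ∂ν := by
  rw [← hf.map_eq] at hF ⊢
  rw [integral_map hf.measurable.aemeasurable hF]

theorem lintegral_V_lt_top : ∫⁻ x, ENNReal.ofReal (V x) ∂volI < ⊤ := by
  obtain ⟨C, hC0, hC⟩ := exists_V_le
  calc _ ≤ ∫⁻ x, ENNReal.ofReal C * ENNReal.ofReal (omega x ^ (-(1 / 3) : ℝ)) ∂volI := by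
        refine lintegral_mono_ae (ae_volI_mem.mono fun x hx => ?_)
        rw [← ENNReal.ofReal_mul hC0.le]
        exact ENNReal.ofReal_le_ofReal (hC x hx)
    _ = ENNReal.ofReal C * ∫⁻ x, ENNReal.ofReal (omega x ^ (-(1 / 3) : ℝ)) ∂volI :=
        lintegral_const_mul' _ _ ENNReal.ofReal_ne_top
    _ < ⊤ := ENNReal.mul_lt_top ENNReal.ofReal_lt_top
        (lintegral_omega_rpow_lt_top (by norm_num) (by norm_num))

instance : IsFiniteMeasure rateMeasure := ⟨by
  rw [rateMeasure, withDensity_apply _ MeasurableSet.univ, setLIntegral_univ]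
  exact lintegral_V_lt_top⟩

theorem memLp_collisionDiff {g : ℝ → ℂ} (hg : MemLp g 2 rateMeasure) :
    MemLp (collisionDiff g) 2 collisionMeasure :=
  (((hg.comp_measurePreserving measurePreserving_fst).add
    (hg.comp_measurePreserving measurePreserving_partner)).sub
    (hg.comp_measurePreserving measurePreserving_snd)).sub
    (hg.comp_measurePreserving measurePreserving_partner')

theorem integrable_collisionDiff_mul {g γ : ℝ → ℂ} (hg : MemLp g 2 rateMeasure)
    (hγ : MemLp γ 2 rateMeasure) {q : ℝ × ℝ → ℝ}
    (hq : MeasurePreserving q collisionMeasure rateMeasure) :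
    Integrable (fun p => collisionDiff g p * conj (γ (q p))) collisionMeasure :=
  (memLp_collisionDiff hg).integrable_mul (hγ.comp_measurePreserving hq).star

/-- The symmetries of the collision measure turn the quadratic form of collision differences into
a form tested against the first particle only. -/
theorem integral_collisionDiff_mul_conj {g γ : ℝ → ℂ} (hg : MemLp g 2 rateMeasure)
    (hγ : MemLp γ 2 rateMeasure) :
    ∫ p, collisionDiff g p * conj (collisionDiff γ p) ∂collisionMeasure
      = 4 * ∫ p, collisionDiff g p * conj (γ p.1) ∂collisionMeasure := by
  have i0 := integrable_collisionDiff_mul hg hγ measurePreserving_fst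
  have i1 := integrable_collisionDiff_mul hg hγ measurePreserving_partner
  have i2 := integrable_collisionDiff_mul hg hγ measurePreserving_snd
  have i3 := integrable_collisionDiff_mul hg hγ measurePreserving_partner'
  -- Under the swap the difference changes sign; under the exchange it is invariant. These carry the
  -- test function from the first momentum to the other three, with the sign each has in the
  -- difference, so the four terms coincide.
  have j2 := integral_comp_measurePreserving measurePreserving_swap i0.aestronglyMeasurable
  have j3 := integral_comp_measurePreserving measurePreserving_exchange i2.aestronglyMeasurable
  have j1 := integral_comp_measurePreserving measurePreserving_swap i3.aestronglyMeasurable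
  simp only [collisionDiff_swap, Prod.fst_swap, Prod.snd_swap, neg_mul, integral_neg] at j2 j1
  have j3' : ∫ p, collisionDiff g p * conj (γ (partner p.2 p.1)) ∂collisionMeasure
      = ∫ p, collisionDiff g p * conj (γ p.2) ∂collisionMeasure := by
    rw [← j3]
    refine integral_congr_ae ((collisionDiff_exchange g).mono fun p hp => ?_)
    simp only [hp]
  have e : (fun p => collisionDiff g p * conj (collisionDiff γ p)) = fun p =>
      collisionDiff g p * conj (γ p.1) + collisionDiff g p * conj (γ (partner p.1 p.2))
      - collisionDiff g p * conj (γ p.2) - collisionDiff g p * conj (γ (partner p.2 p.1)) := by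
    funext p
    conv_lhs => rw [collisionDiff.eq_1 γ]
    simp only [map_add, map_sub]
    ring
  have i01 : Integrable (fun p => collisionDiff g p * conj (γ p.1)
      + collisionDiff g p * conj (γ (partner p.1 p.2))) collisionMeasure := i0.add i1
  have i012 : Integrable (fun p => collisionDiff g p * conj (γ p.1)
      + collisionDiff g p * conj (γ (partner p.1 p.2))
      - collisionDiff g p * conj (γ p.2)) collisionMeasure := i01.sub i2
  rw [e, integral_sub i012 i3, integral_sub i01 i2, integral_add i0 i1]
  linear_combination -j1 - 2 * j3' + 3 * j2

theorem integral_withDensity_ofReal {α : Type*} [MeasurableSpace α] {m : Measure α} {k : α → ℝ}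
    (hk : Measurable k) (hk0 : ∀ x, 0 ≤ k x) (g : α → ℂ) :
    ∫ x, g x ∂m.withDensity (fun x => ENNReal.ofReal (k x)) = ∫ x, (k x : ℂ) * g x ∂m := by
  rw [integral_withDensity_eq_integral_toReal_smul (by fun_prop)
    (Eventually.of_forall fun x => ENNReal.ofReal_lt_top)]
  simp [ENNReal.toReal_ofReal (hk0 _)]

theorem integrable_withDensity_ofReal {α : Type*} [MeasurableSpace α] {m : Measure α} {k : α → ℝ}
    (hk : Measurable k) (hk0 : ∀ x, 0 ≤ k x) (g : α → ℂ) :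
    Integrable g (m.withDensity (fun x => ENNReal.ofReal (k x)))
      ↔ Integrable (fun x => (k x : ℂ) * g x) m := by
  rw [integrable_withDensity_iff_integrable_smul' (by fun_prop)
    (Eventually.of_forall fun x => ENNReal.ofReal_lt_top)]
  simp [ENNReal.toReal_ofReal (hk0 _)]

/-- By Tonelli the double integral of k(x, y)|g(y)| is ∫ V |g|, which is finite, so almost every
section is integrable. -/
theorem ae_integrable_K {k : ℝ → ℝ → ℝ} (hk : Measurable fun p : ℝ × ℝ => k p.1 p.2)
    (hk0 : ∀ x y, 0 ≤ k x y)
    (hV : ∀ x ∈ Ioo 0 (2 * π), ∫⁻ y, ENNReal.ofReal (k y x) ∂volI = ENNReal.ofReal (V x))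
    {g : ℝ → ℂ} (hgm : Measurable g) (hg : Integrable g rateMeasure) :
    ∀ᵐ x ∂volI, Integrable (fun y => (k x y : ℂ) * g y) volI := by
  have h : ∫⁻ x, ∫⁻ y, ENNReal.ofReal (k x y) * ‖g y‖ₑ ∂volI ∂volI < ⊤ := by
    rw [lintegral_lintegral_swap (by fun_prop)]
    have h1 := hg.2
    rw [hasFiniteIntegral_iff_enorm, lintegral_rateMeasure (by fun_prop)] at h1
    refine h1.trans_le' (le_of_eq (lintegral_congr_ae (ae_volI_mem.mono fun y hy => ?_)))
    simp only
    rw [lintegral_mul_const _ (by fun_prop), hV y hy]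
  have hm : Measurable fun x => ∫⁻ y, ENNReal.ofReal (k x y) * ‖g y‖ₑ ∂volI :=
    Measurable.lintegral_prod_right' (f := fun p : ℝ × ℝ => ENNReal.ofReal (k p.1 p.2) * ‖g p.2‖ₑ)
      (by fun_prop)
  filter_upwards [ae_lt_top hm h.ne] with x hx
  refine ⟨by fun_prop, ?_⟩
  rw [hasFiniteIntegral_iff_enorm]
  refine hx.trans_le' (le_of_eq (lintegral_congr fun y => ?_))
  rw [enorm_mul, ← ofReal_norm ((k x y : ℝ) : ℂ), Complex.norm_real, norm_of_nonneg (hk0 x y)]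

theorem ae_integrable_K1 {g : ℝ → ℂ} (hgm : Measurable g) (hg : Integrable g rateMeasure) :
    ∀ᵐ x ∂volI, Integrable (fun y => (K1 x y : ℂ) * g y) volI :=
  ae_integrable_K (by fun_prop) K1_nonneg (fun x hx => by
    simp_rw [fun y => K1_comm y x]; exact lintegral_K1 hx) hgm hg

theorem ae_integrable_K2 {g : ℝ → ℂ} (hgm : Measurable g) (hg : Integrable g rateMeasure) :
    ∀ᵐ x ∂volI, Integrable (fun y => (K2 x y : ℂ) * g y) volI :=
  ae_integrable_K (by fun_prop) K2_nonneg (fun x hx => by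
    simp_rw [fun y => K2_comm y x]; exact (ofReal_V hx).symm) hgm hg

/-- The four terms of the difference integrate to V g, K₁ g, -K₂ g and, by the exchange symmetry,
once more -K₂ g. -/
theorem integral_K2_mul_collisionDiff {g : ℝ → ℂ} (hgm : Measurable g) {x : ℝ}
    (hx : x ∈ Ioo 0 (2 * π)) (h1 : Integrable (fun y => (K1 x y : ℂ) * g y) volI)
    (h2 : Integrable (fun y => (K2 x y : ℂ) * g y) volI) :
    ∫ z, (K2 x z : ℂ) * collisionDiff g (x, z) ∂volI = collisionL g x := by
  have m1 := map_partner_withDensity hx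
  have m2 := map_exchange_withDensity hx
  have k1 : Measurable fun y => K1 x y := by fun_prop
  have k2 : Measurable fun y => K2 x y := by fun_prop
  have a1 : ∫ z, (K2 x z : ℂ) * g (partner x z) ∂volI = ∫ y, (K1 x y : ℂ) * g y ∂volI := by
    rw [← integral_withDensity_ofReal k2 (K2_nonneg x), ← integral_withDensity_ofReal k1 (K1_nonneg x)]
    exact integral_comp_measurePreserving m1 hgm.aestronglyMeasurable
  have a2 : ∫ z, (K2 x z : ℂ) * g (partner z x) ∂volI = ∫ y, (K2 x y : ℂ) * g y ∂volI := by
    rw [← integral_withDensity_ofReal k2 (K2_nonneg x), ← integral_withDensity_ofReal k2 (K2_nonneg x)]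
    exact integral_comp_measurePreserving m2 hgm.aestronglyMeasurable
  have b1 : Integrable (fun z => (K2 x z : ℂ) * g (partner x z)) volI := by
    rw [← integrable_withDensity_ofReal k2 (K2_nonneg x)]
    rw [← integrable_withDensity_ofReal k1 (K1_nonneg x)] at h1
    exact m1.integrable_comp_of_integrable h1
  have b2 : Integrable (fun z => (K2 x z : ℂ) * g (partner z x)) volI := by
    rw [← integrable_withDensity_ofReal k2 (K2_nonneg x)] at h2 ⊢
    exact m2.integrable_comp_of_integrable h2
  have b0 : Integrable (fun z => (K2 x z : ℂ) * g x) volI :=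
    (integrable_K2 hx).ofReal.mul_const _
  have e : (fun z => (K2 x z : ℂ) * collisionDiff g (x, z)) = fun z =>
      (K2 x z : ℂ) * g x + (K2 x z : ℂ) * g (partner x z) - (K2 x z : ℂ) * g z
        - (K2 x z : ℂ) * g (partner z x) := by
    funext z; simp only [collisionDiff]; ring
  have b01 : Integrable (fun z => (K2 x z : ℂ) * g x + (K2 x z : ℂ) * g (partner x z)) volI :=
    b0.add b1
  have b012 : Integrable (fun z => (K2 x z : ℂ) * g x + (K2 x z : ℂ) * g (partner x z)
    - (K2 x z : ℂ) * g z) volI := b01.sub h2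
  rw [e, integral_sub b012 b2, integral_sub b01 h2, integral_add b0 b1, a1, a2,
    integral_mul_const, integral_complex_ofReal]
  unfold collisionL V volI
  ring

theorem integrable_of_memLp_rate {g : ℝ → ℂ} (hg : MemLp g 2 rateMeasure) :
    Integrable g rateMeasure := hg.integrable one_le_two

theorem integrable_collisionL_mul {g γ : ℝ → ℂ} (hgm : Measurable g)
    (hg : MemLp g 2 rateMeasure) (hγ : MemLp γ 2 rateMeasure) :
    Integrable (fun x => collisionL g x * conj (γ x)) volI ∧
    ∫ p, collisionDiff g p * conj (γ p.1) ∂collisionMeasure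
      = ∫ x, collisionL g x * conj (γ x) ∂volI := by
  have h0 := integrable_collisionDiff_mul hg hγ measurePreserving_fst
  have hk : Measurable fun p : ℝ × ℝ => K2 p.1 p.2 := by fun_prop
  have hk0 : ∀ p : ℝ × ℝ, 0 ≤ K2 p.1 p.2 := fun p => K2_nonneg _ _
  have h1 := h0
  rw [collisionMeasure, integrable_withDensity_ofReal hk hk0] at h1
  have key : ∀ᵐ x ∂volI, ∫ z, (K2 x z : ℂ) * (collisionDiff g (x, z) * conj (γ x)) ∂volI
      = collisionL g x * conj (γ x) := by
    filter_upwards [ae_volI_mem, ae_integrable_K1 hgm (integrable_of_memLp_rate hg),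
      ae_integrable_K2 hgm (integrable_of_memLp_rate hg)] with x hx a1 a2
    simp_rw [← mul_assoc]
    rw [integral_mul_const, integral_K2_mul_collisionDiff hgm hx a1 a2]
  refine ⟨h1.integral_prod_left.congr key, ?_⟩
  rw [collisionMeasure, integral_withDensity_ofReal hk hk0, integral_prod _ h1]
  exact integral_congr_ae key

/-- The factor 1/2 in `collOp` contributes 1/4, which cancels the 4 from symmetrization, so the form
is exactly that of L. -/
theorem inner_collOp (γ g : RateL2) :
    ⟪collOp γ, collOp g⟫_ℂ = ∫ x, collisionL g x * conj (γ x) ∂volI := by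
  have hg := Lp.memLp g
  have hγ := Lp.memLp γ
  rw [← (integrable_collisionL_mul (Lp.stronglyMeasurable g).measurable hg hγ).2, L2.inner_def]
  have h4 := integral_collisionDiff_mul_conj hg hγ
  have : ∫ p, ⟪collOp γ p, collOp g p⟫_ℂ ∂collisionMeasure
      = ∫ p, (1 / 4 : ℂ) * (collisionDiff g p * conj (collisionDiff γ p)) ∂collisionMeasure := by
    refine integral_congr_ae ?_
    filter_upwards [collOp_coe γ, collOp_coe g] with p h1 h2
    rw [h1, h2, RCLike.inner_apply, map_mul]
    simp only [map_div₀, map_one, map_ofNat]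
    ring
  rw [this, integral_const_mul, h4]
  ring

end FPU

/-! ### Construction, positivity and uniqueness of L̃ -/

namespace FPU

open Real Set

open scoped ENNReal ComplexConjugate

/-- Since V is at most of order ω^(-1/3), ω²V is at most of order ω^(5/3). This makes multiplication
by ω bounded from L²(I) to L²(V dx), although V itself is unbounded. -/
theorem exists_omega_sq_mul_V_le :
    ∃ C : ℝ, 0 < C ∧ ∀ x ∈ Ioo 0 (2 * π), V x * omega x ^ 2 ≤ C := by
  obtain ⟨C, hC0, hC⟩ := exists_V_le
  refine ⟨C, hC0, fun x hx => ?_⟩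
  have h0 := omega_pos hx
  calc V x * omega x ^ 2 ≤ C * omega x ^ (-(1 / 3) : ℝ) * omega x ^ 2 := by
        gcongr; exact hC x hx
    _ = C * omega x ^ (5 / 3 : ℝ) := by
        rw [mul_assoc, ← rpow_natCast, ← rpow_add h0]; norm_num
    _ ≤ C * 1 := by
        gcongr; exact rpow_le_one h0.le (omega_le_one x) (by norm_num)
    _ = C := mul_one C

theorem eLpNorm_two_eq {α : Type*} [MeasurableSpace α] (m : Measure α) (f : α → ℂ) :
    eLpNorm f 2 m = (∫⁻ x, ‖f x‖ₑ ^ 2 ∂m) ^ (1 / 2 : ℝ) := by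
  rw [eLpNorm_eq_lintegral_rpow_enorm_toReal (by norm_num) (by norm_num)]
  simp

theorem exists_eLpNorm_omega_mul_le :
    ∃ C : ℝ, 0 ≤ C ∧ ∀ f : ℝ → ℂ, Measurable f →
      eLpNorm (fun x => (omega x : ℂ) * f x) 2 rateMeasure
        ≤ ENNReal.ofReal C * eLpNorm f 2 volI := by
  obtain ⟨C, hC0, hC⟩ := exists_omega_sq_mul_V_le
  refine ⟨C ^ (1 / 2 : ℝ), by positivity, fun f hf => ?_⟩
  rw [eLpNorm_two_eq, eLpNorm_two_eq, ← ENNReal.ofReal_rpow_of_pos hC0,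
    ← ENNReal.mul_rpow_of_nonneg _ _ (by norm_num)]
  gcongr
  rw [lintegral_rateMeasure (by fun_prop), ← lintegral_const_mul' _ _ ENNReal.ofReal_ne_top]
  refine lintegral_mono_ae (ae_volI_mem.mono fun x hx => ?_)
  rw [enorm_mul, mul_pow, ← mul_assoc, ← ofReal_norm ((omega x : ℝ) : ℂ), Complex.norm_real,
    norm_of_nonneg (omega_nonneg x), ← ENNReal.ofReal_pow (omega_nonneg x),
    ← ENNReal.ofReal_mul (V_nonneg x)]
  gcongr
  exact hC x hx

theorem memLp_omega_mul (f : L2I) :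
    MemLp (fun x => (omega x : ℂ) * f x) 2 rateMeasure := by
  have hf := (Lp.stronglyMeasurable f).measurable
  obtain ⟨C, hC0, hC⟩ := exists_eLpNorm_omega_mul_le
  exact ⟨by fun_prop, (hC f hf).trans_lt (ENNReal.mul_lt_top ENNReal.ofReal_lt_top
    (Lp.eLpNorm_lt_top f))⟩

/-- Multiplication by `ω` as a linear map from `L²(I)` to `L²(V dx)`. -/
noncomputable def mulOmegaₗ : L2I →ₗ[ℂ] RateL2 where
  toFun f := (memLp_omega_mul f).toLp _
  map_add' f g := by
    rw [← MemLp.toLp_add]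
    refine MemLp.toLp_congr _ _ ?_
    filter_upwards [rateMeasure_absolutelyContinuous.ae_le (Lp.coeFn_add f g)] with x hx
    simp only [hx, Pi.add_apply, mul_add]
  map_smul' c f := by
    rw [RingHom.id_apply, ← MemLp.toLp_const_smul]
    refine MemLp.toLp_congr _ _ ?_
    filter_upwards [rateMeasure_absolutelyContinuous.ae_le (Lp.coeFn_smul c f)] with x hx
    simp only [hx, Pi.smul_apply, smul_eq_mul]
    ring

theorem exists_norm_mulOmegaₗ_le : ∃ C : ℝ, ∀ f, ‖mulOmegaₗ f‖ ≤ C * ‖f‖ := by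
  obtain ⟨C, hC0, hC⟩ := exists_eLpNorm_omega_mul_le
  refine ⟨C, fun f => ?_⟩
  have hf := (Lp.stronglyMeasurable f).measurable
  change ‖(memLp_omega_mul f).toLp _‖ ≤ _
  rw [Lp.norm_toLp, Lp.norm_def, ← ENNReal.toReal_ofReal hC0, ← ENNReal.toReal_mul]
  exact ENNReal.toReal_mono (ENNReal.mul_lt_top ENNReal.ofReal_lt_top
    (Lp.eLpNorm_lt_top f)).ne (hC f hf)

/-- Multiplication by `ω` as a bounded operator from `L²(I)` to `L²(V dx)`. -/
noncomputable def mulOmega : L2I →L[ℂ] RateL2 :=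
  mulOmegaₗ.mkContinuousOfExistsBound exists_norm_mulOmegaₗ_le

theorem mulOmega_coe_rate (f : L2I) :
    mulOmega f =ᵐ[rateMeasure] fun x => (omega x : ℂ) * f x :=
  (memLp_omega_mul f).coeFn_toLp

theorem mulOmega_coe (f : L2I) : mulOmega f =ᵐ[volI] fun x => (omega x : ℂ) * f x :=
  absolutelyContinuous_rateMeasure.ae_le (mulOmega_coe_rate f)

/-- The operator `L̃ = ω L ω` on `L²(I)`. -/
noncomputable def Ltilde : L2I →L[ℂ] L2I :=
  (collOp ∘L mulOmega).adjoint ∘L (collOp ∘L mulOmega)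

theorem isPositive_Ltilde : Ltilde.IsPositive := ContinuousLinearMap.isPositive_adjoint_comp_self _

theorem inner_Ltilde (φ f : L2I) :
    ⟪φ, Ltilde f⟫_ℂ = ⟪collOp (mulOmega φ), collOp (mulOmega f)⟫_ℂ := by
  unfold Ltilde
  rw [ContinuousLinearMap.comp_apply, ContinuousLinearMap.adjoint_inner_right]
  rfl

theorem collisionL_congr {g g' : ℝ → ℂ} (h : g =ᵐ[volI] g') :
    collisionL g =ᵐ[volI] collisionL g' := by
  filter_upwards [h] with x hx
  unfold collisionL
  rw [hx]
  congr 1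
  · congr 1
    exact integral_congr_ae (h.mono fun y hy => by simp only [hy])
  · congr 1
    exact integral_congr_ae (h.mono fun y hy => by simp only [hy])

theorem integrable_collisionLtilde_mul (φ f : L2I) :
    Integrable (fun x => collisionLtilde f x * conj (φ x)) volI ∧
    ⟪φ, Ltilde f⟫_ℂ = ∫ x, collisionLtilde f x * conj (φ x) ∂volI := by
  have e : (fun x => collisionL (mulOmega f) x * conj (mulOmega φ x)) =ᵐ[volI]
      fun x => collisionLtilde f x * conj (φ x) := by
    filter_upwards [collisionL_congr (mulOmega_coe f), mulOmega_coe φ] with x h1 h2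
    rw [h1, h2, map_mul, Complex.conj_ofReal]
    unfold collisionLtilde
    ring
  constructor
  · exact (integrable_collisionL_mul (Lp.stronglyMeasurable _).measurable (Lp.memLp _)
      (Lp.memLp (mulOmega φ))).1.congr e
  · rw [inner_Ltilde, inner_collOp]
    exact integral_congr_ae e

instance : IsFiniteMeasure (volume.restrict I) := by unfold I; infer_instance

/-- The adjoint only gives a weak identity. Testing it against indicators of measurable sets
identifies the two integrable functions almost everywhere. -/
theorem Ltilde_apply_ae (f : L2I) : ∀ᵐ x ∂volI, Ltilde f x = collisionLtilde f x := by
  have hone : ∀ (s : Set ℝ) (hs : MeasurableSet s) (k : ℝ → ℂ),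
      (fun x => k x * conj (indicatorConstLp 2 (μ := volI) hs
        (measure_ne_top _ _) (1 : ℂ) x)) =ᵐ[volI] s.indicator k := by
    intro s hs k
    filter_upwards [indicatorConstLp_coeFn (p := 2) (hs := hs) (hμs := measure_ne_top volI s)
      (c := (1 : ℂ))] with x hx
    rw [hx]
    by_cases h : x ∈ s <;> simp [h]
  have hint : Integrable (collisionLtilde f) volI := by
    refine (integrable_collisionLtilde_mul _ f).1.congr ((hone univ MeasurableSet.univ _).trans ?_)
    rw [indicator_univ]
  refine Integrable.ae_eq_of_forall_setIntegral_eq _ _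
    ((Lp.memLp (Ltilde f)).integrable one_le_two) hint fun s hs _ => ?_
  have h1 := (integrable_collisionLtilde_mul
    (indicatorConstLp 2 (μ := volI) hs (measure_ne_top _ _) (1 : ℂ)) f).2
  rw [integral_congr_ae (hone s hs _), integral_indicator hs] at h1
  rw [← h1, L2.inner_indicatorConstLp_one]

theorem isLtilde_Ltilde : IsLtilde Ltilde where
  integrable_V := ae_volI_mem.mono fun x hx => integrable_K2 hx
  integrable_K1 f := by
    have hf := (Lp.stronglyMeasurable f).measurable
    exact ae_integrable_K1 (by fun_prop) (integrable_of_memLp_rate (memLp_omega_mul f))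
  integrable_K2 f := by
    have hf := (Lp.stronglyMeasurable f).measurable
    exact ae_integrable_K2 (by fun_prop) (integrable_of_memLp_rate (memLp_omega_mul f))
  apply_ae := Ltilde_apply_ae

theorem IsLtilde.unique {S T : L2I →L[ℂ] L2I} (hS : IsLtilde S) (hT : IsLtilde T) : S = T := by
  ext f
  filter_upwards [hS.apply_ae f, hT.apply_ae f] with x h1 h2
  rw [h1, h2]

theorem isUnit_smul_one_add {H : Type*} [NormedAddCommGroup H] [InnerProductSpace ℂ H]
    [CompleteSpace H] {T : H →L[ℂ] H} (hT : T.IsPositive) {r : ℝ} (hr : 0 < r) :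
    IsUnit ((r : ℂ) • (1 : H →L[ℂ] H) + T) := by
  have h0 : 0 ≤ T := (ContinuousLinearMap.nonneg_iff_isPositive T).2 hT
  have h1 : -r ∉ spectrum ℝ T := fun h => by
    have := spectrum_nonneg_of_nonneg h0 h
    linarith
  rw [spectrum.notMem_iff] at h1
  have h2 := h1.neg
  rw [neg_sub, map_neg, sub_neg_eq_add, Algebra.algebraMap_eq_smul_one, add_comm] at h2
  exact h2

end FPU

/-! ### Continuous odd collision invariants vanish -/

namespace FPU

open Real Set

/-- A continuous collision invariant in half-angle variables that is odd about `π / 2`. -/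
structure IsOddInvariant (H : ℝ → ℂ) : Prop where
  cont : ContinuousOn H (Ioo 0 π)
  odd : ∀ a ∈ Ioo 0 π, H (π - a) = -H a
  invariant : ∀ a ∈ Ioo 0 π, ∀ c ∈ Ioo 0 π, a < c →
    H a + H (partnerHalf a c) = H c + H (partnerHalf c a)

namespace IsOddInvariant

variable {H : ℝ → ℂ}

/-- The collision with a = σ - δ, c = σ + δ has b = δ + m and d = π - (δ - m); oddness turns H(d)
into -H(δ - m), so everything is expressed through δ, σ and m. -/
theorem parametrized (h : IsOddInvariant H) {δ σ : ℝ} (hδ : 0 < δ) (hσ : δ < σ)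
    (hσ' : σ < π - δ) :
    |arcsin (tan δ * cos σ)| < δ ∧
      H (σ + δ) - H (σ - δ)
        = H (δ + arcsin (tan δ * cos σ)) + H (δ - arcsin (tan δ * cos σ)) := by
  have ha : σ - δ ∈ Ioo 0 π := ⟨by linarith, by linarith⟩
  have hc : σ + δ ∈ Ioo 0 π := ⟨by linarith, by linarith⟩
  have hlt : σ - δ < σ + δ := by linarith
  have h1 := h.invariant _ ha _ hc hlt
  have h2 := abs_midAngle_lt ha hc hlt
  have e1 : (σ + δ - (σ - δ)) / 2 = δ := by ring
  have e2 : (σ - δ + (σ + δ)) / 2 = σ := by ring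
  rw [midAngle_of_lt hlt, e1, e2] at h2
  rw [partnerHalf_of_lt hlt, partnerHalf_of_gt hlt, midAngle_of_lt hlt, e1, e2] at h1
  refine ⟨h2, ?_⟩
  have h3 := abs_lt.1 h2
  have h4 := h.odd (δ - arcsin (tan δ * cos σ)) ⟨by linarith, by linarith⟩
  rw [show π - (δ - arcsin (tan δ * cos σ)) = π - δ + arcsin (tan δ * cos σ) by ring] at h4
  rw [h4] at h1
  linear_combination -h1

/-- At σ = π/2 the angle m vanishes. -/
theorem half_reflect (h : IsOddInvariant H) {δ : ℝ} (hδ : 0 < δ) (hδ' : δ < π / 2) :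
    H (π / 2 - δ) = -H δ := by
  have h1 := (h.parametrized hδ hδ' (by linarith)).2
  have h2 := h.odd (π / 2 - δ) ⟨by linarith, by linarith⟩
  rw [show π - (π / 2 - δ) = π / 2 + δ by ring] at h2
  rw [cos_pi_div_two, mul_zero, arcsin_zero, add_zero, sub_zero, h2] at h1
  linear_combination (-1 / 2) * h1

/-- Taking σ = π/2 - τ and applying both reflections, the symmetric sum at δ is unchanged when τ is
replaced by arcsin(tan δ sin τ). -/
theorem sum_step (h : IsOddInvariant H) {δ τ : ℝ} (hδ : δ < π / 4) (hτ : |τ| < δ) :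
    |arcsin (tan δ * sin τ)| < δ ∧
      H (δ + arcsin (tan δ * sin τ)) + H (δ - arcsin (tan δ * sin τ))
        = H (δ + τ) + H (δ - τ) := by
  obtain ⟨h1, h2⟩ := abs_lt.1 hτ
  have h0 : 0 < δ := (abs_nonneg τ).trans_lt hτ
  obtain ⟨h3, h4⟩ := h.parametrized (δ := δ) (σ := π / 2 - τ) h0 (by linarith) (by linarith)
  rw [cos_pi_div_two_sub] at h3 h4
  refine ⟨h3, ?_⟩
  have h5 := h.half_reflect (δ := τ + δ) (by linarith) (by linarith)
  have h6 := h.half_reflect (δ := δ - τ) (by linarith) (by linarith)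
  have h7 := h.odd (π / 2 - (δ - τ)) ⟨by linarith, by linarith⟩
  rw [show π / 2 - (τ + δ) = π / 2 - τ - δ by ring] at h5
  rw [show π - (π / 2 - (δ - τ)) = π / 2 - τ + δ by ring] at h7
  rw [← h4, h5, h7, h6, add_comm τ]
  ring

/-- For δ < π/4 one has tan δ < 1, so iterating the previous step multiplies sin τ by tan δ each
time. The offset tends to 0 and continuity gives the value at the midpoint. -/
theorem midpoint (h : IsOddInvariant H) {δ τ : ℝ} (hδ : δ < π / 4) (hτ : |τ| < δ) :
    H (δ + τ) + H (δ - τ) = 2 * H δ := by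
  have h0 : 0 < δ := (abs_nonneg τ).trans_lt hτ
  have htan0 : 0 < tan δ := tan_pos_of_pos_of_lt_pi_div_two h0 (by linarith [pi_pos])
  have htan1 : tan δ < 1 := by
    rw [← tan_pi_div_four]
    exact tan_lt_tan_of_lt_of_lt_pi_div_two (by linarith [pi_pos]) (by linarith [pi_pos]) hδ
  have hval : ∀ n : ℕ, |tan δ ^ n * sin τ| ≤ 1 := fun n => by
    rw [abs_mul, abs_of_pos (by positivity)]
    exact mul_le_one₀ (pow_le_one₀ htan0.le htan1.le) (abs_nonneg _) (abs_sin_le_one τ)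
  have hs : ∀ n : ℕ, sin (arcsin (tan δ ^ n * sin τ)) = tan δ ^ n * sin τ := fun n =>
    sin_arcsin (abs_le.1 (hval n)).1 (abs_le.1 (hval n)).2
  have hstep : ∀ n : ℕ, |arcsin (tan δ ^ n * sin τ)| < δ ∧
      H (δ + arcsin (tan δ ^ n * sin τ)) + H (δ - arcsin (tan δ ^ n * sin τ))
        = H (δ + τ) + H (δ - τ) := by
    intro n
    induction n with
    | zero =>
      obtain ⟨h1, h2⟩ := abs_lt.1 hτ
      rw [pow_zero, one_mul, arcsin_sin (by linarith [pi_pos]) (by linarith [pi_pos])]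
      exact ⟨hτ, rfl⟩
    | succ n ih =>
      obtain ⟨i1, i2⟩ := h.sum_step hδ ih.1
      rw [hs, ← mul_assoc, ← pow_succ'] at i1 i2
      exact ⟨i1, i2.trans ih.2⟩
  have hlim : Tendsto (fun n : ℕ => arcsin (tan δ ^ n * sin τ)) atTop (𝓝 0) := by
    have h1 := (tendsto_pow_atTop_nhds_zero_of_lt_one htan0.le htan1).mul_const (sin τ)
    rw [zero_mul] at h1
    have h2 := (continuous_arcsin.tendsto 0).comp h1
    rwa [arcsin_zero] at h2
  have hcontδ : ContinuousAt H δ :=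
    h.cont.continuousAt (Ioo_mem_nhds h0 (by linarith [pi_pos]))
  have h3 : Tendsto (fun n : ℕ => H (δ + arcsin (tan δ ^ n * sin τ))
      + H (δ - arcsin (tan δ ^ n * sin τ))) atTop (𝓝 (H δ + H δ)) := by
    refine Tendsto.add (hcontδ.tendsto.comp ?_) (hcontδ.tendsto.comp ?_)
    · simpa using hlim.const_add δ
    · simpa using hlim.const_sub δ
  have h4 := tendsto_nhds_unique h3 (tendsto_const_nhds.congr fun n => (hstep n).2.symm)
  rw [← h4]; ring

theorem difference (h : IsOddInvariant H) {δ τ : ℝ} (hδ0 : 0 < δ) (hδ : δ < π / 4) (hτ : δ < τ)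
    (hτ' : τ < π / 2 - δ) : H (τ + δ) - H (τ - δ) = 2 * H δ := by
  obtain ⟨h3, h4⟩ := h.parametrized (δ := δ) (σ := π / 2 - τ) hδ0 (by linarith) (by linarith)
  rw [h.midpoint hδ h3] at h4
  have h5 := h.half_reflect (δ := τ + δ) (by linarith) (by linarith)
  have h6 := h.half_reflect (δ := τ - δ) (by linarith) (by linarith)
  rw [show π / 2 - (τ + δ) = π / 2 - τ - δ by ring] at h5
  rw [show π / 2 - (τ - δ) = π / 2 - τ + δ by ring] at h6
  rw [h5, h6] at h4
  linear_combination h4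

/-- The midpoint identity gives the sum of H(δ + τ) and H(δ - τ), and `difference` with the roles of
δ and τ exchanged gives their difference. -/
theorem additive (h : IsOddInvariant H) {δ τ : ℝ} (hτ : 0 < τ) (hτδ : τ < δ) (hδ : δ < π / 4) :
    H (δ + τ) = H δ + H τ ∧ H (δ - τ) = H δ - H τ := by
  have h1 := h.midpoint hδ (τ := τ) (by rwa [abs_of_pos hτ])
  have h2 := h.difference hτ (by linarith) hτδ (by linarith)
  exact ⟨by linear_combination (1 / 2) * h1 + (1 / 2) * h2,
    by linear_combination (1 / 2) * h1 - (1 / 2) * h2⟩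

theorem double (h : IsOddInvariant H) {δ : ℝ} (hδ0 : 0 < δ) (hδ : δ < π / 4) :
    H (2 * δ) = 2 * H δ := by
  have hc : ∀ x ∈ Ioo 0 π, ContinuousAt H x := fun x hx => h.cont.continuousAt (Ioo_mem_nhds hx.1 hx.2)
  have h1 : Tendsto (fun τ => H (δ + τ)) (𝓝[<] δ) (𝓝 (H (2 * δ))) := by
    refine (hc (2 * δ) ⟨by linarith, by linarith⟩).tendsto.comp ?_
    have : Tendsto (fun τ => δ + τ) (𝓝 δ) (𝓝 (2 * δ)) := by
      rw [two_mul]; exact tendsto_id.const_add δ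
    exact this.mono_left nhdsWithin_le_nhds
  have h2 : Tendsto (fun τ => H δ + H τ) (𝓝[<] δ) (𝓝 (2 * H δ)) := by
    rw [two_mul]
    exact (((hc δ ⟨by linarith, by linarith⟩).tendsto).mono_left nhdsWithin_le_nhds).const_add _
  refine tendsto_nhds_unique h1 (h2.congr' ?_)
  filter_upwards [Ioo_mem_nhdsLT hδ0] with τ hτ
  exact ((h.additive hτ.1 hτ.2 hδ).1).symm

/-- Letting δ tend to π/4 in the subtraction formula; H(π/4) = 0 by reflection about that point. -/
theorem quarter_reflect (h : IsOddInvariant H) {τ : ℝ} (hτ0 : 0 < τ) (hτ : τ < π / 4) :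
    H (π / 4 - τ) = -H τ := by
  have hc : ∀ x ∈ Ioo 0 π, ContinuousAt H x := fun x hx => h.cont.continuousAt (Ioo_mem_nhds hx.1 hx.2)
  have h0 : H (π / 4) = 0 := by
    have := h.half_reflect (δ := π / 4) (by linarith) (by linarith)
    rw [show π / 2 - π / 4 = π / 4 by ring] at this
    exact self_eq_neg.1 this
  have h1 : Tendsto (fun δ => H (δ - τ)) (𝓝[<] (π / 4)) (𝓝 (H (π / 4 - τ))) := by
    refine (hc _ ⟨by linarith, by linarith⟩).tendsto.comp ?_
    exact (tendsto_id.sub_const τ).mono_left nhdsWithin_le_nhds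
  have h2 : Tendsto (fun δ => H δ - H τ) (𝓝[<] (π / 4)) (𝓝 (-H τ)) := by
    have := ((hc (π / 4) ⟨by linarith, by linarith⟩).tendsto.mono_left
      (nhdsWithin_le_nhds (s := Iio (π / 4)))).sub_const (H τ)
    rwa [h0, zero_sub] at this
  refine tendsto_nhds_unique h1 (h2.congr' ?_)
  filter_upwards [Ioo_mem_nhdsLT hτ] with δ hδ
  exact ((h.additive hτ0 hδ.1 hδ.2).2).symm

/-- No behaviour at the endpoint 0 is assumed. The identity H(p) = H(π/4 + p) moves small p into a
compact subset of the open interval. -/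
theorem exists_bound (h : IsOddInvariant H) : ∃ M : ℝ, ∀ p ∈ Ioo 0 (π / 4), ‖H p‖ ≤ M := by
  have hp := pi_pos
  obtain ⟨M, hM⟩ := (isCompact_Icc (a := π / 8) (b := 3 * π / 8)).exists_bound_of_continuousOn
    (h.cont.mono fun x hx => ⟨by linarith [hx.1], by linarith [hx.2]⟩)
  refine ⟨M, fun p hp => ?_⟩
  rcases le_or_gt (π / 8) p with h1 | h1
  · exact hM p ⟨h1, by linarith [hp.2]⟩
  · have h2 := h.difference (τ := π / 4) hp.1 hp.2 hp.2 (by linarith)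
    rw [h.quarter_reflect hp.1 hp.2] at h2
    have h3 : H p = H (π / 4 + p) := by linear_combination -h2
    rw [h3]
    exact hM _ ⟨by linarith [hp.1], by linarith⟩

/-- Doubling halves any bound on (0, π/8), and reflection about π/8 transfers the improved bound to
the rest of (0, π/4); iterating forces zero. -/
theorem eq_zero_quarter (h : IsOddInvariant H) {p : ℝ} (hp : p ∈ Ioo 0 (π / 4)) : H p = 0 := by
  obtain ⟨M, hM⟩ := h.exists_bound
  have key : ∀ n : ℕ, ∀ p ∈ Ioo 0 (π / 4), ‖H p‖ ≤ M * (1 / 2) ^ n := by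
    intro n
    induction n with
    | zero => simpa using hM
    | succ n ih =>
      have small : ∀ p, 0 < p → p < π / 8 → ‖H p‖ ≤ M * (1 / 2) ^ (n + 1) := fun p hp0 hp1 => by
        have h1 := ih (2 * p) ⟨by linarith, by linarith⟩
        rw [h.double hp0 (by linarith), norm_mul, Complex.norm_ofNat] at h1
        rw [pow_succ]
        linarith
      intro p hp
      rcases lt_trichotomy p (π / 8) with h1 | h1 | h1
      · exact small p hp.1 h1
      · have h2 := h.quarter_reflect hp.1 hp.2
        rw [h1, show π / 4 - π / 8 = π / 8 by ring] at h2
        rw [h1, self_eq_neg.1 h2, norm_zero]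
        have := (norm_nonneg _).trans (hM p hp)
        positivity
      · have h2 := small (π / 4 - p) (by linarith [hp.2]) (by linarith)
        rwa [h.quarter_reflect hp.1 hp.2, norm_neg] at h2
  have hlim : Tendsto (fun n : ℕ => M * (1 / 2) ^ n) atTop (𝓝 0) := by
    simpa using (tendsto_pow_atTop_nhds_zero_of_lt_one (r := (1 / 2 : ℝ)) (by norm_num)
      (by norm_num)).const_mul M
  exact norm_le_zero_iff.1 (ge_of_tendsto' hlim fun n => key n p hp)

theorem eq_zero (h : IsOddInvariant H) {a : ℝ} (ha : a ∈ Ioo 0 π) : H a = 0 := by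
  have h1 : ∀ p, 0 < p → p < π / 2 → H p = 0 := by
    intro p hp0 hp1
    rcases lt_trichotomy p (π / 4) with h2 | h2 | h2
    · exact h.eq_zero_quarter ⟨hp0, h2⟩
    · have := h.half_reflect hp0 hp1
      rw [h2, show π / 2 - π / 4 = π / 4 by ring] at this
      rw [h2]
      exact self_eq_neg.1 this
    · have := h.half_reflect (δ := π / 2 - p) (by linarith) (by linarith)
      rw [sub_sub_cancel, h.eq_zero_quarter (p := π / 2 - p) ⟨by linarith, by linarith⟩, neg_zero] at this
      exact this
  rcases lt_trichotomy a (π / 2) with h2 | h2 | h2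
  · exact h1 a ha.1 h2
  · have := h.odd a ha
    rw [h2, show π - π / 2 = π / 2 by ring] at this
    rw [h2]
    exact self_eq_neg.1 this
  · have := h.odd (π - a) (pi_sub_mem ha)
    rw [sub_sub_cancel, h1 (π - a) (by linarith [ha.2]) (by linarith), neg_zero] at this
    exact this

end IsOddInvariant

end FPU

/-! ### Regularity of collision invariants by averaging -/

namespace FPU

open Real Set

open scoped ENNReal ComplexConjugate

theorem partner_eq_of_lt {x z : ℝ} (h : x < z) :
    partner x z = 2 * ((z / 2 - x / 2) / 2
      + arcsin (tan ((z / 2 - x / 2) / 2) * cos ((x / 2 + z / 2) / 2))) := by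
  have h' : x / 2 < z / 2 := by linarith
  rw [partner, partnerHalf_of_lt h', midAngle_of_lt h']

theorem partner_eq_of_gt {x z : ℝ} (h : x < z) :
    partner z x = 2 * (π - (z / 2 - x / 2) / 2
      + arcsin (tan ((z / 2 - x / 2) / 2) * cos ((x / 2 + z / 2) / 2))) := by
  have h' : x / 2 < z / 2 := by linarith
  rw [partner, partnerHalf_of_gt h', midAngle_of_lt h']

theorem continuousAt_partner {p : ℝ × ℝ} (h1 : p.1 ∈ Ioo 0 (2 * π)) (h2 : p.2 ∈ Ioo 0 (2 * π))
    (h : p.1 ≠ p.2) : ContinuousAt (fun q : ℝ × ℝ => partner q.1 q.2) p := by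
  have key : ∀ x z : ℝ × ℝ → ℝ, Continuous x → Continuous z → x p ∈ Ioo 0 (2 * π) →
      z p ∈ Ioo 0 (2 * π) → ContinuousAt (fun q => arcsin (tan ((z q / 2 - x q / 2) / 2)
        * cos ((x q / 2 + z q / 2) / 2))) p := by
    intro x z hx hz hxp hzp
    have hc := (cos_half_sub_pos (half_mem hxp) (half_mem hzp)).ne'
    refine continuous_arcsin.continuousAt.comp (ContinuousAt.mul ?_ (by fun_prop))
    exact ContinuousAt.comp (f := fun q => (z q / 2 - x q / 2) / 2) (continuousAt_tan.2 hc)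
      (by fun_prop)
  rcases lt_or_gt_of_ne h with h | h
  · have e : (fun q : ℝ × ℝ => partner q.1 q.2) =ᶠ[𝓝 p] _ :=
      Eventually.mono ((isOpen_lt continuous_fst continuous_snd).mem_nhds (x := p) h)
        fun q (hq : q.1 < q.2) => partner_eq_of_lt hq
    rw [continuousAt_congr e]
    have := key Prod.fst Prod.snd continuous_fst continuous_snd h1 h2
    fun_prop
  · have e : (fun q : ℝ × ℝ => partner q.1 q.2) =ᶠ[𝓝 p] _ :=
      Eventually.mono ((isOpen_lt continuous_snd continuous_fst).mem_nhds (x := p) h)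
        fun q (hq : q.2 < q.1) => partner_eq_of_gt hq
    rw [continuousAt_congr e]
    have := key Prod.snd Prod.fst continuous_snd continuous_fst h2 h1
    fun_prop

theorem continuous_Fminus : Continuous fun p : ℝ × ℝ => Fminus p.1 p.2 := by
  unfold Fminus; fun_prop

theorem Fplus_pos {x z : ℝ} (hx : x ∈ Ioo 0 (2 * π)) (hz : z ∈ Ioo 0 (2 * π)) : 0 < Fplus x z :=
  FplusHalf_pos (half_mem hx) (half_mem hz)

theorem continuousAt_K2 {p : ℝ × ℝ} (h1 : p.1 ∈ Ioo 0 (2 * π)) (h2 : p.2 ∈ Ioo 0 (2 * π)) :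
    ContinuousAt (fun q : ℝ × ℝ => K2 q.1 q.2) p := by
  have h := sqrt_pos.2 (Fplus_pos h1 h2)
  have hc : Continuous fun q : ℝ × ℝ => Fplus q.1 q.2 := by unfold Fplus; fun_prop
  exact continuousAt_const.div (continuous_sqrt.comp hc).continuousAt h.ne'

theorem Fminus_le {x y : ℝ} (hx : x ∈ Ioo 0 (2 * π)) (hy : y ∈ Ioo 0 (2 * π)) :
    Fminus x y ≤ 4 := by
  have h1 := sin_pos_of_mem_Ioo (half_mem hx)
  have h2 := sin_pos_of_mem_Ioo (half_mem hy)
  unfold Fminus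
  nlinarith [mul_pos h1 h2, cos_le_one (x / 2), cos_le_one (y / 2), neg_one_le_cos (x / 2),
    neg_one_le_cos (y / 2)]

/-- The positive part of `F₋`, which cancels the singularity of `K₁`. -/
noncomputable def FminusPos (x y : ℝ) : ℝ := max (Fminus x y) 0

theorem K1_mul_FminusPos (x y : ℝ) : K1 x y * FminusPos x y = 4 * √(Fminus x y) := by
  unfold K1 FminusPos
  split_ifs with h
  · rw [max_eq_left h.le]
    have := sqrt_pos.2 h
    field_simp
    rw [sq_sqrt h.le]
  · rw [sqrt_eq_zero_of_nonpos (not_lt.1 h)]; simp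

theorem continuous_FminusPos : Continuous fun p : ℝ × ℝ => FminusPos p.1 p.2 :=
  continuous_Fminus.max continuous_const

@[fun_prop]
theorem measurable_FminusPos {α : Type*} [MeasurableSpace α] {f g : α → ℝ} (hf : Measurable f)
    (hg : Measurable g) : Measurable fun x => FminusPos (f x) (g x) := by
  unfold FminusPos; fun_prop

theorem FminusPos_nonneg (x y : ℝ) : 0 ≤ FminusPos x y := le_max_right _ _

theorem FminusPos_le {x y : ℝ} (hx : x ∈ Ioo 0 (2 * π)) (hy : y ∈ Ioo 0 (2 * π)) :
    FminusPos x y ≤ 4 := max_le (Fminus_le hx hy) (by norm_num)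

/-- The weight with which the collision equation is averaged to prove regularity. -/
noncomputable def gainWeight (x z : ℝ) : ℝ := K2 x z * FminusPos x (partner x z)

@[fun_prop]
theorem measurable_gainWeight {α : Type*} [MeasurableSpace α] {f g : α → ℝ} (hf : Measurable f)
    (hg : Measurable g) : Measurable fun x => gainWeight (f x) (g x) := by
  unfold gainWeight; fun_prop

theorem norm_gainWeight_le {x z : ℝ} (hx : x ∈ Ioo 0 (2 * π)) (hz : z ∈ Ioo 0 (2 * π))
    (h : x ≠ z) : ‖(gainWeight x z : ℂ)‖ ≤ 16 / omega x ^ 2 := by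
  rw [Complex.norm_real, gainWeight,
    norm_of_nonneg (mul_nonneg (K2_nonneg _ _) (FminusPos_nonneg _ _))]
  calc K2 x z * FminusPos x (partner x z) ≤ 4 / omega x ^ 2 * 4 :=
        mul_le_mul (K2_le hx hz) (FminusPos_le hx (partner_mem hx hz h)) (FminusPos_nonneg _ _)
          (by positivity)
    _ = _ := by ring

theorem ae_volI_mem_ne (x : ℝ) : ∀ᵐ z ∂volI, z ∈ Ioo 0 (2 * π) ∧ x ≠ z := by
  have h : ∀ᵐ z : ℝ, x ≠ z := by simp [ae_iff]
  filter_upwards [ae_volI_mem, ae_restrict_of_ae h] with z h1 h2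
  exact ⟨h1, h2⟩

theorem continuousOn_integral_gainWeight {g : ℝ → ℂ} (hgm : Measurable g)
    (hg : Integrable g volI) :
    ContinuousOn (fun x => ∫ z, (gainWeight x z : ℂ) * g z ∂volI) (Ioo 0 (2 * π)) := by
  intro x hx
  refine ContinuousAt.continuousWithinAt ?_
  have hω : ContinuousAt omega x := by unfold omega; fun_prop
  have h1 : ∀ᶠ y in 𝓝 x, omega x / 2 < omega y :=
    hω.eventually (lt_mem_nhds (half_lt_self (omega_pos hx)))
  refine continuousAt_of_dominated (bound := fun z => 16 / (omega x / 2) ^ 2 * ‖g z‖)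
    (Eventually.of_forall fun y => by fun_prop) ?_ (hg.norm.const_mul _) ?_
  · filter_upwards [h1, isOpen_Ioo.mem_nhds hx] with y hy1 hy2
    filter_upwards [ae_volI_mem_ne y] with z hz
    rw [norm_mul]
    have := omega_pos hx
    refine mul_le_mul_of_nonneg_right ((norm_gainWeight_le hy2 hz.1 hz.2).trans ?_) (norm_nonneg _)
    gcongr
  · filter_upwards [ae_volI_mem_ne x] with z hz
    refine ContinuousAt.mul ?_ continuousAt_const
    refine Complex.continuous_ofReal.continuousAt.comp ?_
    have e : ContinuousAt (fun y : ℝ => (y, z)) x := by fun_prop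
    have h2 : ContinuousAt (fun y => K2 y z) x :=
      ContinuousAt.comp (f := fun y : ℝ => (y, z)) (g := fun p : ℝ × ℝ => K2 p.1 p.2)
        (continuousAt_K2 (p := (x, z)) hx hz.1) e
    have h3 : ContinuousAt (fun y => partner y z) x :=
      ContinuousAt.comp (f := fun y : ℝ => (y, z)) (g := fun p : ℝ × ℝ => partner p.1 p.2)
        (continuousAt_partner (p := (x, z)) hx hz.1 hz.2) e
    exact h2.mul (ContinuousAt.comp (f := fun y : ℝ => (y, partner y z))
      (g := fun p : ℝ × ℝ => FminusPos p.1 p.2) continuous_FminusPos.continuousAt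
      (continuousAt_id.prodMk h3))

theorem abs_Fminus_le (x y : ℝ) : |Fminus x y| ≤ 8 := by
  unfold Fminus
  have h1 : |sin (x / 2) * sin (y / 2)| ≤ 1 := by
    rw [abs_mul]; exact mul_le_one₀ (abs_sin_le_one _) (abs_nonneg _) (abs_sin_le_one _)
  have h2 : |cos (x / 2) + cos (y / 2)| ≤ 2 :=
    (abs_add_le _ _).trans (by linarith [abs_cos_le_one (x / 2), abs_cos_le_one (y / 2)])
  have h3 : (cos (x / 2) + cos (y / 2)) ^ 2 ≤ 4 := by
    rw [← sq_abs]; nlinarith [abs_nonneg (cos (x / 2) + cos (y / 2))]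
  rw [abs_le] at h1 ⊢
  constructor <;> nlinarith [sq_nonneg (cos (x / 2) + cos (y / 2))]

theorem norm_sqrt_Fminus_le (x y : ℝ) : ‖((√(Fminus x y) : ℝ) : ℂ)‖ ≤ 3 := by
  rw [Complex.norm_real, norm_of_nonneg (sqrt_nonneg _)]
  exact sqrt_le_iff.2 ⟨by norm_num, by linarith [le_abs_self (Fminus x y), abs_Fminus_le x y]⟩

theorem integrable_sqrt_Fminus_mul {g : ℝ → ℂ} (hg : Integrable g volI)
    (x : ℝ) : Integrable (fun y => ((√(Fminus x y) : ℝ) : ℂ) * g y) volI :=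
  hg.bdd_mul (c := 3) (Measurable.aestronglyMeasurable (by fun_prop))
    (Eventually.of_forall fun y => norm_sqrt_Fminus_le x y)

theorem continuous_integral_sqrt_Fminus {g : ℝ → ℂ} (hgm : Measurable g)
    (hg : Integrable g volI) :
    Continuous fun x => ∫ y, ((√(Fminus x y) : ℝ) : ℂ) * g y ∂volI := by
  refine continuous_of_dominated (bound := fun y => 3 * ‖g y‖) (fun x => by fun_prop)
    (fun x => Eventually.of_forall fun y => ?_) (hg.norm.const_mul _)
    (Eventually.of_forall fun y => ?_)
  · rw [norm_mul]
    exact mul_le_mul_of_nonneg_right (norm_sqrt_Fminus_le x y) (norm_nonneg _)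
  · have h : Continuous fun x => Fminus x y := by unfold Fminus; fun_prop
    exact (Complex.continuous_ofReal.comp (continuous_sqrt.comp h)).mul continuous_const

theorem integral_sqrt_Fminus_pos {x : ℝ} (hx : x ∈ Ioo 0 (2 * π)) :
    0 < ∫ y, √(Fminus x y) ∂volI := by
  have hi : Integrable (fun y => √(Fminus x y)) volI :=
    Integrable.of_bound (C := 3) (Measurable.aestronglyMeasurable (by fun_prop))
      (Eventually.of_forall fun y => by
        have := norm_sqrt_Fminus_le x y; rwa [Complex.norm_real] at this)
  rw [integral_pos_iff_support_of_nonneg (fun y => sqrt_nonneg _) hi, pos_iff_ne_zero]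
  intro h0
  have h := lintegral_K2_Fminus_ge hx
  have h1 : ∀ᵐ z ∂volI, (if 0 < Fminus x z then ENNReal.ofReal (K2 x z) else 0) = 0 := by
    have : ∀ᵐ z ∂volI, z ∉ Function.support fun y => √(Fminus x y) := measure_eq_zero_iff_ae_notMem.1 h0
    filter_upwards [this] with z hz
    rw [Function.notMem_support, sqrt_eq_zero'] at hz
    rw [if_neg (not_lt.2 hz)]
  rw [lintegral_congr_ae h1, lintegral_zero] at h
  have := omega_pos hx
  exact absurd h (not_le.2 (ENNReal.ofReal_pos.2 (by positivity)))

/-- Averaging the collision equation over the outgoing momenta. -/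
theorem gain_identity {g : ℝ → ℂ} (hgm : Measurable g) (hg : Integrable g volI) {x : ℝ}
    (hx : x ∈ Ioo 0 (2 * π)) (h : ∀ᵐ z ∂volI, collisionDiff g (x, z) = 0) :
    4 * (∫ y, ((√(Fminus x y) : ℝ) : ℂ) ∂volI) * g x
      + 4 * ∫ y, ((√(Fminus x y) : ℝ) : ℂ) * g y ∂volI
      = 2 * ∫ z, (gainWeight x z : ℂ) * g z ∂volI := by
  have m1 := map_partner_withDensity hx
  have m2 := map_exchange_withDensity hx
  have k1 : Measurable fun y => K1 x y := by fun_prop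
  have k2 : Measurable fun y => K2 x y := by fun_prop
  -- The weight contains F₋⁺ at the partner. After the change of variables to the partner it meets
  -- K₁, and the product 4√F₋ is bounded and continuous.
  have gain : ∀ f : ℝ → ℂ, Measurable f → Integrable f volI →
      Integrable (fun z => (gainWeight x z : ℂ) * f (partner x z)) volI ∧
      ∫ z, (gainWeight x z : ℂ) * f (partner x z) ∂volI
        = 4 * ∫ y, ((√(Fminus x y) : ℝ) : ℂ) * f y ∂volI := by
    intro f hf hfi
    have e1 : (fun z => (gainWeight x z : ℂ) * f (partner x z)) = fun z =>
        (K2 x z : ℂ) * (fun y => (FminusPos x y : ℂ) * f y) (partner x z) := by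
      funext z; simp only [gainWeight, Complex.ofReal_mul, mul_assoc]
    have e2 : (fun y => (K1 x y : ℂ) * ((FminusPos x y : ℂ) * f y)) = fun y =>
        4 * (((√(Fminus x y) : ℝ) : ℂ) * f y) := by
      funext y
      rw [← mul_assoc, ← Complex.ofReal_mul, K1_mul_FminusPos]; push_cast; ring
    have hm : Measurable fun y => (FminusPos x y : ℂ) * f y := by fun_prop
    constructor
    · rw [e1, ← integrable_withDensity_ofReal k2 (K2_nonneg x)]
      refine m1.integrable_comp_of_integrable (g := fun y => (FminusPos x y : ℂ) * f y) ?_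
      rw [integrable_withDensity_ofReal k1 (K1_nonneg x), e2]
      exact (integrable_sqrt_Fminus_mul hfi x).const_mul 4
    · rw [e1, ← integral_withDensity_ofReal k2 (K2_nonneg x),
        integral_comp_measurePreserving m1 hm.aestronglyMeasurable,
        integral_withDensity_ofReal k1 (K1_nonneg x), e2, integral_const_mul]
  have hw : Integrable (fun z => (gainWeight x z : ℂ) * g z) volI :=
    hg.bdd_mul (c := 16 / omega x ^ 2) (Measurable.aestronglyMeasurable (by fun_prop))
      ((ae_volI_mem_ne x).mono fun z hz => norm_gainWeight_le hx hz.1 hz.2)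
  -- The weight depends on `z` through K₂ and the partner only. Exchanging the outgoing momenta
  -- keeps the partner and preserves K₂ dz, so both outgoing terms give the same integral.
  have loss : Integrable (fun z => (gainWeight x z : ℂ) * g (partner z x)) volI ∧
      ∫ z, (gainWeight x z : ℂ) * g (partner z x) ∂volI = ∫ z, (gainWeight x z : ℂ) * g z ∂volI := by
    have e1 : (fun z => (gainWeight x z : ℂ) * g (partner z x)) =ᵐ[volI] fun z =>
        (K2 x z : ℂ) * (fun y => (FminusPos x (partner x y) : ℂ) * g y) (partner z x) := by
      filter_upwards [ae_volI_mem_ne x] with z hz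
      simp only [gainWeight, Complex.ofReal_mul, mul_assoc, (partner_relations hx hz.1 hz.2).2.1]
    have e2 : (fun z => (gainWeight x z : ℂ) * g z) = fun z =>
        (K2 x z : ℂ) * ((FminusPos x (partner x z) : ℂ) * g z) := by
      funext z; simp only [gainWeight, Complex.ofReal_mul, mul_assoc]
    have hm : Measurable fun y => (FminusPos x (partner x y) : ℂ) * g y := by fun_prop
    constructor
    · rw [integrable_congr e1, ← integrable_withDensity_ofReal k2 (K2_nonneg x)]
      refine m2.integrable_comp_of_integrable
        (g := fun y => (FminusPos x (partner x y) : ℂ) * g y) ?_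
      rw [integrable_withDensity_ofReal k2 (K2_nonneg x)]
      rwa [e2] at hw
    · rw [integral_congr_ae e1, ← integral_withDensity_ofReal k2 (K2_nonneg x),
        integral_comp_measurePreserving m2 hm.aestronglyMeasurable,
        integral_withDensity_ofReal k2 (K2_nonneg x), e2]
  obtain ⟨c1, c2⟩ := gain (fun _ => 1) measurable_const (integrable_const 1)
  obtain ⟨b1, b2⟩ := gain g hgm hg
  simp only [mul_one] at c1 c2
  have d1 : Integrable (fun z => (gainWeight x z : ℂ) * g x) volI := c1.mul_const _
  have e : ∫ z, ((gainWeight x z : ℂ) * g x + (gainWeight x z : ℂ) * g (partner x z)) ∂volI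
      = ∫ z, ((gainWeight x z : ℂ) * g z + (gainWeight x z : ℂ) * g (partner z x)) ∂volI := by
    refine integral_congr_ae (h.mono fun z hz => ?_)
    unfold collisionDiff at hz
    linear_combination (gainWeight x z : ℂ) * hz
  rw [integral_add d1 b1, integral_add hw loss.1, integral_mul_const, c2, b2, loss.2] at e
  rw [e]; ring

theorem integrable_of_memLp_rateMeasure {g : ℝ → ℂ} (hgm : Measurable g)
    (hg : MemLp g 2 rateMeasure) : Integrable g volI := by
  have h := integrable_of_memLp_rate hg
  unfold rateMeasure at h
  rw [integrable_withDensity_ofReal measurable_V V_nonneg] at h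
  refine (h.norm.const_mul 80).mono' hgm.aestronglyMeasurable (ae_volI_mem.mono fun x hx => ?_)
  have h1 : 1 ≤ 80 * V x := by
    have h2 := V_ge hx
    have h3 : 1 ≤ omega x ^ (-(1 / 3) : ℝ) :=
      one_le_rpow_of_pos_of_le_one_of_nonpos (omega_pos hx) (omega_le_one x) (by norm_num)
    linarith
  rw [norm_mul, Complex.norm_real, norm_of_nonneg (V_nonneg x), ← mul_assoc]
  exact le_mul_of_one_le_left (norm_nonneg _) h1

theorem ae_volI_prod_of_collisionMeasure {P : ℝ × ℝ → Prop} (h : ∀ᵐ p ∂collisionMeasure, P p) :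
    ∀ᵐ p ∂(volI.prod volI), P p := by
  refine (withDensity_absolutelyContinuous' (by fun_prop) ?_).ae_le h
  filter_upwards [ae_volI_prod] with p hp
  simpa using K2_pos hp.1 hp.2.1

/-- The averaged equation can be solved for g(x), because ∫ √F₋(x, y) dy > 0. The resulting
expression consists of integrals depending continuously on x. -/
theorem exists_continuousOn_of_collisionDiff_eq_zero {g : ℝ → ℂ} (hgm : Measurable g)
    (hg : MemLp g 2 rateMeasure) (h : ∀ᵐ p ∂collisionMeasure, collisionDiff g p = 0) :
    ∃ G : ℝ → ℂ, ContinuousOn G (Ioo 0 (2 * π)) ∧ g =ᵐ[volI] G := by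
  have hgi := integrable_of_memLp_rateMeasure hgm hg
  have h1 : ∀ᵐ x ∂volI, ∀ᵐ z ∂volI, collisionDiff g (x, z) = 0 :=
    Measure.ae_ae_of_ae_prod (ae_volI_prod_of_collisionMeasure h)
  refine ⟨fun x => (2 * (∫ z, (gainWeight x z : ℂ) * g z ∂volI)
    - 4 * ∫ y, ((√(Fminus x y) : ℝ) : ℂ) * g y ∂volI)
      / (4 * ∫ y, ((√(Fminus x y) : ℝ) : ℂ) ∂volI), ?_, ?_⟩
  · have a1 := continuousOn_integral_gainWeight hgm hgi
    have a2 := continuous_integral_sqrt_Fminus hgm hgi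
    have a3 := continuous_integral_sqrt_Fminus (g := fun _ => 1) measurable_const
      (integrable_const 1)
    simp only [mul_one] at a3
    refine ContinuousOn.div ((continuousOn_const.mul a1).sub (continuous_const.mul a2).continuousOn)
      (continuous_const.mul a3).continuousOn fun x hx => ?_
    rw [integral_complex_ofReal]
    have := (integral_sqrt_Fminus_pos hx).ne'
    norm_cast
    positivity
  · filter_upwards [h1, ae_volI_mem] with x hx hx'
    have h2 := gain_identity hgm hgi hx' hx
    have h3 : (4 * ∫ y, ((√(Fminus x y) : ℝ) : ℂ) ∂volI) ≠ 0 := by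
      rw [integral_complex_ofReal]
      have := (integral_sqrt_Fminus_pos hx').ne'
      norm_cast
      positivity
    rw [eq_div_iff h3]
    linear_combination h2

theorem measurePreserving_reflect : MeasurePreserving (fun x => 2 * π - x) volI volI := by
  refine measurePreserving_of_lintegral (by fun_prop) fun F _ => ?_
  rw [volI_eq, lintegral_Ioo_reflect 0 (2 * π) (2 * π)]
  simp

/-- The only odd collision invariant of finite norm is zero. -/
theorem ae_eq_zero_of_collisionDiff_eq_zero {g : ℝ → ℂ} (hgm : Measurable g)
    (hg : MemLp g 2 rateMeasure) (h : ∀ᵐ p ∂collisionMeasure, collisionDiff g p = 0)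
    (hodd : ∀ᵐ x ∂volI, g (2 * π - x) = -g x) : g =ᵐ[volI] 0 := by
  obtain ⟨G, hG, hgG⟩ := exists_continuousOn_of_collisionDiff_eq_zero hgm hg h
  have hr : ∀ x ∈ Ioo 0 (2 * π), 2 * π - x ∈ Ioo 0 (2 * π) := fun x hx =>
    ⟨by linarith [hx.2], by linarith [hx.1]⟩
  have hGodd : EqOn (fun x => G (2 * π - x)) (fun x => -G x) (Ioo 0 (2 * π)) := by
    refine Measure.eqOn_open_of_ae_eq (μ := volume) ?_ isOpen_Ioo
      (hG.comp (by fun_prop) hr) hG.neg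
    rw [← volI_eq]
    filter_upwards [hodd, hgG, measurePreserving_reflect.quasiMeasurePreserving.ae hgG]
      with x h1 h2 h3
    rw [← h2, ← h3, h1]
  -- The partner map is continuous off the diagonal, so on the open triangle the almost everywhere
  -- identity holds everywhere.
  have hGinv : EqOn (fun p : ℝ × ℝ => G p.1 + G (partner p.1 p.2))
      (fun p => G p.2 + G (partner p.2 p.1))
      ((Ioo 0 (2 * π) ×ˢ Ioo 0 (2 * π)) ∩ {p | p.1 < p.2}) := by
    have ho : IsOpen ((Ioo 0 (2 * π) ×ˢ Ioo 0 (2 * π)) ∩ {p : ℝ × ℝ | p.1 < p.2}) :=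
      (isOpen_Ioo.prod isOpen_Ioo).inter (isOpen_lt continuous_fst continuous_snd)
    have hc : ∀ x ∈ Ioo 0 (2 * π), ContinuousAt G x := fun x hx =>
      hG.continuousAt (isOpen_Ioo.mem_nhds hx)
    refine Measure.eqOn_open_of_ae_eq (μ := volume) ?_ ho ?_ ?_
    · refine ae_restrict_of_ae_restrict_of_subset inter_subset_left ?_
      rw [Measure.volume_eq_prod, ← Measure.prod_restrict, ← volI_eq]
      refine ae_volI_prod_of_collisionMeasure ?_
      filter_upwards [h, ae_collisionMeasure_of_ae (rateMeasure_absolutelyContinuous.ae_le hgG)]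
        with p h1 ⟨h2, h3, h4, h5⟩
      rw [← h2, ← h3, ← h4, ← h5]
      unfold collisionDiff at h1
      linear_combination h1
    · rintro p ⟨⟨h1, h2⟩, h3⟩
      have h3 : p.1 < p.2 := h3
      refine ContinuousAt.continuousWithinAt (ContinuousAt.add ?_ ?_)
      · exact ContinuousAt.comp (hc _ h1) continuousAt_fst
      · exact ContinuousAt.comp (f := fun p : ℝ × ℝ => partner p.1 p.2)
          (hc _ (partner_mem h1 h2 h3.ne)) (continuousAt_partner h1 h2 h3.ne)
    · rintro p ⟨⟨h1, h2⟩, h3⟩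
      have h3 : p.1 < p.2 := h3
      refine ContinuousAt.continuousWithinAt (ContinuousAt.add ?_ ?_)
      · exact ContinuousAt.comp (hc _ h2) continuousAt_snd
      · have h4 : ContinuousAt (fun p : ℝ × ℝ => partner p.2 p.1) p :=
          ContinuousAt.comp (f := Prod.swap) (g := fun p : ℝ × ℝ => partner p.1 p.2)
            (continuousAt_partner (p := p.swap) h2 h1 h3.ne') continuous_swap.continuousAt
        exact ContinuousAt.comp (f := fun p : ℝ × ℝ => partner p.2 p.1)
          (hc _ (partner_mem h2 h1 h3.ne')) h4
  have hd : ∀ a ∈ Ioo 0 π, 2 * a ∈ Ioo 0 (2 * π) := fun a ha =>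
    ⟨by linarith [ha.1], by linarith [ha.2]⟩
  have hH : IsOddInvariant fun a => G (2 * a) := by
    refine ⟨hG.comp (by fun_prop) hd, fun a ha => ?_, fun a ha c hc hac => ?_⟩
    · have := hGodd (hd a ha)
      simp only at this
      rw [← this]; congr 1; ring
    · have := hGinv (x := (2 * a, 2 * c)) ⟨⟨hd a ha, hd c hc⟩, by
        change 2 * a < 2 * c; linarith⟩
      simpa only [partner, mul_div_cancel_left₀ _ (two_ne_zero' ℝ)] using this
  filter_upwards [hgG, ae_volI_mem] with x h1 h2
  have := hH.eq_zero (half_mem h2)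
  rw [show 2 * (x / 2) = x by ring] at this
  rw [h1, this]; rfl

end FPU

/-! ### Momentum reflection commutes with the collision operator -/

namespace FPU

open Real Set

open scoped ENNReal ComplexConjugate

theorem reflect_half (x : ℝ) : (2 * π - x) / 2 = π - x / 2 := by ring

theorem omega_reflect (x : ℝ) : omega (2 * π - x) = omega x := by
  rw [omega, omega, reflect_half, sin_pi_sub]

theorem K2_reflect (x y : ℝ) : K2 (2 * π - x) (2 * π - y) = K2 x y := by
  rw [K2_eq_half, K2_eq_half, reflect_half, reflect_half, K2Half_mirror]

theorem partner_reflect {x z : ℝ} (h : x ≠ z) :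
    partner (2 * π - x) (2 * π - z) = 2 * π - partner x z := by
  unfold partner
  rw [reflect_half, reflect_half, partnerHalf_mirror fun h' => h (by linarith)]
  ring

theorem V_reflect (x : ℝ) : V (2 * π - x) = V x := by
  unfold V
  have h := measurePreserving_reflect.integral_comp
    (MeasurableEquiv.subLeft (2 * π)).measurableEmbedding (fun y => K2 (2 * π - x) y)
  simp only [K2_reflect] at h
  exact h.symm

theorem measurePreserving_reflect_rate :
    MeasurePreserving (fun x => 2 * π - x) rateMeasure rateMeasure := by
  refine measurePreserving_of_lintegral (by fun_prop) fun F hF => ?_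
  rw [lintegral_rateMeasure hF, lintegral_rateMeasure (F := fun x => F (2 * π - x)) (by fun_prop),
    ← measurePreserving_reflect.lintegral_comp (f := fun x => ENNReal.ofReal (V x) * F x)
      (by fun_prop)]
  simp only [V_reflect]

theorem measurePreserving_reflect_collision :
    MeasurePreserving (fun p : ℝ × ℝ => (2 * π - p.1, 2 * π - p.2)) collisionMeasure
      collisionMeasure := by
  refine measurePreserving_of_lintegral (by fun_prop) fun F hF => ?_
  rw [lintegral_collisionMeasure hF,
    lintegral_collisionMeasure (F := fun p => F (2 * π - p.1, 2 * π - p.2)) (by fun_prop),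
    ← measurePreserving_reflect.lintegral_comp
      (f := fun x => ∫⁻ z, ENNReal.ofReal (K2 x z) * F (x, z) ∂volI)
      (Measurable.lintegral_prod_right' (f := fun p : ℝ × ℝ => ENNReal.ofReal (K2 p.1 p.2) * F p)
        (by fun_prop))]
  refine lintegral_congr fun x => ?_
  rw [← measurePreserving_reflect.lintegral_comp
      (f := fun z => ENNReal.ofReal (K2 (2 * π - x) z) * F (2 * π - x, z)) (by fun_prop)]
  simp only [K2_reflect]

/-- The momentum reflection `x ↦ 2π - x` on `L²(I)`. -/
noncomputable def reflectL2 : L2I →ₗᵢ[ℂ] L2I :=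
  Lp.compMeasurePreservingₗᵢ ℂ _ measurePreserving_reflect

/-- The momentum reflection `x ↦ 2π - x` on `L²(V dx)`. -/
noncomputable def reflectRate : RateL2 →ₗᵢ[ℂ] RateL2 :=
  Lp.compMeasurePreservingₗᵢ ℂ _ measurePreserving_reflect_rate

/-- The momentum reflection on functions of collisions. -/
noncomputable def reflectColl : CollL2 →ₗᵢ[ℂ] CollL2 :=
  Lp.compMeasurePreservingₗᵢ ℂ _ measurePreserving_reflect_collision

theorem reflectL2_coe (f : L2I) : reflectL2 f =ᵐ[volI] fun x => f (2 * π - x) :=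
  Lp.coeFn_compMeasurePreserving f measurePreserving_reflect

theorem reflectRate_coe (g : RateL2) : reflectRate g =ᵐ[rateMeasure] fun x => g (2 * π - x) :=
  Lp.coeFn_compMeasurePreserving g measurePreserving_reflect_rate

theorem reflectColl_coe (g : CollL2) :
    reflectColl g =ᵐ[collisionMeasure] fun p => g (2 * π - p.1, 2 * π - p.2) :=
  Lp.coeFn_compMeasurePreserving g measurePreserving_reflect_collision

theorem reflectL2_reflectL2 (f : L2I) : reflectL2 (reflectL2 f) = f := by
  refine Lp.ext ?_
  filter_upwards [reflectL2_coe (reflectL2 f),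
    measurePreserving_reflect.quasiMeasurePreserving.ae (reflectL2_coe f)] with x h1 h2
  rw [h1, h2, sub_sub_cancel]

theorem inner_reflectL2 (f g : L2I) : ⟪f, reflectL2 g⟫_ℂ = ⟪reflectL2 f, g⟫_ℂ := by
  rw [← reflectL2.inner_map_map, reflectL2_reflectL2]

theorem reflectColl_reflectColl (g : CollL2) : reflectColl (reflectColl g) = g := by
  refine Lp.ext ?_
  filter_upwards [reflectColl_coe (reflectColl g),
    measurePreserving_reflect_collision.quasiMeasurePreserving.ae (reflectColl_coe g)] with x h1 h2
  rw [h1, h2, sub_sub_cancel, sub_sub_cancel]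

theorem mulOmega_reflectL2 (f : L2I) : mulOmega (reflectL2 f) = reflectRate (mulOmega f) := by
  refine Lp.ext ?_
  filter_upwards [mulOmega_coe_rate (reflectL2 f), reflectRate_coe (mulOmega f),
    rateMeasure_absolutelyContinuous.ae_le (reflectL2_coe f),
    measurePreserving_reflect_rate.quasiMeasurePreserving.ae (mulOmega_coe_rate f)]
    with x h1 h2 h3 h4
  rw [h1, h2, h3, h4, omega_reflect]

theorem collOp_reflectRate (g : RateL2) : collOp (reflectRate g) = reflectColl (collOp g) := by
  refine Lp.ext ?_
  filter_upwards [collOp_coe (reflectRate g), reflectColl_coe (collOp g),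
    measurePreserving_reflect_collision.quasiMeasurePreserving.ae (collOp_coe g),
    ae_collisionMeasure_of_ae (reflectRate_coe g), ae_collisionMeasure]
    with p h1 h2 h3 ⟨h4, h5, h6, h7⟩ ⟨_, _, h8⟩
  rw [h1, h2, h3]
  simp only [collisionDiff, h4, h5, h6, h7, partner_reflect h8, partner_reflect h8.symm]

theorem Ltilde_reflectL2 (f : L2I) : Ltilde (reflectL2 f) = reflectL2 (Ltilde f) := by
  refine ext_inner_left ℂ fun φ => ?_
  rw [inner_Ltilde, mulOmega_reflectL2, collOp_reflectRate, inner_reflectL2, inner_Ltilde,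
    mulOmega_reflectL2, collOp_reflectRate, ← reflectColl.inner_map_map, reflectColl_reflectColl]

end FPU

/-! ### Splitting K₁ - 2K₂ into a subcritical part and a Hilbert-Schmidt part -/

namespace FPU

open Real Set

open scoped ENNReal ComplexConjugate

/-- Twice the kernel `K₂`, restricted to the region where `K₁` vanishes. -/
noncomputable def blockedKernel (x y : ℝ) : ℝ := if 0 < Fminus x y then 0 else 2 * K2 x y

/-- The excess of `K₁` over `2 K₂` in the region where `K₁` is positive. -/
noncomputable def surplusKernel (x y : ℝ) : ℝ := K1 x y - if 0 < Fminus x y then 2 * K2 x y else 0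

section measurability

variable {α : Type*} [MeasurableSpace α] {f g : α → ℝ}

@[fun_prop]
theorem measurable_blockedKernel (hf : Measurable f) (hg : Measurable g) :
    Measurable fun x => blockedKernel (f x) (g x) := by
  unfold blockedKernel
  exact Measurable.ite (measurableSet_lt measurable_const (by fun_prop)) (by fun_prop)
    (by fun_prop)

@[fun_prop]
theorem measurable_surplusKernel (hf : Measurable f) (hg : Measurable g) :
    Measurable fun x => surplusKernel (f x) (g x) := by
  unfold surplusKernel
  exact Measurable.sub (by fun_prop) (Measurable.ite
    (measurableSet_lt measurable_const (by fun_prop)) (by fun_prop) (by fun_prop))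

end measurability

theorem surplusKernel_sub_blockedKernel (x y : ℝ) :
    surplusKernel x y - blockedKernel x y = K1 x y - 2 * K2 x y := by
  unfold surplusKernel blockedKernel; split_ifs <;> ring

theorem surplusKernel_comm (x y : ℝ) : surplusKernel x y = surplusKernel y x := by
  unfold surplusKernel; rw [K1_comm, Fminus_comm, K2_comm]

theorem surplusKernel_nonneg {x y : ℝ} (hx : x ∈ Ioo 0 (2 * π)) (hy : y ∈ Ioo 0 (2 * π)) :
    0 ≤ surplusKernel x y := by
  unfold surplusKernel
  split_ifs with h
  · exact sub_nonneg.2 (two_mul_K2_le_K1 hx hy h)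
  · simpa using K1_nonneg x y

theorem blockedKernel_nonneg (x y : ℝ) : 0 ≤ blockedKernel x y := by
  unfold blockedKernel; split_ifs
  · exact le_rfl
  · exact mul_nonneg two_pos.le (K2_nonneg x y)

theorem blockedKernel_le (x y : ℝ) : blockedKernel x y ≤ 2 * K2 x y := by
  unfold blockedKernel; split_ifs
  · exact mul_nonneg two_pos.le (K2_nonneg x y)
  · exact le_rfl

/-- The row integral of K₁ is exactly V, for which Schur's test yields nothing. Removing 2K₂ where
F₋ > 0 keeps the kernel nonnegative and lowers the row integral by at least ω^(-1/3) / 40, a fixed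
fraction of V. -/
theorem exists_lintegral_surplusKernel_le :
    ∃ δ : ℝ, 0 < δ ∧ δ ≤ 1 ∧ ∀ x ∈ Ioo 0 (2 * π),
      ∫⁻ y, ENNReal.ofReal (surplusKernel x y) ∂volI ≤ ENNReal.ofReal ((1 - δ) * V x) := by
  obtain ⟨C, hC0, hC⟩ := exists_V_le
  refine ⟨min (1 / (40 * C)) 1, by positivity, min_le_right _ _, fun x hx => ?_⟩
  have h0 := omega_pos hx
  have h1 : ∫⁻ y, ENNReal.ofReal (surplusKernel x y) ∂volI
      + ∫⁻ y, ENNReal.ofReal (if 0 < Fminus x y then 2 * K2 x y else 0) ∂volI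
        = ENNReal.ofReal (V x) := by
    rw [← lintegral_K1 hx, ← lintegral_add_left (by fun_prop)]
    refine lintegral_congr_ae (ae_volI_mem.mono fun y hy => ?_)
    simp only
    have : 0 ≤ if 0 < Fminus x y then 2 * K2 x y else 0 := by
      split_ifs
      · exact mul_nonneg two_pos.le (K2_nonneg x y)
      · exact le_rfl
    rw [← ENNReal.ofReal_add (surplusKernel_nonneg hx hy) this]
    unfold surplusKernel; congr 1; ring
  have h2 : ENNReal.ofReal (min (1 / (40 * C)) 1 * V x)
      ≤ ∫⁻ y, ENNReal.ofReal (if 0 < Fminus x y then 2 * K2 x y else 0) ∂volI := by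
    have e : ∀ y, ENNReal.ofReal (if 0 < Fminus x y then 2 * K2 x y else 0)
        = 2 * (if 0 < Fminus x y then ENNReal.ofReal (K2 x y) else 0) := by
      intro y
      split_ifs
      · rw [ENNReal.ofReal_mul two_pos.le, ENNReal.ofReal_ofNat]
      · simp
    simp_rw [e]
    rw [lintegral_const_mul' _ _ (by simp)]
    refine le_trans ?_ (mul_le_mul_right (lintegral_K2_Fminus_ge hx) 2)
    rw [show (2 : ℝ≥0∞) = ENNReal.ofReal 2 by simp, ← ENNReal.ofReal_mul two_pos.le]
    refine ENNReal.ofReal_le_ofReal ?_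
    calc min (1 / (40 * C)) 1 * V x ≤ 1 / (40 * C) * (C * omega x ^ (-(1 / 3) : ℝ)) := by
          gcongr
          · exact V_nonneg x
          · exact min_le_left _ _
          · exact hC x hx
      _ = _ := by field_simp; norm_num
  rw [sub_mul, one_mul, ENNReal.ofReal_sub _ (by have := V_nonneg x; positivity)]
  refine ENNReal.le_sub_of_add_le_right ENNReal.ofReal_ne_top ?_
  rw [← h1]
  gcongr

theorem integral_rateMeasure (f : ℝ → ℂ) :
    ∫ x, f x ∂rateMeasure = ∫ x, (V x : ℂ) * f x ∂volI :=
  integral_withDensity_ofReal measurable_V V_nonneg f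

theorem integrable_rateMeasure (f : ℝ → ℂ) :
    Integrable f rateMeasure ↔ Integrable (fun x => (V x : ℂ) * f x) volI :=
  integrable_withDensity_ofReal measurable_V V_nonneg f

theorem norm_sq_rate (g : RateL2) :
    Integrable (fun x => V x * ‖g x‖ ^ 2) volI ∧ ‖g‖ ^ 2 = ∫ x, V x * ‖g x‖ ^ 2 ∂volI := by
  have h1 := L2.integrable_inner (𝕜 := ℂ) g g
  have h2 := L2.inner_def (𝕜 := ℂ) g g
  have e : ∀ x, (V x : ℂ) * ⟪g x, g x⟫_ℂ = ((V x * ‖g x‖ ^ 2 : ℝ) : ℂ) := fun x => by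
    rw [inner_self_eq_norm_sq_to_K]; push_cast; rfl
  rw [integrable_rateMeasure] at h1
  rw [integral_rateMeasure] at h2
  simp only [e] at h1 h2
  rw [integral_complex_ofReal, inner_self_eq_norm_sq_to_K] at h2
  constructor
  · refine h1.norm.congr (Eventually.of_forall fun x => ?_)
    simp only
    rw [Complex.norm_real, norm_of_nonneg (mul_nonneg (V_nonneg x) (sq_nonneg _))]
  · refine Complex.ofReal_injective ?_
    rw [← h2]; push_cast; rfl

theorem lintegral_V_mul_enorm_sq (g : RateL2) :
    ∫⁻ x, ENNReal.ofReal (V x) * ‖g x‖ₑ ^ 2 ∂volI = ENNReal.ofReal (‖g‖ ^ 2) := by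
  obtain ⟨h1, h2⟩ := norm_sq_rate g
  rw [h2, ofReal_integral_eq_lintegral_ofReal h1
    (Eventually.of_forall fun x => mul_nonneg (V_nonneg x) (sq_nonneg _))]
  refine lintegral_congr fun x => ?_
  rw [ENNReal.ofReal_mul (V_nonneg x), ENNReal.ofReal_pow (norm_nonneg _), ofReal_norm]

theorem ennreal_two_mul_mul_le (a b : ℝ≥0∞) : 2 * (a * b) ≤ a ^ 2 + b ^ 2 := by
  wlog h : a ≤ b generalizing a b
  · rw [mul_comm a, add_comm]; exact this b a (le_of_not_ge h)
  obtain ⟨c, rfl⟩ := exists_add_of_le h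
  calc 2 * (a * (a + c)) ≤ 2 * (a * (a + c)) + c ^ 2 := le_self_add
    _ = _ := by ring

/-- Schur's test for the surplus kernel. -/
theorem lintegral_surplusKernel_mul_le {δ : ℝ} (hδ : ∀ x ∈ Ioo 0 (2 * π),
      ∫⁻ y, ENNReal.ofReal (surplusKernel x y) ∂volI ≤ ENNReal.ofReal ((1 - δ) * V x))
    (g : RateL2) :
    ∫⁻ x, ∫⁻ y, ENNReal.ofReal (surplusKernel x y) * (‖g x‖ₑ * ‖g y‖ₑ) ∂volI ∂volI
      ≤ ENNReal.ofReal ((1 - δ) * ‖g‖ ^ 2) := by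
  have hgm := (Lp.stronglyMeasurable g).measurable
  have hq : ∫⁻ x, ∫⁻ y, ENNReal.ofReal (surplusKernel x y) * ‖g x‖ₑ ^ 2 ∂volI ∂volI
      ≤ ENNReal.ofReal ((1 - δ) * ‖g‖ ^ 2) := by
    rw [ENNReal.ofReal_mul' (sq_nonneg _), ← lintegral_V_mul_enorm_sq,
      ← lintegral_const_mul' _ _ ENNReal.ofReal_ne_top]
    refine lintegral_mono_ae (ae_volI_mem.mono fun x hx => ?_)
    rw [lintegral_mul_const _ (by fun_prop), ← mul_assoc, ← ENNReal.ofReal_mul' (V_nonneg x)]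
    gcongr
    exact hδ x hx
  have hs : ∫⁻ x, ∫⁻ y, ENNReal.ofReal (surplusKernel x y) * ‖g y‖ₑ ^ 2 ∂volI ∂volI
      = ∫⁻ x, ∫⁻ y, ENNReal.ofReal (surplusKernel x y) * ‖g x‖ₑ ^ 2 ∂volI ∂volI := by
    rw [lintegral_lintegral_swap (by fun_prop)]
    simp_rw [fun x y => surplusKernel_comm y x]
  have h2 : 2 * ∫⁻ x, ∫⁻ y, ENNReal.ofReal (surplusKernel x y) * (‖g x‖ₑ * ‖g y‖ₑ) ∂volI ∂volI
      ≤ 2 * ENNReal.ofReal ((1 - δ) * ‖g‖ ^ 2) := by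
    calc _ = ∫⁻ x, ∫⁻ y, ENNReal.ofReal (surplusKernel x y) * (2 * (‖g x‖ₑ * ‖g y‖ₑ))
            ∂volI ∂volI := by
          rw [← lintegral_const_mul' _ _ (by simp)]
          refine lintegral_congr fun x => ?_
          rw [← lintegral_const_mul' _ _ (by simp)]
          refine lintegral_congr fun y => ?_
          ring
      _ ≤ ∫⁻ x, ∫⁻ y, (ENNReal.ofReal (surplusKernel x y) * ‖g x‖ₑ ^ 2
            + ENNReal.ofReal (surplusKernel x y) * ‖g y‖ₑ ^ 2) ∂volI ∂volI := by
          refine lintegral_mono fun x => lintegral_mono fun y => ?_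
          rw [← mul_add]
          gcongr
          exact ennreal_two_mul_mul_le _ _
      _ = ∫⁻ x, ((∫⁻ y, ENNReal.ofReal (surplusKernel x y) * ‖g x‖ₑ ^ 2 ∂volI)
            + ∫⁻ y, ENNReal.ofReal (surplusKernel x y) * ‖g y‖ₑ ^ 2 ∂volI) ∂volI := by
          refine lintegral_congr fun x => ?_
          rw [lintegral_add_left (by fun_prop)]
      _ = (∫⁻ x, ∫⁻ y, ENNReal.ofReal (surplusKernel x y) * ‖g x‖ₑ ^ 2 ∂volI ∂volI)
            + ∫⁻ x, ∫⁻ y, ENNReal.ofReal (surplusKernel x y) * ‖g y‖ₑ ^ 2 ∂volI ∂volI :=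
          lintegral_add_left (Measurable.lintegral_prod_right'
            (f := fun p : ℝ × ℝ => ENNReal.ofReal (surplusKernel p.1 p.2) * ‖g p.1‖ₑ ^ 2)
              (by fun_prop)) _
      _ ≤ _ := by rw [hs, two_mul]; gcongr
  exact (ENNReal.mul_le_mul_iff_right (by simp) (by simp)).1 h2

/-- With K₂² ≤ 1 / (ω(x) ω(y)) and division by V(y), the integrand is of order ω(y)^(-2/3) / ω(x). A
further division by V(x) makes it integrable in x too: relative to V dx the kernel is
Hilbert-Schmidt. -/
theorem exists_integral_blockedKernel_sq :
    ∃ C : ℝ, 0 ≤ C ∧ ∀ x ∈ Ioo 0 (2 * π),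
      ∫⁻ y, ‖((blockedKernel x y / V y : ℝ) : ℂ)‖ₑ ^ 2 ∂rateMeasure
        ≤ ENNReal.ofReal (C / omega x) := by
  refine ⟨320 * ∫ y, omega y ^ (-(2 / 3) : ℝ) ∂volI, mul_nonneg (by norm_num)
    (integral_nonneg fun y => rpow_nonneg (omega_nonneg y) _), fun x hx => ?_⟩
  have hx0 := omega_pos hx
  have hi := integrable_omega_rpow (κ := 2 / 3) (by norm_num) (by norm_num)
  rw [lintegral_rateMeasure (by fun_prop), mul_div_right_comm,
    ENNReal.ofReal_mul (by positivity), ofReal_integral_eq_lintegral_ofReal hi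
      (Eventually.of_forall fun y => rpow_nonneg (omega_nonneg y) _),
    ← lintegral_const_mul' _ _ ENNReal.ofReal_ne_top]
  refine lintegral_mono_ae (ae_volI_mem.mono fun y hy => ?_)
  have hy0 := omega_pos hy
  have hV := V_pos hy
  rw [← ofReal_norm, ← ENNReal.ofReal_pow (norm_nonneg _), ← ENNReal.ofReal_mul (V_nonneg y),
    ← ENNReal.ofReal_mul (by positivity), Complex.norm_real, norm_eq_abs, sq_abs]
  refine ENNReal.ofReal_le_ofReal ?_
  have h1 : blockedKernel x y ^ 2 ≤ 4 / (omega x * omega y) := by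
    calc blockedKernel x y ^ 2 ≤ (2 * K2 x y) ^ 2 := by
          gcongr
          · exact blockedKernel_nonneg x y
          · exact blockedKernel_le x y
      _ = 4 * K2 x y ^ 2 := by ring
      _ ≤ 4 * (1 / (omega x * omega y)) := by gcongr; exact K2_sq_le hx hy
      _ = _ := by ring
  calc V y * (blockedKernel x y / V y) ^ 2 = blockedKernel x y ^ 2 / V y := by field_simp
    _ ≤ 4 / (omega x * omega y) / (1 / 80 * omega y ^ (-(1 / 3) : ℝ)) := by
        gcongr
        exact V_ge hy
    _ = 320 / omega x * omega y ^ (-(2 / 3) : ℝ) := by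
        rw [show (-(2 / 3) : ℝ) = (-1) - (-(1 / 3)) by norm_num, rpow_sub hy0, rpow_neg_one]
        have := rpow_pos_of_pos hy0 (-(1 / 3))
        field_simp
        norm_num

/-- Each value of the blocked operator is an inner product in L²(V dx), so it converges along weakly
convergent sequences. -/
theorem exists_blockedVector :
    ∃ C : ℝ, 0 ≤ C ∧ ∀ x ∈ Ioo 0 (2 * π), ∃ b : RateL2, ‖b‖ ^ 2 ≤ C / omega x ∧
      ∀ g : RateL2, ∫ y, (blockedKernel x y : ℂ) * g y ∂volI = ⟪b, g⟫_ℂ := by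
  obtain ⟨C, hC0, hC⟩ := exists_integral_blockedKernel_sq
  refine ⟨C, hC0, fun x hx => ?_⟩
  have hx0 := omega_pos hx
  have hb : MemLp (fun y => ((blockedKernel x y / V y : ℝ) : ℂ)) 2 rateMeasure := by
    refine ⟨Measurable.aestronglyMeasurable (by fun_prop), ?_⟩
    rw [eLpNorm_two_eq]
    exact ENNReal.rpow_lt_top_of_nonneg (by norm_num) ((hC x hx).trans_lt ENNReal.ofReal_lt_top).ne
  refine ⟨hb.toLp _, ?_, fun g => ?_⟩
  · have h1 := hC x hx
    rw [← ENNReal.ofReal_le_ofReal_iff (by positivity)]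
    refine le_trans (le_of_eq ?_) h1
    rw [Lp.norm_toLp, eLpNorm_two_eq, ← ENNReal.toReal_rpow, ← rpow_natCast, ← rpow_mul
      ENNReal.toReal_nonneg, Nat.cast_ofNat, div_mul_cancel₀ _ (two_ne_zero' ℝ), rpow_one]
    exact ENNReal.ofReal_toReal (h1.trans_lt ENNReal.ofReal_lt_top).ne
  · rw [L2.inner_def]
    have e : ∫ y, ⟪hb.toLp _ y, g y⟫_ℂ ∂rateMeasure
        = ∫ y, ((blockedKernel x y / V y : ℝ) : ℂ) * g y ∂rateMeasure := by
      refine integral_congr_ae (hb.coeFn_toLp.mono fun y hy => ?_)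
      simp only
      rw [hy, RCLike.inner_apply, Complex.conj_ofReal, mul_comm]
    rw [e]
    rw [integral_rateMeasure]
    refine integral_congr_ae (ae_volI_mem.mono fun y hy => ?_)
    have := (V_pos hy).ne'
    simp only
    rw [← mul_assoc, ← Complex.ofReal_mul]
    congr 2
    field_simp

end FPU

/-! ### Coercivity and the spectral gap on odd functions -/

namespace FPU

open Real Set

open scoped ENNReal ComplexConjugate

/-- The collision form is coercive up to the Hilbert-Schmidt part of the gain term. -/
theorem exists_collOp_lower_bound :
    ∃ δ : ℝ, 0 < δ ∧ ∀ g : RateL2,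
      δ * ‖g‖ ^ 2 - (1 / (4 * δ)) * ∫ x, ‖∫ y, (blockedKernel x y : ℂ) * g y ∂volI‖ ^ 2 / V x ∂volI
        ≤ ‖collOp g‖ ^ 2 ∧
      Integrable (fun x => ‖∫ y, (blockedKernel x y : ℂ) * g y ∂volI‖ ^ 2 / V x) volI := by
  obtain ⟨δ, hδ0, hδ1, hδ⟩ := exists_lintegral_surplusKernel_le
  obtain ⟨C, hC0, hC⟩ := exists_blockedVector
  -- Schur's test leaves δ‖g‖²; half of it is spent absorbing the blocked term.
  refine ⟨δ / 2, by positivity, fun g => ?_⟩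
  have hgm := (Lp.stronglyMeasurable g).measurable
  set B : ℝ → ℂ := fun x => ∫ y, (blockedKernel x y : ℂ) * g y ∂volI with hB
  set A : ℝ → ℂ := fun x => ∫ y, (surplusKernel x y : ℂ) * g y ∂volI with hA
  have hBm : Measurable B := by
    have : Measurable fun p : ℝ × ℝ => (blockedKernel p.1 p.2 : ℂ) * g p.2 := by fun_prop
    exact (this.stronglyMeasurable.integral_prod_right (ν := volI)).measurable
  have hAm : Measurable A := by
    have : Measurable fun p : ℝ × ℝ => (surplusKernel p.1 p.2 : ℂ) * g p.2 := by fun_prop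
    exact (this.stronglyMeasurable.integral_prod_right (ν := volI)).measurable
  have hBi : Integrable (fun x => ‖B x‖ ^ 2 / V x) volI := by
    have hi := (integrable_omega_rpow (κ := 2 / 3) (by norm_num) (by norm_num)).const_mul
      (80 * (C * ‖g‖ ^ 2))
    refine hi.mono' (Measurable.aestronglyMeasurable (by fun_prop))
      (ae_volI_mem.mono fun x hx => ?_)
    obtain ⟨b, hb1, hb2⟩ := hC x hx
    have hx0 := omega_pos hx
    have hV := V_pos hx
    have h1 : ‖B x‖ ^ 2 ≤ C / omega x * ‖g‖ ^ 2 := by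
      rw [hB]; simp only
      rw [hb2 g]
      calc ‖⟪b, g⟫_ℂ‖ ^ 2 ≤ (‖b‖ * ‖g‖) ^ 2 := by gcongr; exact norm_inner_le_norm b g
        _ = ‖b‖ ^ 2 * ‖g‖ ^ 2 := by ring
        _ ≤ _ := by gcongr
    rw [norm_of_nonneg (by positivity)]
    calc ‖B x‖ ^ 2 / V x ≤ C / omega x * ‖g‖ ^ 2 / (1 / 80 * omega x ^ (-(1 / 3) : ℝ)) := by
          gcongr
          exact V_ge hx
      _ = 80 * (C * ‖g‖ ^ 2) * omega x ^ (-(2 / 3) : ℝ) := by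
          rw [show (-(2 / 3) : ℝ) = (-1) - (-(1 / 3)) by norm_num, rpow_sub hx0, rpow_neg_one]
          have := rpow_pos_of_pos hx0 (-(1 / 3))
          field_simp
  refine ⟨?_, hBi⟩
  have hg := Lp.memLp g
  obtain ⟨hVi, hVn⟩ := norm_sq_rate g
  have htot := (integrable_collisionL_mul hgm hg hg).1
  have hform := inner_collOp g g
  have hAe : ∫⁻ x, ‖A x * conj (g x)‖ₑ ∂volI ≤ ENNReal.ofReal ((1 - δ) * ‖g‖ ^ 2) := by
    refine le_trans (lintegral_mono_ae (ae_volI_mem.mono fun x hx => ?_))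
      (lintegral_surplusKernel_mul_le hδ g)
    rw [enorm_mul, RCLike.enorm_conj]
    calc ‖A x‖ₑ * ‖g x‖ₑ ≤ (∫⁻ y, ‖(surplusKernel x y : ℂ) * g y‖ₑ ∂volI) * ‖g x‖ₑ := by
          gcongr; exact enorm_integral_le_lintegral_enorm _
      _ = ∫⁻ y, ‖(surplusKernel x y : ℂ) * g y‖ₑ * ‖g x‖ₑ ∂volI := by
          rw [lintegral_mul_const _ (by fun_prop)]
      _ = _ := by
          refine lintegral_congr_ae (ae_volI_mem.mono fun y hy => ?_)
          simp only
          rw [enorm_mul, ← ofReal_norm, Complex.norm_real,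
            norm_of_nonneg (surplusKernel_nonneg hx hy)]
          ring
  have hAi : Integrable (fun x => A x * conj (g x)) volI :=
    ⟨Measurable.aestronglyMeasurable (hAm.mul (Complex.continuous_conj.measurable.comp hgm)),
      hAe.trans_lt ENNReal.ofReal_lt_top⟩
  have hdec : ∀ᵐ x ∂volI, B x * conj (g x)
      = ((V x * ‖g x‖ ^ 2 : ℝ) : ℂ) + A x * conj (g x) - collisionL g x * conj (g x) := by
    filter_upwards [ae_integrable_K1 hgm (integrable_of_memLp_rate hg),
      ae_integrable_K2 hgm (integrable_of_memLp_rate hg), ae_volI_mem] with x h1 h2 hx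
    have hBx : Integrable (fun y => (blockedKernel x y : ℂ) * g y) volI := by
      refine (h2.norm.const_mul 2).mono' (Measurable.aestronglyMeasurable (by fun_prop))
        (Eventually.of_forall fun y => ?_)
      rw [norm_mul, norm_mul, ← mul_assoc, Complex.norm_real, Complex.norm_real,
        norm_of_nonneg (blockedKernel_nonneg x y), norm_of_nonneg (K2_nonneg x y)]
      gcongr
      exact blockedKernel_le x y
    have e : ∀ y, (surplusKernel x y : ℂ) * g y
        = (K1 x y : ℂ) * g y - 2 * ((K2 x y : ℂ) * g y) + (blockedKernel x y : ℂ) * g y := by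
      intro y
      have h3 : surplusKernel x y = K1 x y - 2 * K2 x y + blockedKernel x y := by
        linarith [surplusKernel_sub_blockedKernel x y]
      rw [h3]; push_cast; ring
    have hAx : A x = (∫ y, (K1 x y : ℂ) * g y ∂volI) - 2 * (∫ y, (K2 x y : ℂ) * g y ∂volI) + B x := by
      rw [hA]
      simp only [e]
      have h12 : Integrable (fun y => (K1 x y : ℂ) * g y - 2 * ((K2 x y : ℂ) * g y)) volI :=
        h1.sub (h2.const_mul 2)
      rw [integral_add h12 hBx, integral_sub h1 (h2.const_mul 2),
        integral_const_mul]
    rw [hAx]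
    unfold collisionL
    have h4 : ((V x * ‖g x‖ ^ 2 : ℝ) : ℂ) = (V x : ℂ) * (g x * conj (g x)) := by
      rw [Complex.mul_conj']; push_cast; rfl
    rw [h4]
    unfold volI
    ring
  have hVi' : Integrable (fun x => ((V x * ‖g x‖ ^ 2 : ℝ) : ℂ)) volI := hVi.ofReal
  have hBgi : Integrable (fun x => B x * conj (g x)) volI :=
    ((hVi'.add hAi).sub htot).congr (hdec.mono fun x hx => hx.symm)
  have hsum : ∫ x, B x * conj (g x) ∂volI = ((‖g‖ ^ 2 : ℝ) : ℂ) + ∫ x, A x * conj (g x) ∂volI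
      - ((‖collOp g‖ ^ 2 : ℝ) : ℂ) := by
    have h1 : ((‖collOp g‖ ^ 2 : ℝ) : ℂ) = ∫ x, collisionL g x * conj (g x) ∂volI := by
      rw [← hform, inner_self_eq_norm_sq_to_K]; push_cast; rfl
    have h2 : Integrable (fun x => ((V x * ‖g x‖ ^ 2 : ℝ) : ℂ) + A x * conj (g x)) volI :=
      hVi'.add hAi
    rw [integral_congr_ae hdec, integral_sub h2 htot, integral_add hVi' hAi,
      integral_complex_ofReal, hVn, h1]
  have hAb : ‖∫ x, A x * conj (g x) ∂volI‖ ≤ (1 - δ) * ‖g‖ ^ 2 := by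
    have h1 := (enorm_integral_le_lintegral_enorm (μ := volI) fun x => A x * conj (g x)).trans hAe
    rwa [← ofReal_norm, ENNReal.ofReal_le_ofReal_iff
      (mul_nonneg (sub_nonneg.2 hδ1) (sq_nonneg _))] at h1
  -- Young's inequality with weight δV, written as a completed square.
  have hBb : ‖∫ x, B x * conj (g x) ∂volI‖
      ≤ (1 / (2 * δ)) * (∫ x, ‖B x‖ ^ 2 / V x ∂volI) + δ / 2 * ‖g‖ ^ 2 := by
    rw [hVn, ← integral_const_mul, ← integral_const_mul,
      ← integral_add (hBi.const_mul _) (hVi.const_mul _)]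
    refine norm_integral_le_of_norm_le ((hBi.const_mul _).add (hVi.const_mul _))
      (ae_volI_mem.mono fun x hx => ?_)
    have hV := V_pos hx
    rw [norm_mul, RCLike.norm_conj]
    have h1 : 1 / (2 * δ) * (‖B x‖ ^ 2 / V x) + δ / 2 * (V x * ‖g x‖ ^ 2) - ‖B x‖ * ‖g x‖
        = (‖B x‖ - δ * V x * ‖g x‖) ^ 2 / (2 * δ * V x) := by
      field_simp; ring
    have h2 : 0 ≤ (‖B x‖ - δ * V x * ‖g x‖) ^ 2 / (2 * δ * V x) := by positivity
    linarith
  have hre : ‖collOp g‖ ^ 2 = ‖g‖ ^ 2 + (∫ x, A x * conj (g x) ∂volI).re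
      - (∫ x, B x * conj (g x) ∂volI).re := by
    have := congrArg Complex.re hsum
    rw [Complex.sub_re, Complex.add_re, Complex.ofReal_re, Complex.ofReal_re] at this
    linarith
  have h1 := (abs_le.1 (Complex.abs_re_le_norm (∫ x, A x * conj (g x) ∂volI))).1
  have h2 := Complex.re_le_norm (∫ x, B x * conj (g x) ∂volI)
  rw [show 4 * (δ / 2) = 2 * δ by ring]
  linarith

theorem eq_zero_of_odd_of_collOp_eq_zero {g : RateL2} (hodd : reflectRate g = -g)
    (h : collOp g = 0) : g = 0 := by
  have hgm := (Lp.stronglyMeasurable g).measurable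
  have h1 : ∀ᵐ p ∂collisionMeasure, collisionDiff g p = 0 := by
    filter_upwards [collOp_coe g, Lp.coeFn_zero ℂ 2 collisionMeasure] with p h1 h2
    rw [h, h2] at h1
    simpa using h1.symm
  have h2 : ∀ᵐ x ∂volI, g (2 * π - x) = -g x := by
    filter_upwards [absolutelyContinuous_rateMeasure.ae_le (reflectRate_coe g),
      absolutelyContinuous_rateMeasure.ae_le (Lp.coeFn_neg g)] with x h1 h2
    rw [← h1, hodd, h2, Pi.neg_apply]
  refine Lp.ext ?_
  have h3 := rateMeasure_absolutelyContinuous.ae_le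
    (ae_eq_zero_of_collisionDiff_eq_zero hgm (Lp.memLp g) h1 h2)
  filter_upwards [h3, Lp.coeFn_zero ℂ 2 rateMeasure] with x h1 h2
  rw [h1, h2]

instance : TopologicalSpace.SeparableSpace RateL2 := by
  unfold RateL2 rateMeasure
  have : Fact ((1 : ℝ≥0∞) ≤ 2) := ⟨one_le_two⟩
  have : Fact ((2 : ℝ≥0∞) ≠ ∞) := ⟨by simp⟩
  infer_instance

/-- A bounded sequence in a separable Hilbert space has a weakly convergent subsequence. -/
theorem exists_weak_limit {E : Type*} [NormedAddCommGroup E] [InnerProductSpace ℂ E]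
    [CompleteSpace E] [TopologicalSpace.SeparableSpace E] (u : ℕ → E) {r : ℝ}
    (hu : ∀ n, ‖u n‖ ≤ r) :
    ∃ v : E, ∃ φ : ℕ → ℕ, StrictMono φ ∧
      ∀ w : E, Tendsto (fun n => ⟪w, u (φ n)⟫_ℂ) atTop (𝓝 ⟪w, v⟫_ℂ) := by
  have hc := WeakDual.isSeqCompact_closedBall ℂ E 0 r
  have hmem : ∀ n, StrongDual.toWeakDual (InnerProductSpace.toDual ℂ E (u n)) ∈
      WeakDual.toStrongDual ⁻¹' Metric.closedBall (0 : StrongDual ℂ E) r := by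
    intro n
    change InnerProductSpace.toDual ℂ E (u n) ∈ Metric.closedBall (0 : StrongDual ℂ E) r
    rw [mem_closedBall_zero_iff, LinearIsometryEquiv.norm_map]
    exact hu n
  obtain ⟨ℓ, -, φ, hφ, hlim⟩ := hc hmem
  refine ⟨(InnerProductSpace.toDual ℂ E).symm (WeakDual.toStrongDual ℓ), φ, hφ, fun w => ?_⟩
  have h1 : Tendsto (fun n => ⟪u (φ n), w⟫_ℂ) atTop (𝓝 (ℓ w)) :=
    ((WeakDual.eval_continuous w).tendsto ℓ).comp hlim
  have h2 : ⟪(InnerProductSpace.toDual ℂ E).symm (WeakDual.toStrongDual ℓ), w⟫_ℂ = ℓ w :=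
    InnerProductSpace.toDual_symm_apply
  rw [← h2] at h1
  have h3 := (Complex.continuous_conj.tendsto _).comp h1
  simpa only [Function.comp_def, inner_conj_symm] using h3

/-- The collision form has a spectral gap on odd functions. -/
theorem exists_collOp_gap :
    ∃ δ : ℝ, 0 < δ ∧ ∀ g : RateL2, reflectRate g = -g → δ * ‖g‖ ^ 2 ≤ ‖collOp g‖ ^ 2 := by
  obtain ⟨δ, hδ0, hδ⟩ := exists_collOp_lower_bound
  obtain ⟨C, hC0, hC⟩ := exists_blockedVector
  by_contra! hcon
  have hseq : ∀ n : ℕ, ∃ g : RateL2, reflectRate g = -g ∧ ‖g‖ = 1 ∧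
      ‖collOp g‖ ^ 2 < 1 / ((n : ℝ) + 1) := by
    intro n
    obtain ⟨g, hg1, hg2⟩ := hcon (1 / ((n : ℝ) + 1)) (by positivity)
    have hg0 : 0 < ‖g‖ := by
      rw [norm_pos_iff]
      rintro rfl
      simp at hg2
    refine ⟨((‖g‖⁻¹ : ℝ) : ℂ) • g, ?_, ?_, ?_⟩
    · rw [map_smul, hg1, smul_neg]
    · rw [norm_smul, Complex.norm_real, norm_inv, norm_norm, inv_mul_cancel₀ hg0.ne']
    · rw [map_smul, norm_smul, Complex.norm_real, norm_inv, norm_norm, mul_pow, inv_pow,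
        inv_mul_lt_iff₀ (by positivity)]
      linarith
  -- A failing gap gives odd unit vectors whose images tend to zero. Their weak limit is an odd
  -- invariant, hence zero; the blocked term then vanishes in the limit, and the lower bound
  -- contradicts the unit norm.
  choose u hu1 hu2 hu3 using hseq
  obtain ⟨v, φ, hφ, hv⟩ := exists_weak_limit u (fun n => (hu2 n).le)
  have hinv : Tendsto (fun n : ℕ => 1 / ((n : ℝ) + 1)) atTop (𝓝 0) :=
    tendsto_one_div_add_atTop_nhds_zero_nat
  have hcoll : Tendsto (fun n => ‖collOp (u n)‖ ^ 2) atTop (𝓝 0) :=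
    squeeze_zero (fun n => by positivity) (fun n => (hu3 n).le) hinv
  have hv1 : collOp v = 0 := by
    refine ext_inner_left ℂ fun w => ?_
    rw [inner_zero_right, ← ContinuousLinearMap.adjoint_inner_left]
    refine tendsto_nhds_unique (hv _) ?_
    simp only [ContinuousLinearMap.adjoint_inner_left]
    rw [tendsto_zero_iff_norm_tendsto_zero]
    have h1 : Tendsto (fun n => ‖w‖ * ‖collOp (u (φ n))‖) atTop (𝓝 0) := by
      have h2 := (continuous_sqrt.tendsto 0).comp (hcoll.comp hφ.tendsto_atTop)
      simp only [Function.comp_def, sqrt_sq (norm_nonneg _), sqrt_zero] at h2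
      simpa using h2.const_mul ‖w‖
    exact squeeze_zero (fun n => norm_nonneg _) (fun n => norm_inner_le_norm _ _) h1
  have hv2 : reflectRate v = -v := by
    refine ext_inner_left ℂ fun w => ?_
    rw [← LinearIsometry.coe_toContinuousLinearMap, ← ContinuousLinearMap.adjoint_inner_left,
      inner_neg_right]
    refine tendsto_nhds_unique (hv _) ?_
    simp only [ContinuousLinearMap.adjoint_inner_left, LinearIsometry.coe_toContinuousLinearMap,
      hu1, inner_neg_right]
    exact (hv w).neg
  have hv0 : v = 0 := eq_zero_of_odd_of_collOp_eq_zero hv2 hv1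
  have hHS : Tendsto (fun n => ∫ x, ‖∫ y, (blockedKernel x y : ℂ) * u (φ n) y ∂volI‖ ^ 2 / V x
      ∂volI) atTop (𝓝 0) := by
    have hi := (integrable_omega_rpow (κ := 2 / 3) (by norm_num) (by norm_num)).const_mul (80 * C)
    have h0 : ∫ x, (0 : ℝ) ∂volI = 0 := integral_zero _ _
    rw [← h0]
    refine tendsto_integral_of_dominated_convergence (fun x => 80 * C * omega x ^ (-(2 / 3) : ℝ))
      (fun n => (hδ (u (φ n))).2.aestronglyMeasurable) hi (fun n => ?_) ?_
    · refine ae_volI_mem.mono fun x hx => ?_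
      obtain ⟨b, hb1, hb2⟩ := hC x hx
      have hx0 := omega_pos hx
      have hV := V_pos hx
      rw [hb2, norm_of_nonneg (by positivity)]
      have h1 : ‖⟪b, u (φ n)⟫_ℂ‖ ^ 2 ≤ C / omega x := by
        refine le_trans ?_ hb1
        gcongr
        simpa [hu2] using norm_inner_le_norm (𝕜 := ℂ) b (u (φ n))
      calc ‖⟪b, u (φ n)⟫_ℂ‖ ^ 2 / V x ≤ C / omega x / (1 / 80 * omega x ^ (-(1 / 3) : ℝ)) := by
            gcongr
            exact V_ge hx
        _ = 80 * C * omega x ^ (-(2 / 3) : ℝ) := by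
            rw [show (-(2 / 3) : ℝ) = (-1) - (-(1 / 3)) by norm_num, rpow_sub hx0, rpow_neg_one]
            have := rpow_pos_of_pos hx0 (-(1 / 3))
            field_simp
    · refine ae_volI_mem.mono fun x hx => ?_
      obtain ⟨b, hb1, hb2⟩ := hC x hx
      simp only [hb2]
      have h1 := hv b
      rw [hv0, inner_zero_right] at h1
      simpa using (h1.norm.pow 2).div_const (V x)
  have h1 : ∀ n, δ - (1 / (4 * δ)) *
      ∫ x, ‖∫ y, (blockedKernel x y : ℂ) * u (φ n) y ∂volI‖ ^ 2 / V x ∂volI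
        ≤ ‖collOp (u (φ n))‖ ^ 2 := fun n => by
    have := (hδ (u (φ n))).1
    rwa [hu2, one_pow, mul_one] at this
  have h2 := le_of_tendsto_of_tendsto' ((hHS.const_mul (1 / (4 * δ))).const_sub δ)
    (hcoll.comp hφ.tendsto_atTop) h1
  linarith

end FPU

/-! ### Comparison of the resolvent with its multiplicative part -/

namespace FPU

open Real Set

open scoped ENNReal ComplexConjugate

@[fun_prop]
theorem measurable_omegaDeriv : Measurable omegaDeriv :=
  Measurable.ite (measurableSet_singleton (0 : ℝ)) measurable_const (by fun_prop)

theorem omegaDeriv_eq {x : ℝ} (hx : x ∈ Ioo 0 (2 * π)) : omegaDeriv x = 1 / 2 * cos (x / 2) := by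
  rw [omegaDeriv, if_neg hx.1.ne']

theorem abs_omegaDeriv_le (x : ℝ) : |omegaDeriv x| ≤ 1 / 2 := by
  unfold omegaDeriv
  split_ifs
  · simp
  · rw [abs_mul, abs_of_pos (by norm_num : (0 : ℝ) < 1 / 2)]
    linarith [abs_cos_le_one (x / 2)]

theorem reflect_mem {x : ℝ} (hx : x ∈ Ioo 0 (2 * π)) : 2 * π - x ∈ Ioo 0 (2 * π) :=
  ⟨by linarith [hx.2], by linarith [hx.1]⟩

theorem omegaDeriv_reflect {x : ℝ} (hx : x ∈ Ioo 0 (2 * π)) :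
    omegaDeriv (2 * π - x) = -omegaDeriv x := by
  rw [omegaDeriv_eq hx, omegaDeriv_eq (reflect_mem hx), reflect_half, cos_pi_sub]; ring

/-- The symbol `ω² V` of the multiplication part of `L̃`. -/
noncomputable def lossSymbol (x : ℝ) : ℝ := omega x ^ 2 * V x

@[fun_prop]
theorem measurable_lossSymbol : Measurable lossSymbol := by
  unfold lossSymbol; fun_prop

theorem lossSymbol_nonneg (x : ℝ) : 0 ≤ lossSymbol x := mul_nonneg (sq_nonneg _) (V_nonneg x)

theorem lossSymbol_reflect (x : ℝ) : lossSymbol (2 * π - x) = lossSymbol x := by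
  rw [lossSymbol, lossSymbol, omega_reflect, V_reflect]

theorem lossSymbol_ge {x : ℝ} (hx : x ∈ Ioo 0 (2 * π)) :
    1 / 80 * omega x ^ (5 / 3 : ℝ) ≤ lossSymbol x := by
  have h0 := omega_pos hx
  calc 1 / 80 * omega x ^ (5 / 3 : ℝ) = omega x ^ 2 * (1 / 80 * omega x ^ (-(1 / 3) : ℝ)) := by
        rw [show (5 / 3 : ℝ) = (2 : ℕ) + (-(1 / 3)) by norm_num, rpow_add h0, rpow_natCast]; ring
    _ ≤ _ := by unfold lossSymbol; gcongr; exact V_ge hx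

/-- The solution of the resolvent equation for the multiplication part of `L̃`. -/
noncomputable def profile (r x : ℝ) : ℝ := omegaDeriv x / (r + lossSymbol x)

@[fun_prop]
theorem measurable_profile (r : ℝ) : Measurable (profile r) := by unfold profile; fun_prop

theorem memLp_profile {r : ℝ} (hr : 0 < r) : MemLp (fun x => (profile r x : ℂ)) 2 volI := by
  refine MemLp.of_bound (C := 1 / 2 / r) (Measurable.aestronglyMeasurable (by fun_prop))
    (Eventually.of_forall fun x => ?_)
  have h := lossSymbol_nonneg x
  rw [Complex.norm_real, norm_eq_abs, profile, abs_div, abs_of_pos (by linarith : 0 < r + _)]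
  gcongr
  · exact abs_omegaDeriv_le x
  · linarith

/-- `profile r` as a vector of `L²(I)`. -/
noncomputable def profileVec {r : ℝ} (hr : 0 < r) : L2I := (memLp_profile hr).toLp _

theorem profileVec_coe {r : ℝ} (hr : 0 < r) :
    profileVec hr =ᵐ[volI] fun x => (profile r x : ℂ) := (memLp_profile hr).coeFn_toLp

theorem omegaPrime_coe : omegaPrime =ᵐ[volI] fun x => (omegaDeriv x : ℂ) :=
  memLp_omegaDeriv.coeFn_toLp

theorem reflect_omegaPrime : reflectL2 omegaPrime = -omegaPrime := by
  refine Lp.ext ?_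
  filter_upwards [reflectL2_coe omegaPrime, Lp.coeFn_neg omegaPrime, omegaPrime_coe,
    measurePreserving_reflect.quasiMeasurePreserving.ae omegaPrime_coe, ae_volI_mem]
    with x h1 h2 h3 h4 hx
  rw [h1, h2, Pi.neg_apply, h3, h4, omegaDeriv_reflect hx]; push_cast; rfl

theorem reflect_profileVec {r : ℝ} (hr : 0 < r) :
    reflectL2 (profileVec hr) = -profileVec hr := by
  refine Lp.ext ?_
  filter_upwards [reflectL2_coe (profileVec hr), Lp.coeFn_neg (profileVec hr), profileVec_coe hr,
    measurePreserving_reflect.quasiMeasurePreserving.ae (profileVec_coe hr), ae_volI_mem]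
    with x h1 h2 h3 h4 hx
  rw [h1, h2, Pi.neg_apply, h3, h4, profile, profile, omegaDeriv_reflect hx, lossSymbol_reflect]
  push_cast; ring

/-- Weighted AM-GM gives r + ω^(5/3) ≥ r^(4/25) ω^(7/5). The weight is chosen so that the remaining
power ω^(-2/5) is the one the kernel bounds accept, while 4/25 < 1/5 keeps the final error below
r^(-2/5). -/
theorem omega_mul_profile_le {r : ℝ} (hr : 0 < r) {x : ℝ} (hx : x ∈ Ioo 0 (2 * π)) :
    ‖(omega x : ℂ) * (profile r x : ℂ)‖ ≤ 80 * r ^ (-(4 / 25) : ℝ) * omega x ^ (-(2 / 5) : ℝ) := by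
  have h0 := omega_pos hx
  have hW := lossSymbol_ge hx
  have hgm := geom_mean_le_arith_mean2_weighted (w₁ := 4 / 25) (w₂ := 21 / 25) (p₁ := r)
    (p₂ := omega x ^ (5 / 3 : ℝ)) (by norm_num) (by norm_num) hr.le (by positivity) (by norm_num)
  rw [← rpow_mul h0.le, show (5 / 3 : ℝ) * (21 / 25) = 7 / 5 by norm_num] at hgm
  have h5 : 0 < omega x ^ (5 / 3 : ℝ) := by positivity
  have h1 : 1 / 80 * (r ^ (4 / 25 : ℝ) * omega x ^ (7 / 5 : ℝ)) ≤ r + lossSymbol x := by linarith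
  rw [norm_mul, Complex.norm_real, Complex.norm_real, norm_of_nonneg h0.le, norm_eq_abs, profile,
    abs_div, abs_of_pos (by linarith : 0 < r + lossSymbol x)]
  calc omega x * (|omegaDeriv x| / (r + lossSymbol x))
      ≤ omega x * (1 / (1 / 80 * (r ^ (4 / 25 : ℝ) * omega x ^ (7 / 5 : ℝ)))) := by
        gcongr
        linarith [abs_omegaDeriv_le x]
    _ = _ := by
        rw [rpow_neg hr.le, show (-(2 / 5) : ℝ) = 1 - 7 / 5 by norm_num, rpow_sub h0, rpow_one]
        field_simp

/-- The residual of the profile in the full resolvent equation. -/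
noncomputable def residual {r : ℝ} (hr : 0 < r) : L2I :=
  ((r : ℂ) • (1 : L2I →L[ℂ] L2I) + Ltilde) (profileVec hr) - omegaPrime

theorem reflect_residual {r : ℝ} (hr : 0 < r) : reflectL2 (residual hr) = -residual hr := by
  unfold residual
  simp only [add_apply, smul_apply,
    one_apply_eq_self, map_sub, map_add, map_smul, ← Ltilde_reflectL2,
    reflect_profileVec, reflect_omegaPrime, map_neg]
  module

/-- The profile solves the multiplicative part exactly, so only the integral operators remain. -/
theorem residual_coe {r : ℝ} (hr : 0 < r) :
    residual hr =ᵐ[volI] fun x => (omega x : ℂ) *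
      ((∫ y, (K1 x y : ℂ) * ((omega y : ℂ) * (profile r y : ℂ)) ∂volI)
        - 2 * ∫ y, (K2 x y : ℂ) * ((omega y : ℂ) * (profile r y : ℂ)) ∂volI) := by
  have hω : (fun y => (omega y : ℂ) * profileVec hr y) =ᵐ[volI]
      fun y => (omega y : ℂ) * (profile r y : ℂ) := by
    filter_upwards [profileVec_coe hr] with y hy
    rw [hy]
  have e : residual hr = ((r : ℂ) • profileVec hr + Ltilde (profileVec hr)) - omegaPrime := rfl
  rw [e]
  filter_upwards [Lp.coeFn_sub ((r : ℂ) • profileVec hr + Ltilde (profileVec hr)) omegaPrime,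
    Lp.coeFn_add ((r : ℂ) • profileVec hr) (Ltilde (profileVec hr)),
    Lp.coeFn_smul (r : ℂ) (profileVec hr), Ltilde_apply_ae (profileVec hr), collisionL_congr hω,
    profileVec_coe hr, omegaPrime_coe] with x h1 h2 h3 h4 h5 h6 h7
  rw [h1, Pi.sub_apply, h2, Pi.add_apply, h3, Pi.smul_apply, h4, h7, h6, collisionLtilde, h5,
    collisionL]
  have h8 := lossSymbol_nonneg x
  have h9 : ((r : ℂ) + (lossSymbol x : ℂ)) * (profile r x : ℂ) = (omegaDeriv x : ℂ) := by
    rw [← Complex.ofReal_add, ← Complex.ofReal_mul, profile,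
      mul_div_cancel₀ _ (by positivity : r + lossSymbol x ≠ 0)]
  unfold lossSymbol at h9
  push_cast at h9
  rw [smul_eq_mul]
  unfold volI
  linear_combination h9

theorem exists_norm_residual_le :
    ∃ C : ℝ, 0 ≤ C ∧ ∀ (r : ℝ) (hr : 0 < r), ∀ᵐ x ∂volI,
      ‖residual hr x‖ ≤ C * r ^ (-(4 / 25) : ℝ) * omega x ^ (1 / 2 : ℝ) := by
  obtain ⟨C, hC0, hC⟩ := exists_lintegral_kernel_omega_le
  refine ⟨3 * (80 * C), by positivity, fun r hr => ?_⟩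
  filter_upwards [residual_coe hr, ae_volI_mem] with x h1 hx
  have h0 := omega_pos hx
  have key : ∀ k : ℝ → ℝ, (∀ y, 0 ≤ k y) → (∫⁻ z, ENNReal.ofReal (k z) *
      ENNReal.ofReal (omega z ^ (-(2 / 5) : ℝ)) ∂volI
        ≤ ENNReal.ofReal (C * omega x ^ (-(1 / 2) : ℝ))) →
      ‖∫ y, (k y : ℂ) * ((omega y : ℂ) * (profile r y : ℂ)) ∂volI‖
        ≤ 80 * r ^ (-(4 / 25) : ℝ) * (C * omega x ^ (-(1 / 2) : ℝ)) := by
    intro k hk hkC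
    rw [← ENNReal.ofReal_le_ofReal_iff (by positivity), ofReal_norm]
    refine (enorm_integral_le_lintegral_enorm _).trans ?_
    rw [ENNReal.ofReal_mul (by positivity)]
    refine le_trans ?_ (mul_le_mul_right hkC _)
    rw [← lintegral_const_mul' _ _ ENNReal.ofReal_ne_top]
    refine lintegral_mono_ae (ae_volI_mem.mono fun y hy => ?_)
    rw [enorm_mul, ← ofReal_norm, Complex.norm_real, norm_of_nonneg (hk y), mul_left_comm]
    gcongr
    rw [← ENNReal.ofReal_mul (by positivity), ← ofReal_norm]
    exact ENNReal.ofReal_le_ofReal (omega_mul_profile_le hr hy)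
  have h2 := key (K1 x) (K1_nonneg x) (hC x hx).1
  have h3 := key (K2 x) (K2_nonneg x) (hC x hx).2
  rw [h1, norm_mul, Complex.norm_real, norm_of_nonneg h0.le]
  calc _ ≤ omega x * (80 * r ^ (-(4 / 25) : ℝ) * (C * omega x ^ (-(1 / 2) : ℝ))
        + 2 * (80 * r ^ (-(4 / 25) : ℝ) * (C * omega x ^ (-(1 / 2) : ℝ)))) := by
        gcongr
        refine (norm_sub_le _ _).trans (add_le_add h2 ?_)
        rw [norm_mul]
        simpa using h3
    _ = _ := by
        rw [show (1 / 2 : ℝ) = 1 + (-(1 / 2)) by norm_num, rpow_add h0, rpow_one]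
        norm_num
        ring

/-- The gap controls ‖ωf‖ in L²(V dx) only, so the residual is measured in the dual norm: the
representer is residual / (ωV). Its squared norm is ∫ |residual|² / (ω²V), bounded through ∫ ω^(1 -
5/3). -/
theorem exists_residual_dual :
    ∃ C : ℝ, 0 ≤ C ∧ ∀ (r : ℝ) (hr : 0 < r), ∃ k : RateL2, ‖k‖ ≤ C * r ^ (-(4 / 25) : ℝ) ∧
      ∀ f : L2I, ⟪f, residual hr⟫_ℂ = ⟪mulOmega f, k⟫_ℂ := by
  obtain ⟨C, hC0, hC⟩ := exists_norm_residual_le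
  set J := ∫ y, omega y ^ (-(2 / 3) : ℝ) ∂volI with hJ
  have hJ0 : 0 ≤ J := integral_nonneg fun y => rpow_nonneg (omega_nonneg y) _
  refine ⟨√(80 * J) * C, by positivity, fun r hr => ?_⟩
  have hm := (Lp.stronglyMeasurable (residual hr)).measurable
  have hi := integrable_omega_rpow (κ := 2 / 3) (by norm_num) (by norm_num)
  have hb : ∫⁻ x, ‖residual hr x / ((omega x * V x : ℝ) : ℂ)‖ₑ ^ 2 ∂rateMeasure
      ≤ ENNReal.ofReal ((√(80 * J) * C * r ^ (-(4 / 25) : ℝ)) ^ 2) := by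
    have e : (√(80 * J) * C * r ^ (-(4 / 25) : ℝ)) ^ 2
        = 80 * (C * r ^ (-(4 / 25) : ℝ)) ^ 2 * J := by
      rw [mul_pow, mul_pow, sq_sqrt (by positivity)]; ring
    rw [e, ENNReal.ofReal_mul (by positivity), hJ, ofReal_integral_eq_lintegral_ofReal hi
      (Eventually.of_forall fun y => rpow_nonneg (omega_nonneg y) _),
      ← lintegral_const_mul' _ _ ENNReal.ofReal_ne_top, lintegral_rateMeasure (by fun_prop)]
    refine lintegral_mono_ae ?_
    filter_upwards [hC r hr, ae_volI_mem] with x h1 hx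
    have h0 := omega_pos hx
    have hV := V_pos hx
    rw [← ofReal_norm, ← ENNReal.ofReal_pow (norm_nonneg _), ← ENNReal.ofReal_mul hV.le,
      ← ENNReal.ofReal_mul (by positivity)]
    refine ENNReal.ofReal_le_ofReal ?_
    rw [norm_div, Complex.norm_real, norm_of_nonneg (by positivity : 0 ≤ omega x * V x)]
    calc V x * (‖residual hr x‖ / (omega x * V x)) ^ 2
        = ‖residual hr x‖ ^ 2 / lossSymbol x := by unfold lossSymbol; field_simp
      _ ≤ (C * r ^ (-(4 / 25) : ℝ) * omega x ^ (1 / 2 : ℝ)) ^ 2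
          / (1 / 80 * omega x ^ (5 / 3 : ℝ)) := by
          gcongr
          exact lossSymbol_ge hx
      _ = _ := by
          rw [mul_pow, ← rpow_natCast (omega x ^ (1 / 2 : ℝ)), ← rpow_mul h0.le,
            show (-(2 / 3) : ℝ) = 1 / 2 * ((2 : ℕ) : ℝ) - 5 / 3 by norm_num, rpow_sub h0]
          field_simp
  have hk : MemLp (fun x => residual hr x / ((omega x * V x : ℝ) : ℂ)) 2 rateMeasure := by
    refine ⟨Measurable.aestronglyMeasurable (by fun_prop), ?_⟩
    rw [eLpNorm_two_eq]
    exact ENNReal.rpow_lt_top_of_nonneg (by norm_num) (hb.trans_lt ENNReal.ofReal_lt_top).ne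
  refine ⟨hk.toLp _, ?_, fun f => ?_⟩
  · refine le_of_sq_le_sq ?_ (by positivity)
    rw [← ENNReal.ofReal_le_ofReal_iff (by positivity)]
    refine le_trans (le_of_eq ?_) hb
    rw [Lp.norm_toLp, eLpNorm_two_eq, ← ENNReal.toReal_rpow, ← rpow_natCast, ← rpow_mul
      ENNReal.toReal_nonneg, Nat.cast_ofNat, div_mul_cancel₀ _ (two_ne_zero' ℝ), rpow_one]
    exact ENNReal.ofReal_toReal (hb.trans_lt ENNReal.ofReal_lt_top).ne
  · rw [L2.inner_def, L2.inner_def]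
    have e : ∫ y, ⟪mulOmega f y, hk.toLp _ y⟫_ℂ ∂rateMeasure
        = ∫ y, (residual hr y / ((omega y * V y : ℝ) : ℂ)) * conj ((omega y : ℂ) * f y)
          ∂rateMeasure := by
      refine integral_congr_ae ?_
      filter_upwards [hk.coeFn_toLp, mulOmega_coe_rate f] with y h1 h2
      rw [h1, h2, RCLike.inner_apply]
    rw [e, integral_rateMeasure]
    refine integral_congr_ae (ae_volI_mem.mono fun y hy => ?_)
    have h1 : (V y : ℂ) ≠ 0 := Complex.ofReal_ne_zero.2 (V_pos hy).ne'
    have h2 : (omega y : ℂ) ≠ 0 := Complex.ofReal_ne_zero.2 (omega_pos hy).ne'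
    simp only
    rw [RCLike.inner_apply, map_mul, Complex.conj_ofReal]
    push_cast
    field_simp

/-- The resolvent matrix element of the multiplication part of `L̃`. -/
noncomputable def lossResolvent (r : ℝ) : ℝ := ∫ x, omegaDeriv x ^ 2 / (r + lossSymbol x) ∂volI

theorem integrable_lossResolvent {r : ℝ} (hr : 0 < r) :
    Integrable (fun x => omegaDeriv x ^ 2 / (r + lossSymbol x)) volI := by
  refine Integrable.of_bound (C := (1 / 2) ^ 2 / r) (Measurable.aestronglyMeasurable (by fun_prop))
    (Eventually.of_forall fun x => ?_)
  have h := lossSymbol_nonneg x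
  rw [norm_of_nonneg (by positivity), ← sq_abs]
  gcongr
  · exact abs_omegaDeriv_le x
  · linarith

theorem lossResolvent_nonneg {r : ℝ} (hr : 0 < r) : 0 ≤ lossResolvent r :=
  integral_nonneg fun x => by have h := lossSymbol_nonneg x; positivity

theorem inner_omegaPrime_profileVec {r : ℝ} (hr : 0 < r) :
    ⟪omegaPrime, profileVec hr⟫_ℂ = (lossResolvent r : ℂ) := by
  rw [L2.inner_def, lossResolvent, ← integral_complex_ofReal]
  refine integral_congr_ae ?_
  filter_upwards [omegaPrime_coe, profileVec_coe hr] with x h1 h2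
  rw [h1, h2, RCLike.inner_apply, Complex.conj_ofReal, profile]
  push_cast; ring

theorem norm_mulOmega_profileVec_sq_le {r : ℝ} (hr : 0 < r) :
    ‖mulOmega (profileVec hr)‖ ^ 2 ≤ lossResolvent r := by
  obtain ⟨h1, h2⟩ := norm_sq_rate (mulOmega (profileVec hr))
  rw [h2]
  refine integral_mono_ae h1 (integrable_lossResolvent hr) ?_
  filter_upwards [mulOmega_coe (profileVec hr), profileVec_coe hr] with x h3 h4
  have h := lossSymbol_nonneg x
  rw [h3, h4, norm_mul, Complex.norm_real, Complex.norm_real, norm_eq_abs, norm_eq_abs, mul_pow,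
    sq_abs, sq_abs, profile]
  calc V x * (omega x ^ 2 * (omegaDeriv x / (r + lossSymbol x)) ^ 2)
      = omegaDeriv x ^ 2 / (r + lossSymbol x) * (lossSymbol x / (r + lossSymbol x)) := by
        have : 0 < r + lossSymbol x := by positivity
        rw [show V x * (omega x ^ 2 * (omegaDeriv x / (r + lossSymbol x)) ^ 2)
          = lossSymbol x * (omegaDeriv x / (r + lossSymbol x)) ^ 2 by unfold lossSymbol; ring]
        field_simp
    _ ≤ omegaDeriv x ^ 2 / (r + lossSymbol x) * 1 := by
        gcongr
        exact div_le_one_of_le₀ (by linarith) (by positivity)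
    _ = _ := mul_one _

theorem exists_norm_resolventR_sub_le :
    ∃ C : ℝ, 0 ≤ C ∧ ∀ r : ℝ, 0 < r → ‖resolventR Ltilde r - (lossResolvent r : ℂ)‖
      ≤ C * (r ^ (-(4 / 25) : ℝ) * √(lossResolvent r)) + C * (r ^ (-(4 / 25) : ℝ)) ^ 2 := by
  obtain ⟨C, hC0, hC⟩ := exists_residual_dual
  obtain ⟨δ, hδ0, hδ⟩ := exists_collOp_gap
  refine ⟨C + C ^ 2 / δ, by positivity, fun r hr => ?_⟩
  obtain ⟨k, hk1, hk2⟩ := hC r hr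
  set A : L2I →L[ℂ] L2I := (r : ℂ) • (1 : L2I →L[ℂ] L2I) + Ltilde with hA
  have hu : IsUnit A := isUnit_smul_one_add isPositive_Ltilde hr
  have hAinv : ∀ f, A (Ring.inverse A f) = f := fun f => by
    have := Ring.mul_inverse_cancel A hu
    simpa using DFunLike.congr_fun this f
  have hinvA : ∀ f, Ring.inverse A (A f) = f := fun f => by
    have := Ring.inverse_mul_cancel A hu
    simpa using DFunLike.congr_fun this f
  have hAR : ∀ f, A (reflectL2 f) = reflectL2 (A f) := fun f => by
    simp only [hA, add_apply, smul_apply,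
      one_apply_eq_self, Ltilde_reflectL2, map_add, map_smul]
  have hsymm : ∀ f g, ⟪A f, g⟫_ℂ = ⟪f, A g⟫_ℂ := fun f g => by
    have h1 := isPositive_Ltilde.isSymmetric f g
    simp only [ContinuousLinearMap.coe_coe] at h1
    simp only [hA, add_apply, smul_apply,
      one_apply_eq_self, inner_add_left, inner_add_right, inner_smul_left,
      inner_smul_right, Complex.conj_ofReal, h1]
  set φ := Ring.inverse A omegaPrime with hφ
  set ψ := profileVec hr with hψ
  set e := ψ - φ with he
  have hres : residual hr = A ψ - omegaPrime := rfl
  have hAe : A e = residual hr := by rw [he, map_sub, hAinv, hres]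
  have hodd : reflectL2 e = -e := by
    rw [← hinvA (reflectL2 e), hAR, hAe, reflect_residual, map_neg, ← hAe, hinvA]
  have hmodd : reflectRate (mulOmega e) = -mulOmega e := by
    rw [← mulOmega_reflectL2, hodd, map_neg]
  -- The error is odd, so δ‖ωe‖² ≤ ⟨e, A e⟩ = ⟨e, residual⟩ ≤ ‖ωe‖ ‖k‖, uniformly in r.
  have hgap := hδ _ hmodd
  have h1 : ‖⟪e, residual hr⟫_ℂ‖ ≤ ‖mulOmega e‖ * ‖k‖ := by
    rw [hk2]; exact norm_inner_le_norm _ _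
  have h2 : ‖collOp (mulOmega e)‖ ^ 2 ≤ ‖⟪e, residual hr⟫_ℂ‖ := by
    refine le_trans ?_ (Complex.re_le_norm _)
    rw [← hAe, hA]
    simp only [add_apply, smul_apply,
      one_apply_eq_self, inner_add_right, inner_smul_right, inner_Ltilde,
      Complex.add_re, Complex.re_ofReal_mul]
    have h3 : (⟪e, e⟫_ℂ).re = ‖e‖ ^ 2 := inner_self_eq_norm_sq (𝕜 := ℂ) e
    have h4 : (⟪collOp (mulOmega e), collOp (mulOmega e)⟫_ℂ).re = ‖collOp (mulOmega e)‖ ^ 2 :=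
      inner_self_eq_norm_sq (𝕜 := ℂ) _
    rw [h3, h4]
    have : 0 ≤ r * ‖e‖ ^ 2 := by positivity
    linarith
  have h3 : ‖mulOmega e‖ ≤ ‖k‖ / δ := by
    rcases (norm_nonneg (mulOmega e)).eq_or_lt with h0 | h0
    · rw [← h0]; positivity
    · rw [le_div_iff₀ hδ0]
      refine le_of_mul_le_mul_left ?_ h0
      nlinarith
  have h4 : ‖⟪ψ, residual hr⟫_ℂ‖ ≤ √(lossResolvent r) * ‖k‖ := by
    rw [hk2]
    refine (norm_inner_le_norm _ _).trans ?_
    gcongr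
    exact le_sqrt_of_sq_le (norm_mulOmega_profileVec_sq_le hr)
  -- Since A is symmetric and Aφ = ω', the difference is -⟨φ, residual⟩, and φ = ψ - e.
  have h5 : resolventR Ltilde r - (lossResolvent r : ℂ)
      = ⟪e, residual hr⟫_ℂ - ⟪ψ, residual hr⟫_ℂ := by
    rw [← inner_sub_left, he, sub_sub_cancel_left, inner_neg_left, ← hAe, ← hsymm, hAinv,
      he, inner_sub_right, inner_omegaPrime_profileVec]
    change ⟪omegaPrime, φ⟫_ℂ - _ = _
    ring
  have hr' : 0 < r ^ (-(4 / 25) : ℝ) := by positivity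
  have hk0 := norm_nonneg k
  have hs := sqrt_nonneg (lossResolvent r)
  rw [h5]
  calc _ ≤ ‖⟪e, residual hr⟫_ℂ‖ + ‖⟪ψ, residual hr⟫_ℂ‖ := norm_sub_le _ _
    _ ≤ ‖k‖ / δ * ‖k‖ + √(lossResolvent r) * ‖k‖ := by
        refine add_le_add (h1.trans ?_) h4
        gcongr
    _ ≤ C * r ^ (-(4 / 25) : ℝ) / δ * (C * r ^ (-(4 / 25) : ℝ))
        + √(lossResolvent r) * (C * r ^ (-(4 / 25) : ℝ)) := by gcongr
    _ = C ^ 2 / δ * (r ^ (-(4 / 25) : ℝ)) ^ 2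
        + C * (r ^ (-(4 / 25) : ℝ) * √(lossResolvent r)) := by ring
    _ ≤ (C + C ^ 2 / δ) * (r ^ (-(4 / 25) : ℝ)) ^ 2
        + (C + C ^ 2 / δ) * (r ^ (-(4 / 25) : ℝ) * √(lossResolvent r)) := by
        gcongr
        · linarith
        · have : 0 ≤ C ^ 2 / δ := by positivity
          linarith
    _ = _ := add_comm _ _

end FPU

/-! ### Small-momentum asymptotics of V and of the resolvent -/

namespace FPU

open Real Set

theorem integral_volI_eq (G : ℝ → ℝ) : ∫ x, G x ∂volI = ∫ x in (0 : ℝ)..(2 * π), G x := by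
  rw [volI_eq, intervalIntegral.integral_of_le two_pi_pos.le, integral_Ioc_eq_integral_Ioo]

/-- Rescaling of an interval integral, written as an integral over the half line. -/
theorem mul_integral_Ioi_indicator_scale {b p : ℝ} (hb : 0 < b) (hp : 0 ≤ p) (G : ℝ → ℝ) :
    b * ∫ s in Ioi (0 : ℝ), (Iic (p / b)).indicator (fun s => G (b * s)) s
      = ∫ t in (0 : ℝ)..p, G t := by
  rw [integral_indicator measurableSet_Iic, Measure.restrict_restrict measurableSet_Iic,
    inter_comm, Ioi_inter_Iic, ← intervalIntegral.integral_of_le (by positivity),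
    intervalIntegral.mul_integral_comp_mul_left, mul_zero, mul_div_cancel₀ _ hb.ne']

/-- The rescaled collision rate as an integral over a half line. -/
theorem mul_V_eq {b : ℝ} (hb : 0 < b) :
    b * V (2 * b ^ 3) = 2 * ∫ s in Ioi (0 : ℝ),
      (Iic (π / b)).indicator (fun s => b ^ 2 * K2Half (b ^ 3) (π - b * s)) s := by
  have h1 : V (2 * b ^ 3) = 2 * ∫ t in (0 : ℝ)..π, K2Half (b ^ 3) (π - t) := by
    unfold V
    rw [intervalIntegral.integral_comp_sub_left (fun t => K2Half (b ^ 3) t), sub_self, sub_zero,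
      integral_volI_eq]
    have := intervalIntegral.mul_integral_comp_mul_left (a := 0) (b := π)
      (f := fun y => K2 (2 * b ^ 3) y) (2 : ℝ)
    rw [mul_zero] at this
    rw [← this]
    simp only [K2_eq_half, mul_div_cancel_left₀ _ (two_ne_zero' ℝ)]
  have h2 : ∀ s, (Iic (π / b)).indicator (fun s => b ^ 2 * K2Half (b ^ 3) (π - b * s)) s
      = b ^ 2 * (Iic (π / b)).indicator (fun s => K2Half (b ^ 3) (π - b * s)) s := fun s =>
    indicator_const_mul _ _ _ _
  have h3 := mul_integral_Ioi_indicator_scale hb pi_pos.le (fun t => K2Half (b ^ 3) (π - t))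
  simp_rw [h2]
  rw [integral_const_mul, h1, ← h3]
  ring

theorem tendsto_sin_div {f : ℝ → ℝ} {c : ℝ} (h : HasDerivAt f c 0) (h0 : f 0 = 0) :
    Tendsto (fun b => sin (f b) / b) (𝓝[>] 0) (𝓝 c) := by
  have h1 : HasDerivAt (fun b => sin (f b)) c 0 := by
    have := h.sin
    rwa [h0, cos_zero, one_mul] at this
  have h2 := h1.tendsto_slope_zero_right
  simp only [zero_add, h0, sin_zero, sub_zero, smul_eq_mul] at h2
  refine h2.congr fun b => ?_
  rw [div_eq_inv_mul]

/-- Writing the difference of cosines as a product of sines removes the cancellation between two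
quantities near 1, so each factor can be rescaled separately. -/
theorem FplusHalf_pi_sub (a t : ℝ) :
    FplusHalf a (π - t) = (2 * sin ((t + a) / 2) * sin ((t - a) / 2)) ^ 2 + 4 * sin a * sin t := by
  unfold FplusHalf
  rw [cos_pi_sub, sin_pi_sub, ← sub_eq_add_neg, cos_sub_cos, ← neg_sub t a, neg_div, sin_neg,
    add_comm a t]
  ring

/-- At a = b³ and t = bs the squared term contributes (s²/2)² b⁴ and the product of sines
contributes 4 b³ · bs: the scaling is the one that balances them. -/
theorem tendsto_scaled_FplusHalf (s : ℝ) :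
    Tendsto (fun b : ℝ => FplusHalf (b ^ 3) (π - b * s) / b ^ 4) (𝓝[>] 0)
      (𝓝 (s ^ 4 / 4 + 4 * s)) := by
  have d3 : HasDerivAt (fun b : ℝ => b ^ 3) 0 0 := by simpa using hasDerivAt_pow 3 (0 : ℝ)
  have ds : HasDerivAt (fun b : ℝ => b * s) s 0 := by
    simpa using (hasDerivAt_id (0 : ℝ)).mul_const s
  have h1 := tendsto_sin_div ((ds.add d3).div_const 2) (by simp)
  have h2 := tendsto_sin_div ((ds.sub d3).div_const 2) (by simp)
  have h3 := tendsto_sin_div ds (by simp)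
  have h4 := (tendsto_sin_div (hasDerivAt_id (0 : ℝ)) rfl)
  have hb3 : Tendsto (fun b : ℝ => b ^ 3) (𝓝[>] 0) (𝓝[>] 0) := by
    refine tendsto_nhdsWithin_iff.2 ⟨?_, ?_⟩
    · have : Tendsto (fun b : ℝ => b ^ 3) (𝓝 0) (𝓝 (0 ^ 3)) := (continuous_pow 3).tendsto 0
      rw [zero_pow three_ne_zero] at this
      exact this.mono_left nhdsWithin_le_nhds
    · filter_upwards [self_mem_nhdsWithin] with b hb
      exact pow_pos (mem_Ioi.1 hb) 3
  have h5 := h4.comp hb3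
  have h6 := (((h1.const_mul 2).mul h2).pow 2).add ((h5.const_mul 4).mul h3)
  have e : (2 * ((s + 0) / 2) * ((s - 0) / 2)) ^ 2 + 4 * 1 * s = s ^ 4 / 4 + 4 * s := by ring
  rw [e] at h6
  refine h6.congr' ?_
  filter_upwards [self_mem_nhdsWithin] with b hb
  have hb0 : b ≠ 0 := (mem_Ioi.1 hb).ne'
  rw [FplusHalf_pi_sub]
  simp only [Function.comp_apply, id, Pi.add_apply, Pi.sub_apply]
  field_simp

theorem tendsto_scaled_K2Half {s : ℝ} (hs : 0 < s) :
    Tendsto (fun b : ℝ => b ^ 2 * K2Half (b ^ 3) (π - b * s)) (𝓝[>] 0)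
      (𝓝 (2 / √(s ^ 4 / 4 + 4 * s))) := by
  have h1 := ((continuous_sqrt.tendsto _).comp (tendsto_scaled_FplusHalf s))
  have h2 : √(s ^ 4 / 4 + 4 * s) ≠ 0 := (sqrt_pos.2 (by positivity)).ne'
  refine ((tendsto_const_nhds (x := (2 : ℝ))).div h1 h2).congr' ?_
  filter_upwards [self_mem_nhdsWithin] with b hb
  have hb0 : 0 < b := mem_Ioi.1 hb
  simp only [Function.comp_apply, Pi.div_apply]
  rw [sqrt_div' _ (by positivity), show b ^ 4 = (b ^ 2) ^ 2 by ring, sqrt_sq (by positivity),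
    K2Half]
  change _ = b ^ 2 * (2 / √(FplusHalf (b ^ 3) (π - b * s)))
  rw [div_div_eq_mul_div]
  ring

/-- This is the dominating function for the rescaled rate. The profile bound covers bs ≤ π/2; beyond
that K₂ is bounded and b² is at most a constant over s². -/
theorem scaled_K2Half_le {b s : ℝ} (hb0 : 0 < b) (hb1 : b ≤ 1) (hs : 0 < s) (hs' : b * s < π) :
    b ^ 2 * K2Half (b ^ 3) (π - b * s) ≤ 100 * (1 / (s ^ 2 + √s)) := by
  have ha : b ^ 3 ∈ Ioo 0 π :=
    ⟨by positivity, lt_of_le_of_lt (pow_le_one₀ hb0.le hb1) (by linarith [pi_gt_three])⟩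
  have ha1 : b ^ 3 ≤ 1 := pow_le_one₀ hb0.le hb1
  have hq := sqrt_pos.2 hs
  rcases le_or_gt (b * s) (π / 2) with h | h
  · have h1 := K2Half_le_profile (pi_sub_mem ha) (c := b * s) ⟨by positivity, h⟩
    rw [← K2Half_mirror, sub_sub_cancel, sin_pi_sub] at h1
    have h2 : b ^ 3 / 4 ≤ sin (b ^ 3) := by
      have := mul_le_sin ha.1.le (by linarith [pi_gt_three])
      refine le_trans ?_ this
      rw [div_mul_eq_mul_div, le_div_iff₀ pi_pos]
      nlinarith [pi_le_four, ha.1]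
    have h3 : b ^ 2 * √s / 2 ≤ √(sin (b ^ 3) * (b * s)) := by
      refine le_sqrt_of_sq_le ?_
      rw [div_pow, mul_pow, sq_sqrt hs.le]
      have := mul_le_mul_of_nonneg_right h2 (by positivity : 0 ≤ b * s)
      nlinarith
    calc b ^ 2 * K2Half (b ^ 3) (π - b * s)
        ≤ b ^ 2 * (32 / ((b * s) ^ 2 + b ^ 2 * √s / 2)) := by
          gcongr
          refine h1.trans ?_
          gcongr
      _ = 32 / (s ^ 2 + √s / 2) := by field_simp
      _ ≤ 100 * (1 / (s ^ 2 + √s)) := by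
          rw [mul_one_div, div_le_div_iff₀ (by positivity) (by positivity)]
          nlinarith [sq_nonneg s]
  · have h1 : 1 / 4 ≤ FplusHalf (b ^ 3) (π - b * s) := by
      have c1 : 1 / 2 ≤ cos (b ^ 3) := by
        have := one_sub_sq_div_two_le_cos (x := b ^ 3)
        nlinarith [ha.1]
      have c2 : 0 ≤ cos (π - b * s) := cos_nonneg_of_mem_Icc ⟨by linarith, by linarith⟩
      have c3 := sin_pos_of_mem_Ioo ha
      have c4 := sin_pos_of_mem_Ioo (pi_sub_mem (⟨by positivity, hs'⟩ : b * s ∈ Ioo 0 π))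
      unfold FplusHalf
      nlinarith [mul_pos c3 c4]
    have h2 : K2Half (b ^ 3) (π - b * s) ≤ 4 := by
      change 2 / √(FplusHalf (b ^ 3) (π - b * s)) ≤ 4
      have : 1 / 2 ≤ √(FplusHalf (b ^ 3) (π - b * s)) :=
        le_sqrt_of_sq_le (by norm_num; linarith)
      rw [div_le_iff₀ (by linarith)]
      linarith
    have h4 : 1 ≤ s := by nlinarith [pi_gt_three]
    have h5 : √s ≤ s ^ 2 := sqrt_le_iff.2 ⟨by positivity, by nlinarith [sq_nonneg (s ^ 2 - s), pow_pos hs 3]⟩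
    have h6 : (b * s) ^ 2 ≤ 3.15 ^ 2 := by gcongr; linarith [pi_lt_d2]
    calc b ^ 2 * K2Half (b ^ 3) (π - b * s) ≤ b ^ 2 * 4 := by gcongr
      _ ≤ 100 * (1 / (s ^ 2 + √s)) := by
        rw [mul_one_div, le_div_iff₀ (by positivity)]
        have : b ^ 2 * 4 * (s ^ 2 + √s) ≤ b ^ 2 * 4 * (s ^ 2 + s ^ 2) := by gcongr
        nlinarith

/-- The constant in the asymptotics of the collision rate at small momenta. -/
noncomputable def rateConst : ℝ := 2 * ∫ s in Ioi (0 : ℝ), 2 / √(s ^ 4 / 4 + 4 * s)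

theorem tendsto_mul_V : Tendsto (fun b : ℝ => b * V (2 * b ^ 3)) (𝓝[>] 0) (𝓝 rateConst) := by
  have key : Tendsto (fun b : ℝ => ∫ s in Ioi (0 : ℝ),
      (Iic (π / b)).indicator (fun s => b ^ 2 * K2Half (b ^ 3) (π - b * s)) s) (𝓝[>] 0)
      (𝓝 (∫ s in Ioi (0 : ℝ), 2 / √(s ^ 4 / 4 + 4 * s))) := by
    refine tendsto_integral_filter_of_dominated_convergence
      (fun s => 100 * (1 / (s ^ 2 + √s))) (Eventually.of_forall fun b => ?_) ?_
      (integrableOn_profile.const_mul 100) ?_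
    · refine AEStronglyMeasurable.indicator (Measurable.aestronglyMeasurable ?_) measurableSet_Iic
      unfold K2Half FplusHalf
      fun_prop
    · filter_upwards [Ioo_mem_nhdsGT (zero_lt_one' ℝ)] with b hb
      filter_upwards [ae_restrict_mem measurableSet_Ioi,
        ae_restrict_of_ae (Measure.ae_ne volume (π / b))] with s hs hs'
      have hs0 : 0 < s := hs
      by_cases h : s ∈ Iic (π / b)
      · rw [indicator_of_mem h]
        have h1 : b * s < π := by
          have : s < π / b := lt_of_le_of_ne h hs'
          rw [lt_div_iff₀ hb.1] at this
          linarith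
        have h2 : 0 ≤ K2Half (b ^ 3) (π - b * s) := by
          change 0 ≤ 2 / √(FplusHalf _ _); positivity
        rw [norm_of_nonneg (by have := hb.1; positivity)]
        exact scaled_K2Half_le hb.1 hb.2.le hs0 h1
      · rw [indicator_of_notMem h, norm_zero]; positivity
    · filter_upwards [ae_restrict_mem measurableSet_Ioi] with s hs
      have hs0 : 0 < s := hs
      refine (tendsto_scaled_K2Half hs0).congr' ?_
      filter_upwards [Ioo_mem_nhdsGT (by positivity : 0 < π / s)] with b hb
      rw [indicator_of_mem]
      rw [mem_Iic, le_div_iff₀ hb.1]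
      have := hb.2
      rw [lt_div_iff₀ hs0] at this
      linarith
  refine (key.const_mul 2).congr' ?_
  filter_upwards [self_mem_nhdsWithin] with b hb
  exact (mul_V_eq hb).symm

/-- The uniform lower bound on V passes to the limit, so the integral need not be evaluated. -/
theorem rateConst_pos : 0 < rateConst := by
  refine lt_of_lt_of_le (by norm_num : (0 : ℝ) < 1 / 80) (ge_of_tendsto tendsto_mul_V ?_)
  filter_upwards [Ioo_mem_nhdsGT (zero_lt_one' ℝ)] with b hb
  have hb0 := hb.1
  have hb3 : b ^ 3 < 1 := pow_lt_one₀ hb0.le hb.2 three_ne_zero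
  have hx : 2 * b ^ 3 ∈ Ioo 0 (2 * π) := ⟨by positivity, by linarith [pi_gt_three]⟩
  have h1 := V_ge hx
  have h2 : omega (2 * b ^ 3) ≤ b ^ 3 := by
    rw [omega_eq hx, mul_div_cancel_left₀ _ (two_ne_zero' ℝ)]
    exact sin_le (by positivity)
  have h3 : (b ^ 3) ^ (-(1 / 3) : ℝ) ≤ omega (2 * b ^ 3) ^ (-(1 / 3) : ℝ) :=
    rpow_le_rpow_of_nonpos (omega_pos hx) h2 (by norm_num)
  have h4 : (b ^ 3) ^ (-(1 / 3) : ℝ) = b⁻¹ := by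
    rw [← rpow_natCast, ← rpow_mul hb0.le]
    norm_num
    exact rpow_neg_one b
  rw [h4] at h3
  calc 1 / 80 = b * (1 / 80 * b⁻¹) := by field_simp
    _ ≤ b * V (2 * b ^ 3) := by
        gcongr
        linarith

theorem tendsto_scaled_lossSymbol :
    Tendsto (fun b : ℝ => lossSymbol (2 * b ^ 3) / b ^ 5) (𝓝[>] 0) (𝓝 rateConst) := by
  have h4 := (tendsto_sin_div (hasDerivAt_id (0 : ℝ)) rfl)
  have hb3 : Tendsto (fun b : ℝ => b ^ 3) (𝓝[>] 0) (𝓝[>] 0) := by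
    refine tendsto_nhdsWithin_iff.2 ⟨?_, ?_⟩
    · have : Tendsto (fun b : ℝ => b ^ 3) (𝓝 0) (𝓝 (0 ^ 3)) := (continuous_pow 3).tendsto 0
      rw [zero_pow three_ne_zero] at this
      exact this.mono_left nhdsWithin_le_nhds
    · filter_upwards [self_mem_nhdsWithin] with b hb
      exact pow_pos (mem_Ioi.1 hb) 3
  have h6 := ((h4.comp hb3).pow 2).mul tendsto_mul_V
  rw [one_pow, one_mul] at h6
  refine h6.congr' ?_
  filter_upwards [self_mem_nhdsWithin] with b hb
  have hb0 : b ≠ 0 := (mem_Ioi.1 hb).ne'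
  simp only [Function.comp_apply, id]
  rw [lossSymbol, omega, mul_div_cancel_left₀ _ (two_ne_zero' ℝ), sq_abs]
  field_simp

theorem integrableOn_inv_one_add_rpow {c : ℝ} (hc : 0 < c) :
    IntegrableOn (fun ξ : ℝ => 1 / (1 + c * ξ ^ (5 / 3 : ℝ))) (Ioi 0) := by
  rw [← Ioc_union_Ioi_eq_Ioi zero_le_one]
  refine IntegrableOn.union ?_ ?_
  · refine Measure.integrableOn_of_bounded (M := 1) (by simp)
      (Measurable.aestronglyMeasurable (by fun_prop)) ?_
    filter_upwards [ae_restrict_mem measurableSet_Ioc] with ξ hξ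
    have := rpow_nonneg hξ.1.le (5 / 3)
    rw [norm_of_nonneg (by positivity)]
    exact div_le_one_of_le₀ (by nlinarith) (by positivity)
  · refine ((integrableOn_Ioi_rpow_of_lt (a := -(5 / 3)) (by norm_num) zero_lt_one).const_mul
      (1 / c)).mono' (Measurable.aestronglyMeasurable (by fun_prop)) ?_
    filter_upwards [ae_restrict_mem measurableSet_Ioi] with ξ hξ
    have h0 : 0 < ξ := zero_lt_one.trans hξ
    have := rpow_pos_of_pos h0 (5 / 3)
    rw [norm_of_nonneg (by positivity), rpow_neg h0.le, ← one_div, one_div_mul_one_div]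
    gcongr
    linarith

/-- The constant in the asymptotics of the resolvent. -/
noncomputable def resolventConst : ℝ := ∫ ξ in Ioi (0 : ℝ), 1 / (1 + rateConst * ξ ^ (5 / 3 : ℝ))

theorem resolventConst_pos : 0 < resolventConst := by
  have h0 := rateConst_pos
  refine (setIntegral_pos_iff_support_of_nonneg_ae ?_ (integrableOn_inv_one_add_rpow h0)).2 ?_
  · filter_upwards [ae_restrict_mem measurableSet_Ioi] with ξ hξ
    have := rpow_nonneg (mem_Ioi.1 hξ).le (5 / 3)
    change 0 ≤ _
    positivity
  · have : Ioi (0 : ℝ) ⊆ Function.support (fun ξ : ℝ => 1 / (1 + rateConst * ξ ^ (5 / 3 : ℝ))) := by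
      intro ξ hξ
      have := rpow_nonneg (mem_Ioi.1 hξ).le (5 / 3)
      rw [Function.mem_support]
      positivity
    rw [inter_eq_right.2 this]
    simp

/-- The symmetry x ↦ 2π - x leaves a single singular endpoint. Two factors of 2, from the symmetry
and from x = 2a, cancel the 1/4 in ω'². -/
theorem lossResolvent_eq {r : ℝ} (hr : 0 < r) :
    lossResolvent r = ∫ a in (0 : ℝ)..(π / 2), cos a ^ 2 / (r + lossSymbol (2 * a)) := by
  have hi : IntervalIntegrable (fun x => omegaDeriv x ^ 2 / (r + lossSymbol x)) volume 0 (2 * π) := by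
    rw [intervalIntegrable_iff_integrableOn_Ioo_of_le two_pi_pos.le]
    have := integrable_lossResolvent hr
    rwa [volI_eq] at this
  have h1 : IntervalIntegrable (fun x => omegaDeriv x ^ 2 / (r + lossSymbol x)) volume 0 π :=
    hi.mono_set (by
      rw [uIcc_of_le pi_pos.le, uIcc_of_le two_pi_pos.le]
      exact Icc_subset_Icc_right (by linarith [pi_pos]))
  have h2 : IntervalIntegrable (fun x => omegaDeriv x ^ 2 / (r + lossSymbol x)) volume π (2 * π) :=
    hi.mono_set (by
      rw [uIcc_of_le (by linarith [pi_pos]), uIcc_of_le two_pi_pos.le]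
      exact Icc_subset_Icc_left pi_pos.le)
  have h3 : ∫ x in π..(2 * π), omegaDeriv x ^ 2 / (r + lossSymbol x)
      = ∫ x in (0 : ℝ)..π, omegaDeriv x ^ 2 / (r + lossSymbol x) := by
    have := intervalIntegral.integral_comp_sub_left
      (fun x => omegaDeriv x ^ 2 / (r + lossSymbol x)) (a := 0) (b := π) (2 * π)
    rw [sub_zero, show 2 * π - π = π by ring] at this
    rw [← this, intervalIntegral.integral_of_le pi_pos.le, intervalIntegral.integral_of_le pi_pos.le]
    refine setIntegral_congr_fun measurableSet_Ioc fun x hx => ?_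
    rw [omegaDeriv_reflect ⟨hx.1, by linarith [hx.2, pi_pos]⟩, lossSymbol_reflect, neg_sq]
  have h4 := intervalIntegral.mul_integral_comp_mul_left (a := 0) (b := π / 2)
      (f := fun x => omegaDeriv x ^ 2 / (r + lossSymbol x)) (2 : ℝ)
  rw [mul_zero, mul_div_cancel₀ _ (two_ne_zero' ℝ)] at h4
  rw [lossResolvent, integral_volI_eq, ← intervalIntegral.integral_add_adjacent_intervals h1 h2, h3,
    ← h4, ← two_mul, ← mul_assoc, ← intervalIntegral.integral_const_mul,
    intervalIntegral.integral_of_le (by positivity), intervalIntegral.integral_of_le (by positivity)]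
  refine setIntegral_congr_fun measurableSet_Ioc fun a ha => ?_
  rw [omegaDeriv_eq ⟨by linarith [ha.1], by linarith [ha.2, pi_pos]⟩,
    mul_div_cancel_left₀ _ (two_ne_zero' ℝ)]
  ring

theorem lossSymbol_two_mul_ge {a : ℝ} (ha : 0 < a) (ha' : a ≤ π / 2) :
    1 / 80 * (1 / 2) ^ (5 / 3 : ℝ) * a ^ (5 / 3 : ℝ) ≤ lossSymbol (2 * a) := by
  have hx : 2 * a ∈ Ioo 0 (2 * π) := ⟨by linarith, by linarith [pi_pos]⟩
  refine le_trans ?_ (lossSymbol_ge hx)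
  rw [mul_assoc, ← mul_rpow (by norm_num) ha.le, omega_eq hx, mul_div_cancel_left₀ _ (two_ne_zero' ℝ)]
  have := mul_le_sin ha.le ha'
  gcongr
  refine le_trans (mul_le_mul_of_nonneg_right ?_ ha.le) this
  rw [div_le_div_iff₀ two_pos pi_pos]
  linarith [pi_le_four]

/-- The scaling r = m⁵, a = m³ξ balances r against ω²V of order a^(5/3). The prefactor m³ / m⁵ is
m^(-2), that is r^(-2/5). -/
theorem tendsto_scaled_lossResolvent :
    Tendsto (fun m : ℝ => m ^ 2 * lossResolvent (m ^ 5)) (𝓝[>] 0) (𝓝 resolventConst) := by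
  set c : ℝ := 1 / 80 * (1 / 2) ^ (5 / 3 : ℝ) with hc
  have hc0 : 0 < c := by positivity
  have key : Tendsto (fun m : ℝ => ∫ ξ in Ioi (0 : ℝ), (Iic (π / 2 / m ^ 3)).indicator
      (fun ξ => cos (m ^ 3 * ξ) ^ 2 / (1 + lossSymbol (2 * (m ^ 3 * ξ)) / m ^ 5)) ξ) (𝓝[>] 0)
      (𝓝 resolventConst) := by
    refine tendsto_integral_filter_of_dominated_convergence
      (fun ξ => 1 / (1 + c * ξ ^ (5 / 3 : ℝ))) (Eventually.of_forall fun m => ?_) ?_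
      (integrableOn_inv_one_add_rpow hc0) ?_
    · refine AEStronglyMeasurable.indicator (Measurable.aestronglyMeasurable ?_) measurableSet_Iic
      have : Measurable fun ξ : ℝ => lossSymbol (2 * (m ^ 3 * ξ)) :=
        measurable_lossSymbol.comp (by fun_prop)
      fun_prop
    · filter_upwards [self_mem_nhdsWithin] with m hm
      have hm0 : 0 < m := hm
      filter_upwards [ae_restrict_mem measurableSet_Ioi] with ξ hξ
      have hξ0 : 0 < ξ := hξ
      have hξr := rpow_pos_of_pos hξ0 (5 / 3)
      by_cases h : ξ ∈ Iic (π / 2 / m ^ 3)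
      · rw [indicator_of_mem h]
        have h1 : m ^ 3 * ξ ≤ π / 2 := by
          rw [mem_Iic, le_div_iff₀ (by positivity)] at h
          linarith
        have h2 := lossSymbol_two_mul_ge (by positivity) h1
        rw [← hc, mul_rpow (by positivity) hξ0.le, ← rpow_natCast m 3, ← rpow_mul hm0.le,
          show ((3 : ℕ) : ℝ) * (5 / 3) = (5 : ℕ) by norm_num, rpow_natCast] at h2
        have h3 : c * ξ ^ (5 / 3 : ℝ) ≤ lossSymbol (2 * (m ^ 3 * ξ)) / m ^ 5 := by
          rw [le_div_iff₀ (by positivity)]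
          rw [rpow_natCast] at h2
          linarith
        have h4 := lossSymbol_nonneg (2 * (m ^ 3 * ξ))
        rw [norm_of_nonneg (by positivity)]
        gcongr
        exact cos_sq_le_one _
      · rw [indicator_of_notMem h, norm_zero]; positivity
    · filter_upwards [ae_restrict_mem measurableSet_Ioi] with ξ hξ
      have hξ0 : 0 < ξ := hξ
      -- With ξ = q³ the argument m³ξ is (mq)³, so the limit of the loss symbol along cubes applies
      -- at b = mq.
      set q : ℝ := ξ ^ (1 / 3 : ℝ) with hq
      have hq0 : 0 < q := rpow_pos_of_pos hξ0 _
      have hq3 : q ^ 3 = ξ := by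
        rw [hq, ← rpow_natCast, ← rpow_mul hξ0.le]; norm_num
      have hq5 : ξ ^ (5 / 3 : ℝ) = q ^ 5 := by
        rw [hq, ← rpow_natCast, ← rpow_mul hξ0.le]; norm_num
      have hmq : Tendsto (fun m : ℝ => m * q) (𝓝[>] 0) (𝓝[>] 0) := by
        refine tendsto_nhdsWithin_iff.2 ⟨?_, ?_⟩
        · have : Tendsto (fun m : ℝ => m * q) (𝓝 0) (𝓝 (0 * q)) :=
            (continuous_mul_const q).tendsto 0
          rw [zero_mul] at this
          exact this.mono_left nhdsWithin_le_nhds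
        · filter_upwards [self_mem_nhdsWithin] with m hm
          exact mul_pos (mem_Ioi.1 hm) hq0
      have h1 := ((tendsto_scaled_lossSymbol.comp hmq).mul_const (q ^ 5)).const_add 1
      have h2 : Tendsto (fun m : ℝ => cos (m ^ 3 * ξ) ^ 2) (𝓝[>] 0) (𝓝 1) := by
        have h3 : Continuous fun m : ℝ => cos (m ^ 3 * ξ) ^ 2 := by fun_prop
        have h4 := h3.tendsto 0
        simp only [ne_eq, OfNat.ofNat_ne_zero, not_false_eq_true, zero_pow, zero_mul, cos_zero,
          one_pow] at h4
        exact h4.mono_left nhdsWithin_le_nhds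
      have h0 := rateConst_pos
      have h5 := h2.div h1 (by positivity)
      rw [hq5]
      refine h5.congr' ?_
      filter_upwards [Ioo_mem_nhdsGT (by positivity : 0 < min 1 (π / 2 / ξ)), self_mem_nhdsWithin]
        with m hm hm0
      have hm0 : 0 < m := hm0
      rw [indicator_of_mem]
      · simp only [Pi.div_apply, Function.comp_apply]
        congr 2
        rw [mul_pow m q 3, hq3, mul_pow]
        field_simp
      · rw [mem_Iic, le_div_iff₀ (by positivity)]
        have h6 : m ^ 3 ≤ m := by
          have h7 : m ≤ 1 := (hm.2.trans_le (min_le_left _ _)).le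
          nlinarith [mul_nonneg hm0.le (sub_nonneg.2 h7), pow_pos hm0 2]
        have h8 := hm.2.trans_le (min_le_right _ _)
        rw [lt_div_iff₀ hξ0] at h8
        nlinarith
  refine key.congr' ?_
  filter_upwards [self_mem_nhdsWithin] with m hm
  have hm0 : 0 < m := hm
  have h1 := mul_integral_Ioi_indicator_scale (pow_pos hm0 3) (by positivity : 0 ≤ π / 2)
    (fun a => cos a ^ 2 / (m ^ 5 + lossSymbol (2 * a)))
  rw [lossResolvent_eq (by positivity), ← h1, ← mul_assoc, ← pow_add, ← integral_const_mul]
  refine integral_congr_ae (Eventually.of_forall fun ξ => ?_)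
  simp only
  rw [← indicator_const_mul]
  refine congrFun (congrArg _ (funext fun t => ?_)) ξ
  have := lossSymbol_nonneg (2 * (m ^ 3 * t))
  field_simp
  ring_nf

theorem tendsto_lossResolvent :
    Tendsto (fun r : ℝ => r ^ (2 / 5 : ℝ) * lossResolvent r) (𝓝[>] 0) (𝓝 resolventConst) := by
  have h1 : Tendsto (fun r : ℝ => r ^ (1 / 5 : ℝ)) (𝓝[>] 0) (𝓝[>] 0) := by
    refine tendsto_nhdsWithin_iff.2 ⟨?_, ?_⟩
    · have : Tendsto (fun r : ℝ => r ^ (1 / 5 : ℝ)) (𝓝 0) (𝓝 (0 ^ (1 / 5 : ℝ))) :=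
        (continuous_rpow_const (by norm_num)).tendsto 0
      rw [zero_rpow (by norm_num)] at this
      exact this.mono_left nhdsWithin_le_nhds
    · filter_upwards [self_mem_nhdsWithin] with r hr
      exact rpow_pos_of_pos (mem_Ioi.1 hr) _
  refine (tendsto_scaled_lossResolvent.comp h1).congr' ?_
  filter_upwards [self_mem_nhdsWithin] with r hr
  have hr0 : 0 < r := hr
  simp only [Function.comp_apply]
  rw [← rpow_natCast, ← rpow_mul hr0.le, ← rpow_natCast, ← rpow_mul hr0.le]
  norm_num

/-- Small-parameter asymptotics of the resolvent of `L̃`. -/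
theorem tendsto_resolventR :
    Tendsto (fun r : ℝ => ((r ^ (2 / 5 : ℝ) : ℝ) : ℂ) * resolventR Ltilde r) (𝓝[>] 0)
      (𝓝 (resolventConst : ℂ)) := by
  obtain ⟨C, hC0, hC⟩ := exists_norm_resolventR_sub_le
  have h1 : Tendsto (fun r : ℝ => ((r ^ (2 / 5 : ℝ) * lossResolvent r : ℝ) : ℂ)) (𝓝[>] 0)
      (𝓝 (resolventConst : ℂ)) :=
    (Complex.continuous_ofReal.tendsto _).comp tendsto_lossResolvent
  have hp : ∀ κ : ℝ, 0 < κ → Tendsto (fun r : ℝ => r ^ κ) (𝓝[>] 0) (𝓝 0) := fun κ hκ => by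
    have : Tendsto (fun r : ℝ => r ^ κ) (𝓝 0) (𝓝 (0 ^ κ)) :=
      (continuous_rpow_const hκ.le).tendsto 0
    rw [zero_rpow hκ.ne'] at this
    exact this.mono_left nhdsWithin_le_nhds
  -- The exponents left after multiplying by r^(2/5) are 2/5 - 4/25 - 1/5 = 1/25 and 2/5 - 8/25 =
  -- 2/25, both positive.
  have h2 : Tendsto (fun r : ℝ => C * (r ^ (1 / 25 : ℝ) * √(r ^ (2 / 5 : ℝ) * lossResolvent r))
      + C * r ^ (2 / 25 : ℝ)) (𝓝[>] 0) (𝓝 0) := by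
    have h3 := (((hp (1 / 25) (by norm_num)).mul
      ((continuous_sqrt.tendsto _).comp tendsto_lossResolvent)).const_mul C).add
      ((hp (2 / 25) (by norm_num)).const_mul C)
    simpa using h3
  have h4 : Tendsto (fun r : ℝ => ((r ^ (2 / 5 : ℝ) : ℝ) : ℂ) * resolventR Ltilde r
      - ((r ^ (2 / 5 : ℝ) * lossResolvent r : ℝ) : ℂ)) (𝓝[>] 0) (𝓝 0) := by
    rw [tendsto_zero_iff_norm_tendsto_zero]
    refine tendsto_of_tendsto_of_tendsto_of_le_of_le' tendsto_const_nhds h2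
      (Eventually.of_forall fun r => norm_nonneg _) ?_
    filter_upwards [self_mem_nhdsWithin] with r hr
    have hr0 : 0 < r := hr
    have hL := lossResolvent_nonneg hr0
    rw [Complex.ofReal_mul, ← mul_sub, norm_mul, Complex.norm_real,
      norm_of_nonneg (by positivity)]
    calc r ^ (2 / 5 : ℝ) * ‖resolventR Ltilde r - (lossResolvent r : ℂ)‖
        ≤ r ^ (2 / 5 : ℝ) * (C * (r ^ (-(4 / 25) : ℝ) * √(lossResolvent r))
          + C * (r ^ (-(4 / 25) : ℝ)) ^ 2) := by gcongr; exact hC r hr0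
      _ = C * (r ^ (2 / 5 : ℝ) * r ^ (-(4 / 25) : ℝ) * √(lossResolvent r))
          + C * (r ^ (2 / 5 : ℝ) * (r ^ (-(4 / 25) : ℝ) * r ^ (-(4 / 25) : ℝ))) := by ring
      _ = _ := by
          rw [sqrt_mul (by positivity), sqrt_eq_rpow (r ^ (2 / 5 : ℝ)), ← rpow_mul hr0.le,
            ← mul_assoc (r ^ (1 / 25 : ℝ)), ← rpow_add hr0, ← rpow_add hr0, ← rpow_add hr0,
            ← rpow_add hr0]
          norm_num
  simpa using h4.add h1

end FPU

/-! ### A Tauberian theorem and integration of power asymptotics -/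

namespace FPU

open Real Set

section tauberian

theorem exp_neg_mem {s : ℝ} (hs : 0 < s) : exp (-s) ∈ Icc (0 : ℝ) 1 :=
  ⟨(exp_pos _).le, exp_le_one_iff.2 (by linarith)⟩

theorem integrableOn_comp_exp_neg_mul {q w : ℝ → ℝ} (hq : Continuous q)
    (hw : IntegrableOn w (Ioi 0)) : IntegrableOn (fun s => q (exp (-s)) * w s) (Ioi 0) := by
  obtain ⟨M, hM⟩ := isCompact_Icc.exists_bound_of_continuousOn (hq.continuousOn (s := Icc 0 1))
  refine Integrable.bdd_mul (c := M) hw (Continuous.aestronglyMeasurable (by fun_prop)) ?_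
  filter_upwards [ae_restrict_mem measurableSet_Ioi] with s hs
  exact hM _ (exp_neg_mem hs)

theorem integral_polynomial_exp_neg_mul {w : ℝ → ℝ} (hw : IntegrableOn w (Ioi 0))
    (p : Polynomial ℝ) :
    ∫ s in Ioi (0 : ℝ), p.eval (exp (-s)) * w s
      = ∑ i ∈ Finset.range (p.natDegree + 1),
        p.coeff i * ∫ s in Ioi (0 : ℝ), exp (-s) ^ i * w s := by
  simp_rw [Polynomial.eval_eq_sum_range, Finset.sum_mul, mul_assoc]
  rw [integral_finsetSum]
  · simp_rw [integral_const_mul]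
  · intro i _
    exact (integrableOn_comp_exp_neg_mul (q := fun u => u ^ i) (by fun_prop) hw).const_mul _

theorem abs_integral_comp_exp_neg_sub_le {q p w : ℝ → ℝ} (hq : Continuous q) (hp : Continuous p)
    (hw : IntegrableOn w (Ioi 0)) (hw0 : ∀ s, 0 < s → 0 ≤ w s) {ε : ℝ}
    (h : ∀ u ∈ Icc (0 : ℝ) 1, |p u - q u| < ε) :
    |(∫ s in Ioi (0 : ℝ), p (exp (-s)) * w s) - ∫ s in Ioi (0 : ℝ), q (exp (-s)) * w s|
      ≤ ε * ∫ s in Ioi (0 : ℝ), w s := by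
  rw [← integral_sub (integrableOn_comp_exp_neg_mul hp hw) (integrableOn_comp_exp_neg_mul hq hw),
    ← integral_const_mul, ← norm_eq_abs]
  refine norm_integral_le_of_norm_le (hw.const_mul ε) ?_
  filter_upwards [ae_restrict_mem measurableSet_Ioi] with s hs
  rw [← sub_mul, norm_mul, norm_of_nonneg (hw0 s hs)]
  exact mul_le_mul_of_nonneg_right (h _ (exp_neg_mem hs)).le (hw0 s hs)

/-- Convergence of the Laplace moments of positive densities implies convergence of the integrals
against continuous functions of `exp (-s)`. -/
theorem tendsto_integral_comp_exp_neg {ι : Type*} {l : Filter ι} {w : ι → ℝ → ℝ} {w₀ : ℝ → ℝ}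
    (hw : ∀ᶠ r in l, IntegrableOn (w r) (Ioi 0) ∧ ∀ s, 0 < s → 0 ≤ w r s)
    (hi : IntegrableOn w₀ (Ioi 0)) (h0 : ∀ s, 0 < s → 0 ≤ w₀ s)
    (hm : ∀ n : ℕ, Tendsto (fun r => ∫ s in Ioi (0 : ℝ), exp (-s) ^ n * w r s) l
      (𝓝 (∫ s in Ioi (0 : ℝ), exp (-s) ^ n * w₀ s))) {q : ℝ → ℝ} (hq : Continuous q) :
    Tendsto (fun r => ∫ s in Ioi (0 : ℝ), q (exp (-s)) * w r s) l
      (𝓝 (∫ s in Ioi (0 : ℝ), q (exp (-s)) * w₀ s)) := by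
  set m := ∫ s in Ioi (0 : ℝ), w₀ s with hmdef
  have hm0 : 0 ≤ m := setIntegral_nonneg measurableSet_Ioi fun s hs => h0 s hs
  have hm1 := hm 0
  simp only [pow_zero, one_mul] at hm1
  rw [Metric.tendsto_nhds]
  intro η hη
  obtain ⟨p, hp⟩ := exists_polynomial_near_of_continuousOn 0 1 q hq.continuousOn
    (η / (4 * (m + 1))) (by positivity)
  have hpt : Tendsto (fun r => ∫ s in Ioi (0 : ℝ), p.eval (exp (-s)) * w r s) l
      (𝓝 (∫ s in Ioi (0 : ℝ), p.eval (exp (-s)) * w₀ s)) := by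
    rw [integral_polynomial_exp_neg_mul hi]
    refine (tendsto_finsetSum _ fun i _ => (hm i).const_mul (p.coeff i)).congr' ?_
    filter_upwards [hw] with r hr
    rw [integral_polynomial_exp_neg_mul hr.1]
  filter_upwards [hw, (Metric.tendsto_nhds.1 hpt) (η / 2) (by positivity),
    hm1.eventually (gt_mem_nhds (lt_add_one m))] with r hr h1 h2
  rw [dist_eq] at h1 ⊢
  have e1 := abs_integral_comp_exp_neg_sub_le hq p.continuous hr.1 hr.2 hp
  have e2 := abs_integral_comp_exp_neg_sub_le hq p.continuous hi h0 hp
  have e3 : η / (4 * (m + 1)) * (∫ s in Ioi (0 : ℝ), w r s) ≤ η / 4 := by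
    calc _ ≤ η / (4 * (m + 1)) * (m + 1) := by gcongr
      _ = η / 4 := by field_simp
  have e4 : η / (4 * (m + 1)) * (∫ s in Ioi (0 : ℝ), w₀ s) < η / 4 := by
    calc _ < η / (4 * (m + 1)) * (m + 1) := by gcongr; linarith
      _ = η / 4 := by field_simp
  rw [abs_le] at e1 e2
  rw [abs_lt] at h1 ⊢
  constructor <;> linarith [e1.1, e1.2, e2.1, e2.2, h1.1, h1.2]

/-- The tent function on `[α, β]`. -/
noncomputable def tent (α β u : ℝ) : ℝ := max 0 (min (u - α) (β - u))

@[fun_prop]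
theorem continuous_tent (α β : ℝ) : Continuous (tent α β) := by unfold tent; fun_prop

theorem tent_nonneg (α β u : ℝ) : 0 ≤ tent α β u := le_max_left _ _

theorem tent_pos_iff {α β u : ℝ} : 0 < tent α β u ↔ α < u ∧ u < β := by
  unfold tent
  rw [lt_max_iff, lt_min_iff, sub_pos, sub_pos]
  simp

theorem tent_exp_eq_zero {a b s : ℝ} (h : s ∉ Ioo a b) : tent (exp (-b)) (exp (-a)) (exp (-s)) = 0 := by
  by_contra hne
  have h1 := tent_pos_iff.1 (lt_of_le_of_ne (tent_nonneg _ _ _) (Ne.symm hne))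
  rw [exp_lt_exp, exp_lt_exp] at h1
  exact h ⟨by linarith, by linarith⟩

theorem integral_tent_pos {a b : ℝ} (ha : 0 ≤ a) (hab : a < b) :
    0 < ∫ s in Ioi (0 : ℝ), tent (exp (-b)) (exp (-a)) (exp (-s)) * exp (-s) := by
  have hi := integrableOn_comp_exp_neg_mul (continuous_tent (exp (-b)) (exp (-a)))
    (w := fun s => exp (-s)) (by simpa using exp_neg_integrableOn_Ioi 0 one_pos)
  refine (setIntegral_pos_iff_support_of_nonneg_ae (Eventually.of_forall fun s =>
    mul_nonneg (tent_nonneg _ _ _) (exp_pos _).le) hi).2 ?_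
  have hsub : Ioo a b ⊆ Function.support
      (fun s => tent (exp (-b)) (exp (-a)) (exp (-s)) * exp (-s)) ∩ Ioi 0 := by
    intro s hs
    refine ⟨?_, ha.trans_lt hs.1⟩
    rw [Function.mem_support]
    have h1 : 0 < tent (exp (-b)) (exp (-a)) (exp (-s)) := tent_pos_iff.2
      ⟨exp_lt_exp.2 (by linarith [hs.2]), exp_lt_exp.2 (by linarith [hs.1])⟩
    positivity
  refine lt_of_lt_of_le ?_ (measure_mono hsub)
  rw [Real.volume_Ioo]
  exact ENNReal.ofReal_pos.2 (by linarith)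

variable {c : ℝ → ℝ} {ρ c₀ : ℝ}

/-- The weights in the rescaled Laplace transform. -/
theorem integrableOn_scaled (hc : Continuous c) (hanti : AntitoneOn c (Ici 0))
    (h0 : ∀ t, 0 ≤ t → 0 ≤ c t) {r : ℝ} (hr : 0 < r) :
    IntegrableOn (fun s => exp (-s) * (r ^ (ρ - 1) * c (s / r))) (Ioi 0) := by
  have hi : IntegrableOn (fun s : ℝ => exp (-s)) (Ioi 0) := by
    simpa using exp_neg_integrableOn_Ioi 0 one_pos
  refine (hi.mul_const (r ^ (ρ - 1) * c 0)).mono' (Continuous.aestronglyMeasurable (by fun_prop)) ?_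
  filter_upwards [ae_restrict_mem measurableSet_Ioi] with s hs
  have h1 : 0 ≤ s / r := div_nonneg (mem_Ioi.1 hs).le hr.le
  have h2 := h0 _ h1
  rw [norm_of_nonneg (by positivity)]
  gcongr
  exact hanti (mem_Ici.2 le_rfl) h1 h1

/-- The n-th moment is the rescaled Laplace transform at (n + 1)r, and its limit is matched by the
Gamma integral at the same point. -/
theorem tendsto_scaled_moment (hρ0 : 0 < ρ)
    (hlap : Tendsto (fun r => r ^ ρ * ∫ t in Ioi (0 : ℝ), exp (-(r * t)) * c t) (𝓝[>] 0) (𝓝 c₀))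
    (n : ℕ) :
    Tendsto (fun r => ∫ s in Ioi (0 : ℝ), exp (-s) ^ n * (exp (-s) * (r ^ (ρ - 1) * c (s / r))))
      (𝓝[>] 0) (𝓝 (∫ s in Ioi (0 : ℝ), exp (-s) ^ n *
        (exp (-s) * (c₀ / Gamma ρ * s ^ (ρ - 1))))) := by
  have hn : (0 : ℝ) < n + 1 := by positivity
  have hexp : ∀ s : ℝ, exp (-s) ^ n * exp (-s) = exp (-((n + 1) * s)) := fun s => by
    rw [← exp_nat_mul, ← exp_add]; congr 1; ring
  have e0 : ∫ s in Ioi (0 : ℝ), exp (-s) ^ n * (exp (-s) * (c₀ / Gamma ρ * s ^ (ρ - 1)))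
      = (n + 1) ^ (-ρ) * c₀ := by
    have h1 := integral_rpow_mul_exp_neg_mul_Ioi hρ0 hn
    have h2 : ∀ s : ℝ, exp (-s) ^ n * (exp (-s) * (c₀ / Gamma ρ * s ^ (ρ - 1)))
        = c₀ / Gamma ρ * (s ^ (ρ - 1) * exp (-((n + 1) * s))) := fun s => by
      rw [← hexp]; ring
    simp_rw [h2]
    have hG := (Gamma_pos_of_pos hρ0).ne'
    rw [integral_const_mul, h1, one_div, inv_rpow hn.le, rpow_neg hn.le]
    field_simp
  rw [e0]
  have hscale : Tendsto (fun r : ℝ => (n + 1) * r) (𝓝[>] 0) (𝓝[>] 0) := by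
    refine tendsto_nhdsWithin_iff.2 ⟨?_, ?_⟩
    · have : Tendsto (fun r : ℝ => (n + 1) * r) (𝓝 0) (𝓝 ((n + 1) * 0)) :=
        (continuous_const_mul _).tendsto 0
      rw [mul_zero] at this
      exact this.mono_left nhdsWithin_le_nhds
    · filter_upwards [self_mem_nhdsWithin] with r hr
      exact mul_pos hn (mem_Ioi.1 hr)
  refine ((hlap.comp hscale).const_mul ((n + 1 : ℝ) ^ (-ρ))).congr' ?_
  filter_upwards [self_mem_nhdsWithin] with r hr
  have hr0 : 0 < r := hr
  have h1 := integral_comp_mul_left_Ioi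
    (fun s => exp (-s) ^ n * (exp (-s) * (r ^ (ρ - 1) * c (s / r)))) 0 hr0
  rw [mul_zero, smul_eq_mul] at h1
  have h2 : ∀ t : ℝ, exp (-(r * t)) ^ n * (exp (-(r * t)) * (r ^ (ρ - 1) * c (r * t / r)))
      = r ^ (ρ - 1) * (exp (-((n + 1) * r * t)) * c t) := fun t => by
    rw [mul_div_cancel_left₀ _ hr0.ne', ← mul_assoc, hexp, mul_assoc (n + 1 : ℝ)]; ring
  simp_rw [h2] at h1
  rw [integral_const_mul, eq_inv_mul_iff_mul_eq₀ hr0.ne'] at h1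
  rw [← h1]
  simp only [Function.comp_apply]
  rw [mul_rpow hn.le hr0.le, rpow_neg hn.le, rpow_sub hr0, rpow_one]
  have := (rpow_pos_of_pos hn ρ).ne'
  field_simp

theorem tendsto_integral_tent (hc : Continuous c) (hanti : AntitoneOn c (Ici 0))
    (h0 : ∀ t, 0 ≤ t → 0 ≤ c t) (hρ0 : 0 < ρ) (hc₀ : 0 < c₀)
    (hlap : Tendsto (fun r => r ^ ρ * ∫ t in Ioi (0 : ℝ), exp (-(r * t)) * c t) (𝓝[>] 0) (𝓝 c₀))
    (α β : ℝ) :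
    Tendsto (fun r => ∫ s in Ioi (0 : ℝ), tent α β (exp (-s)) *
        (exp (-s) * (r ^ (ρ - 1) * c (s / r)))) (𝓝[>] 0)
      (𝓝 (∫ s in Ioi (0 : ℝ), tent α β (exp (-s)) *
        (exp (-s) * (c₀ / Gamma ρ * s ^ (ρ - 1))))) := by
  have hG := Gamma_pos_of_pos hρ0
  refine tendsto_integral_comp_exp_neg ?_ ?_ ?_ (tendsto_scaled_moment hρ0 hlap)
    (continuous_tent α β)
  · filter_upwards [self_mem_nhdsWithin] with r hr
    have hr0 : 0 < r := hr
    refine ⟨integrableOn_scaled hc hanti h0 hr0, fun s hs => ?_⟩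
    have := h0 _ (div_nonneg hs.le hr0.le)
    positivity
  · refine ((GammaIntegral_convergent hρ0).const_mul (c₀ / Gamma ρ)).congr
      (Eventually.of_forall fun s => ?_)
    simp only; ring
  · intro s hs; positivity

/-- **Karamata's Tauberian theorem** for monotone densities. -/
theorem tendsto_of_tendsto_laplace (hc : Continuous c) (hanti : AntitoneOn c (Ici 0))
    (h0 : ∀ t, 0 ≤ t → 0 ≤ c t) (hρ0 : 0 < ρ) (hρ1 : ρ < 1) (hc₀ : 0 < c₀)
    (hlap : Tendsto (fun r => r ^ ρ * ∫ t in Ioi (0 : ℝ), exp (-(r * t)) * c t) (𝓝[>] 0) (𝓝 c₀)) :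
    Tendsto (fun t => t ^ (1 - ρ) * c t) atTop (𝓝 (c₀ / Gamma ρ)) := by
  have hG := Gamma_pos_of_pos hρ0
  set K := c₀ / Gamma ρ with hK
  have hK0 : 0 < K := by positivity
  have hcont : ContinuousAt (fun b : ℝ => K * b ^ (ρ - 1)) 1 :=
    continuousAt_const.mul (continuousAt_rpow_const _ _ (Or.inl one_ne_zero))
  have hval : K * (1 : ℝ) ^ (ρ - 1) = K := by rw [one_rpow, mul_one]
  have hw0 : IntegrableOn (fun s : ℝ => exp (-s) * (K * s ^ (ρ - 1))) (Ioi 0) := by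
    refine ((GammaIntegral_convergent hρ0).const_mul K).congr
      (Eventually.of_forall fun s => ?_)
    simp only; ring
  have hexp : IntegrableOn (fun s : ℝ => exp (-s)) (Ioi 0) := by
    simpa using exp_neg_integrableOn_Ioi 0 one_pos
  have main : Tendsto (fun r : ℝ => r ^ (ρ - 1) * c (1 / r)) (𝓝[>] 0) (𝓝 K) := by
    rw [tendsto_order]
    constructor
    · intro l hl
      -- A tent supported on s in (1, b) is used: there c(s / r) ≤ c(1 / r), so the tent average
      -- bounds c(1 / r) from below. Its limit is at least K b^(ρ - 1) times the tent mass, close to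
      -- K for b near 1.
      have h1 : ∀ᶠ b in 𝓝[>] (1 : ℝ), l < K * b ^ (ρ - 1) :=
        (hcont.mono_left nhdsWithin_le_nhds).eventually (lt_mem_nhds (hl.trans_eq hval.symm))
      obtain ⟨b, hb1, hb⟩ := (h1.and self_mem_nhdsWithin).exists
      have hb : 1 < b := hb
      set α := exp (-b)
      set β := exp (-1)
      set M := ∫ s in Ioi (0 : ℝ), tent α β (exp (-s)) * exp (-s) with hM
      have hM0 : 0 < M := integral_tent_pos zero_le_one hb
      have hiM := integrableOn_comp_exp_neg_mul (continuous_tent α β) hexp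
      have h2 : K * b ^ (ρ - 1) * M
          ≤ ∫ s in Ioi (0 : ℝ), tent α β (exp (-s)) * (exp (-s) * (K * s ^ (ρ - 1))) := by
        rw [hM, ← integral_const_mul]
        refine setIntegral_mono_on (hiM.const_mul _)
          (integrableOn_comp_exp_neg_mul (continuous_tent α β) hw0) measurableSet_Ioi
          fun s hs => ?_
        by_cases hsb : s ∈ Ioo 1 b
        · have h3 : b ^ (ρ - 1) ≤ s ^ (ρ - 1) :=
            rpow_le_rpow_of_nonpos hs hsb.2.le (by linarith)
          have h4 := tent_nonneg α β (exp (-s))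
          calc K * b ^ (ρ - 1) * (tent α β (exp (-s)) * exp (-s))
              = tent α β (exp (-s)) * (exp (-s) * (K * b ^ (ρ - 1))) := by ring
            _ ≤ _ := by gcongr
        · rw [tent_exp_eq_zero hsb]; simp
      have h3 : l * M < ∫ s in Ioi (0 : ℝ), tent α β (exp (-s)) * (exp (-s) * (K * s ^ (ρ - 1))) :=
        (mul_lt_mul_of_pos_right hb1 hM0).trans_le h2
      filter_upwards [(tendsto_integral_tent hc hanti h0 hρ0 hc₀ hlap α β).eventually
        (lt_mem_nhds h3), self_mem_nhdsWithin] with r hr1 hr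
      have hr0 : 0 < r := hr
      refine lt_of_mul_lt_mul_right (hr1.trans_le ?_) hM0.le
      rw [hM, ← integral_const_mul]
      refine setIntegral_mono_on (integrableOn_comp_exp_neg_mul (continuous_tent α β)
        (integrableOn_scaled hc hanti h0 hr0)) (hiM.const_mul _) measurableSet_Ioi fun s hs => ?_
      by_cases hsb : s ∈ Ioo 1 b
      · have h4 := tent_nonneg α β (exp (-s))
        have h5 : c (s / r) ≤ c (1 / r) :=
          hanti (mem_Ici.2 (by positivity)) (mem_Ici.2 (div_nonneg (mem_Ioi.1 hs).le hr0.le))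
            (by gcongr; exact hsb.1.le)
        calc _ ≤ tent α β (exp (-s)) * (exp (-s) * (r ^ (ρ - 1) * c (1 / r))) := by gcongr
          _ = _ := by ring
      · rw [tent_exp_eq_zero hsb]; simp
    · intro l hl
      -- The upper bound is the mirror argument, with a tent supported on (a, 1), where c(s / r) ≥
      -- c(1 / r).
      have h1 : ∀ᶠ a in 𝓝[<] (1 : ℝ), K * a ^ (ρ - 1) < l :=
        (hcont.mono_left nhdsWithin_le_nhds).eventually (gt_mem_nhds (hval.trans_lt hl))
      obtain ⟨a, ha1, ha⟩ := (h1.and (Ioo_mem_nhdsLT (zero_lt_one' ℝ))).exists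
      set α := exp (-1)
      set β := exp (-a)
      set M := ∫ s in Ioi (0 : ℝ), tent α β (exp (-s)) * exp (-s) with hM
      have hM0 : 0 < M := integral_tent_pos ha.1.le ha.2
      have hiM := integrableOn_comp_exp_neg_mul (continuous_tent α β) hexp
      have h2 : ∫ s in Ioi (0 : ℝ), tent α β (exp (-s)) * (exp (-s) * (K * s ^ (ρ - 1)))
          ≤ K * a ^ (ρ - 1) * M := by
        rw [hM, ← integral_const_mul]
        refine setIntegral_mono_on
          (integrableOn_comp_exp_neg_mul (continuous_tent α β) hw0) (hiM.const_mul _)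
          measurableSet_Ioi fun s hs => ?_
        by_cases hsb : s ∈ Ioo a 1
        · have h3 : s ^ (ρ - 1) ≤ a ^ (ρ - 1) :=
            rpow_le_rpow_of_nonpos ha.1 hsb.1.le (by linarith)
          have h4 := tent_nonneg α β (exp (-s))
          calc _ ≤ tent α β (exp (-s)) * (exp (-s) * (K * a ^ (ρ - 1))) := by gcongr
            _ = _ := by ring
        · rw [tent_exp_eq_zero hsb]; simp
      have h3 : ∫ s in Ioi (0 : ℝ), tent α β (exp (-s)) * (exp (-s) * (K * s ^ (ρ - 1))) < l * M :=
        h2.trans_lt (mul_lt_mul_of_pos_right ha1 hM0)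
      filter_upwards [(tendsto_integral_tent hc hanti h0 hρ0 hc₀ hlap α β).eventually
        (gt_mem_nhds h3), self_mem_nhdsWithin] with r hr1 hr
      have hr0 : 0 < r := hr
      refine lt_of_mul_lt_mul_right (lt_of_le_of_lt ?_ hr1) hM0.le
      rw [hM, ← integral_const_mul]
      refine setIntegral_mono_on (hiM.const_mul _) (integrableOn_comp_exp_neg_mul
        (continuous_tent α β) (integrableOn_scaled hc hanti h0 hr0)) measurableSet_Ioi
        fun s hs => ?_
      by_cases hsb : s ∈ Ioo a 1
      · have h4 := tent_nonneg α β (exp (-s))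
        have h5 : c (1 / r) ≤ c (s / r) :=
          hanti (mem_Ici.2 (div_nonneg (mem_Ioi.1 hs).le hr0.le)) (mem_Ici.2 (by positivity))
            (by gcongr; exact hsb.2.le)
        calc _ = tent α β (exp (-s)) * (exp (-s) * (r ^ (ρ - 1) * c (1 / r))) := by ring
          _ ≤ _ := by gcongr
      · rw [tent_exp_eq_zero hsb]; simp
  refine (main.comp tendsto_inv_atTop_nhdsGT_zero).congr' ?_
  filter_upwards [eventually_gt_atTop 0] with t ht
  simp only [Function.comp_apply]
  rw [one_div, inv_inv, inv_rpow ht.le, ← rpow_neg ht.le, neg_sub]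

/-- Integration of power asymptotics. -/
theorem tendsto_integral_of_tendsto {f : ℝ → ℝ} (hf : Continuous f) {κ K M : ℝ} (hκ : 0 < κ)
    (hM : ∀ t, 0 < t → |f t| ≤ M * t ^ (κ - 1))
    (h : Tendsto (fun t => t ^ (1 - κ) * f t) atTop (𝓝 K)) :
    Tendsto (fun t => t ^ (-κ) * ∫ s in (0 : ℝ)..t, f s) atTop (𝓝 (K / κ)) := by
  have hint : ∫ u in (0 : ℝ)..1, K * u ^ (κ - 1) = K / κ := by
    rw [intervalIntegral.integral_const_mul, integral_rpow (Or.inl (by linarith))]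
    simp [zero_rpow hκ.ne']
    ring
  rw [← hint]
  -- After s = tu the integrand converges pointwise and is dominated by M u^(κ - 1), integrable
  -- because κ > 0. The global power bound is needed for this.
  have key : Tendsto (fun t : ℝ => ∫ u in (0 : ℝ)..1, t ^ (1 - κ) * f (t * u)) atTop
      (𝓝 (∫ u in (0 : ℝ)..1, K * u ^ (κ - 1))) := by
    refine intervalIntegral.tendsto_integral_filter_of_dominated_convergence
      (fun u => M * u ^ (κ - 1)) (Eventually.of_forall fun t =>
        Continuous.aestronglyMeasurable (by fun_prop)) ?_
      ((intervalIntegral.intervalIntegrable_rpow' (by linarith)).const_mul M) ?_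
    · filter_upwards [eventually_gt_atTop 0] with t ht
      refine Eventually.of_forall fun u hu => ?_
      rw [uIoc_of_le zero_le_one] at hu
      rw [norm_mul, norm_of_nonneg (by positivity), norm_eq_abs]
      calc t ^ (1 - κ) * |f (t * u)| ≤ t ^ (1 - κ) * (M * (t * u) ^ (κ - 1)) := by
            gcongr; exact hM _ (mul_pos ht hu.1)
        _ = t ^ (1 - κ) * t ^ (κ - 1) * (M * u ^ (κ - 1)) := by
            rw [mul_rpow ht.le hu.1.le]; ring
        _ = M * u ^ (κ - 1) := by rw [← rpow_add ht]; simp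
    · refine Eventually.of_forall fun u hu => ?_
      rw [uIoc_of_le zero_le_one] at hu
      have h1 := (h.comp (tendsto_id.atTop_mul_const hu.1)).mul_const (u ^ (κ - 1))
      refine h1.congr' ?_
      filter_upwards [eventually_gt_atTop 0] with t ht
      simp only [Function.comp_apply, id]
      rw [mul_rpow ht.le hu.1.le]
      have h2 : u ^ (1 - κ) * u ^ (κ - 1) = 1 := by rw [← rpow_add hu.1]; simp
      linear_combination t ^ (1 - κ) * f (t * u) * h2
  refine key.congr' ?_
  filter_upwards [eventually_gt_atTop 0] with t ht
  have h1 := intervalIntegral.mul_integral_comp_mul_left (a := 0) (b := 1) (f := f) t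
  rw [mul_zero, mul_one] at h1
  rw [intervalIntegral.integral_const_mul, ← h1, ← mul_assoc, ← rpow_add_one ht.ne']
  congr 2; ring

theorem abs_integral_le_of_abs_le {f : ℝ → ℝ} {κ M : ℝ} (hκ : 0 < κ)
    (hM : ∀ t, 0 < t → |f t| ≤ M * t ^ (κ - 1)) {t : ℝ} (ht : 0 < t) :
    |∫ s in (0 : ℝ)..t, f s| ≤ M / κ * t ^ κ := by
  have h1 := intervalIntegral.norm_integral_le_of_norm_le (μ := volume) (f := f)
    (g := fun s => M * s ^ (κ - 1)) ht.le
    (Eventually.of_forall fun s hs => hM s hs.1)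
    ((intervalIntegral.intervalIntegrable_rpow' (by linarith)).const_mul M)
  rw [intervalIntegral.integral_const_mul, integral_rpow (Or.inl (by linarith))] at h1
  refine h1.trans (le_of_eq ?_)
  simp [zero_rpow hκ.ne']
  ring

/-- A monotone function with a power asymptotics is bounded by that power. -/
theorem exists_le_rpow_of_tendsto (hanti : AntitoneOn c (Ici 0)) (h0 : ∀ t, 0 ≤ t → 0 ≤ c t)
    {κ K : ℝ} (hκ : κ ≤ 1) (h : Tendsto (fun t => t ^ (1 - κ) * c t) atTop (𝓝 K)) :
    ∃ M, ∀ t, 0 < t → |c t| ≤ M * t ^ (κ - 1) := by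
  obtain ⟨T, hT⟩ := eventually_atTop.1 ((h.eventually (gt_mem_nhds (lt_add_one K))).and
    (eventually_gt_atTop 0))
  have hT0 := (hT T le_rfl).2
  have hc0 := h0 0 le_rfl
  refine ⟨max (K + 1) (T ^ (1 - κ) * c 0), fun t ht => ?_⟩
  rw [abs_of_nonneg (h0 t ht.le)]
  have h1 : t ^ (1 - κ) * c t ≤ max (K + 1) (T ^ (1 - κ) * c 0) := by
    rcases le_total T t with h2 | h2
    · exact (hT t h2).1.le.trans (le_max_left _ _)
    · refine le_trans ?_ (le_max_right _ _)
      have h3 : c t ≤ c 0 := hanti (mem_Ici.2 le_rfl) ht.le ht.le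
      have h4 := h0 t ht.le
      gcongr
  have h2 : t ^ (1 - κ) * t ^ (κ - 1) = 1 := by rw [← rpow_add ht]; simp
  calc c t = t ^ (1 - κ) * c t * t ^ (κ - 1) := by linear_combination -c t * h2
    _ ≤ _ := by gcongr

end tauberian

end FPU

/-! ### The semigroup, its autocorrelation and its Laplace transform -/

namespace FPU

open Real Set

section semigroup

variable {H : Type*} [NormedAddCommGroup H] [InnerProductSpace ℂ H] [CompleteSpace H]
  {T : H →L[ℂ] H}

/-- The semigroup `exp (-t T)`. -/
noncomputable def semigroup (T : H →L[ℂ] H) (t : ℝ) : H →L[ℂ] H :=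
  NormedSpace.exp (-(t : ℂ) • T)

theorem semigroup_zero : semigroup T 0 = 1 := by
  simp [semigroup]

theorem semigroup_add (s t : ℝ) : semigroup T (s + t) = semigroup T s * semigroup T t := by
  let : NormedAlgebra ℚ (H →L[ℂ] H) := NormedAlgebra.restrictScalars ℚ ℂ _
  unfold semigroup
  rw [← NormedSpace.exp_add_of_commute (((Commute.refl T).smul_left _).smul_right _), ← add_smul]
  congr 2
  push_cast; ring

theorem hasDerivAt_semigroup_apply (f : H) (t : ℝ) :
    HasDerivAt (fun t => semigroup T t f) (-(T (semigroup T t f))) t ∧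
      T (semigroup T t f) = semigroup T t (T f) := by
  have h0 : HasDerivAt (fun t : ℝ => -(t : ℂ)) (-1) t := (Complex.ofRealCLM.hasDerivAt).neg
  have h1 := (hasDerivAt_exp_smul_const' (𝕂 := ℂ) T (-(t : ℂ))).scomp t h0
  have h2 := (((ContinuousLinearMap.apply ℂ H f).restrictScalars ℝ).hasFDerivAt).comp_hasDerivAt t h1
  refine ⟨?_, ?_⟩
  · refine h2.congr_deriv ?_
    simp [semigroup]
  · have h3 := (hasDerivAt_exp_smul_const (𝕂 := ℂ) T (-(t : ℂ))).unique
      (hasDerivAt_exp_smul_const' (𝕂 := ℂ) T (-(t : ℂ)))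
    exact (DFunLike.congr_fun h3 f).symm

theorem inner_semigroup (hT : T.IsPositive) (t : ℝ) (f g : H) :
    ⟪semigroup T t f, g⟫_ℂ = ⟪f, semigroup T t g⟫_ℂ := by
  have h1 : star (semigroup T t) = semigroup T t := by
    unfold semigroup
    rw [NormedSpace.star_exp, star_smul, hT.isSelfAdjoint.star_eq]
    simp
  rw [← ContinuousLinearMap.adjoint_inner_right, ← ContinuousLinearMap.star_eq_adjoint, h1]

theorem hasDerivAt_norm_semigroup_sq (f : H) (t : ℝ) :
    HasDerivAt (fun t => ‖semigroup T t f‖ ^ 2)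
      (-(2 * (⟪semigroup T t f, T (semigroup T t f)⟫_ℂ).re)) t := by
  have h1 := (hasDerivAt_semigroup_apply (T := T) f t).1
  have h2 := Complex.reCLM.hasFDerivAt.comp_hasDerivAt t (h1.inner ℂ h1)
  have e : (fun t => ‖semigroup T t f‖ ^ 2)
      = Complex.reCLM ∘ fun t => ⟪semigroup T t f, semigroup T t f⟫_ℂ := by
    funext s
    exact (inner_self_eq_norm_sq (𝕜 := ℂ) _).symm
  rw [e]
  refine h2.congr_deriv ?_
  have h3 : (⟪T (semigroup T t f), semigroup T t f⟫_ℂ).re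
      = (⟪semigroup T t f, T (semigroup T t f)⟫_ℂ).re := inner_re_symm (𝕜 := ℂ) _ _
  simp only [Complex.reCLM_apply, Complex.add_re, inner_neg_left, inner_neg_right, Complex.neg_re,
    h3]
  ring

theorem antitone_norm_semigroup_sq (hT : T.IsPositive) (f : H) :
    Antitone fun t => ‖semigroup T t f‖ ^ 2 := by
  refine antitone_of_deriv_nonpos (fun t => (hasDerivAt_norm_semigroup_sq f t).differentiableAt)
    fun t => ?_
  rw [(hasDerivAt_norm_semigroup_sq f t).deriv]
  have := hT.re_inner_nonneg_right (semigroup T t f)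
  simp only [RCLike.re_to_complex] at this
  linarith

/-- The autocorrelation function `t ↦ ⟨f, exp (-t T) f⟩`. -/
noncomputable def autocorrelation (T : H →L[ℂ] H) (f : H) (t : ℝ) : ℝ := ‖semigroup T (t / 2) f‖ ^ 2

theorem autocorrelation_nonneg (f : H) (t : ℝ) : 0 ≤ autocorrelation T f t := sq_nonneg _

theorem continuous_autocorrelation (f : H) : Continuous (autocorrelation T f) := by
  have h : Continuous fun t => ‖semigroup T t f‖ ^ 2 :=
    continuous_iff_continuousAt.2 fun t => (hasDerivAt_norm_semigroup_sq f t).continuousAt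
  exact h.comp (continuous_id.div_const 2)

theorem antitone_autocorrelation (hT : T.IsPositive) (f : H) :
    Antitone (autocorrelation T f) := fun s t h =>
  antitone_norm_semigroup_sq hT f (by linarith : s / 2 ≤ t / 2)

/-- Splitting the time in half and moving one self-adjoint factor across shows that the correlation
is a squared norm, hence real, nonnegative and, for positive T, decreasing. -/
theorem inner_semigroup_self (hT : T.IsPositive) (f : H) (t : ℝ) :
    ⟪f, semigroup T t f⟫_ℂ = (autocorrelation T f t : ℂ) := by
  have h : semigroup T t f = semigroup T (t / 2) (semigroup T (t / 2) f) := by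
    conv_lhs => rw [← add_halves t, semigroup_add]
    rfl
  rw [h, ← inner_semigroup hT, inner_self_eq_norm_sq_to_K, autocorrelation]
  push_cast; rfl

/-- The resolvent is the Laplace transform of the semigroup. -/
theorem inner_inverse_eq_laplace (hT : T.IsPositive) (f : H) {r : ℝ} (hr : 0 < r) :
    ⟪f, Ring.inverse ((r : ℂ) • (1 : H →L[ℂ] H) + T) f⟫_ℂ
      = ((∫ t in Ioi (0 : ℝ), exp (-(r * t)) * autocorrelation T f t : ℝ) : ℂ) := by
  set A : H →L[ℂ] H := (r : ℂ) • (1 : H →L[ℂ] H) + T with hA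
  set g := Ring.inverse A f with hg
  have hAg : (r : ℂ) • g + T g = f := by
    have := DFunLike.congr_fun (Ring.mul_inverse_cancel A (isUnit_smul_one_add hT hr)) f
    exact this
  -- With g the resolvent applied to f, e^(-rt)⟨f, e^(-tT) g⟩ is minus an antiderivative of the
  -- Laplace integrand. It equals the resolvent element at t = 0 and vanishes at infinity.
  have hd : ∀ t : ℝ, HasDerivAt (fun t : ℝ => ((exp (-(r * t)) : ℝ) : ℂ) * ⟪f, semigroup T t g⟫_ℂ)
      (-((exp (-(r * t)) * autocorrelation T f t : ℝ) : ℂ)) t := by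
    intro t
    obtain ⟨h1, h2⟩ := hasDerivAt_semigroup_apply (T := T) g t
    have h3 := (hasDerivAt_const t f).inner ℂ h1
    have h4 : HasDerivAt (fun t : ℝ => exp (-(r * t))) (exp (-(r * t)) * -(r * 1)) t :=
      (((hasDerivAt_id t).const_mul r).neg).exp
    refine (h4.ofReal_comp.mul h3).congr_deriv ?_
    rw [Complex.ofReal_mul (exp _) (autocorrelation T f t), ← inner_semigroup_self hT f t]
    have h5 : ⟪f, semigroup T t f⟫_ℂ
        = (r : ℂ) * ⟪f, semigroup T t g⟫_ℂ + ⟪f, semigroup T t (T g)⟫_ℂ := by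
      rw [← inner_smul_right, ← inner_add_right, ← map_smul, ← map_add, hAg]
    rw [h5, h2, inner_neg_right, inner_zero_left, add_zero]
    push_cast
    ring
  have hi : IntegrableOn (fun t => exp (-(r * t)) * autocorrelation T f t) (Ioi 0) := by
    have h1 : IntegrableOn (fun t => exp (-(r * t))) (Ioi 0) := by
      simpa only [neg_mul] using exp_neg_integrableOn_Ioi 0 hr
    have hc := continuous_autocorrelation (T := T) f
    refine (h1.mul_const (autocorrelation T f 0)).mono'
      (Continuous.aestronglyMeasurable (by fun_prop)) ?_
    filter_upwards [ae_restrict_mem measurableSet_Ioi] with t ht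
    rw [norm_of_nonneg (mul_nonneg (exp_pos _).le (autocorrelation_nonneg f t))]
    gcongr
    exact antitone_autocorrelation hT f (mem_Ioi.1 ht).le
  have hlim : Tendsto (fun t : ℝ => ((exp (-(r * t)) : ℝ) : ℂ) * ⟪f, semigroup T t g⟫_ℂ) atTop
      (𝓝 0) := by
    have h1 : Tendsto (fun t : ℝ => exp (-(r * t)) * (‖f‖ * ‖g‖)) atTop (𝓝 0) := by
      have h2 := (tendsto_exp_neg_atTop_nhds_zero.comp (tendsto_id.const_mul_atTop hr)).mul_const
        (‖f‖ * ‖g‖)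
      simpa [Function.comp_def] using h2
    rw [tendsto_zero_iff_norm_tendsto_zero]
    refine tendsto_of_tendsto_of_tendsto_of_le_of_le' tendsto_const_nhds h1
      (Eventually.of_forall fun t => norm_nonneg _) ?_
    filter_upwards [eventually_ge_atTop 0] with t ht
    have h2 : ‖semigroup T t g‖ ≤ ‖g‖ := by
      have h3 := antitone_norm_semigroup_sq hT g ht
      simp only [semigroup_zero, one_apply_eq_self] at h3
      exact le_of_sq_le_sq h3 (norm_nonneg _)
    rw [norm_mul, Complex.norm_real, norm_of_nonneg (exp_pos _).le]
    gcongr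
    exact (norm_inner_le_norm _ _).trans (by gcongr)
  have h5 := integral_Ioi_of_hasDerivAt_of_tendsto (a := 0) (hd 0).continuousAt.continuousWithinAt
    (fun t _ => hd t) hi.ofReal.neg hlim
  simp only [integral_neg, mul_zero, neg_zero, exp_zero, Complex.ofReal_one, one_mul,
    semigroup_zero, one_apply_eq_self, zero_sub, neg_inj] at h5
  rw [← h5, integral_complex_ofReal]

end semigroup

theorem corrC_eq (t : ℝ) : corrC Ltilde t = (autocorrelation Ltilde omegaPrime |t| : ℂ) :=
  inner_semigroup_self isPositive_Ltilde omegaPrime |t|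

theorem corrC_eq_of_nonneg {t : ℝ} (ht : 0 ≤ t) :
    corrC Ltilde t = (autocorrelation Ltilde omegaPrime t : ℂ) := by
  rw [corrC_eq, abs_of_nonneg ht]

theorem integral_corrC {t : ℝ} (ht : 0 ≤ t) :
    ∫ s in (0 : ℝ)..t, corrC Ltilde s
      = ((∫ s in (0 : ℝ)..t, autocorrelation Ltilde omegaPrime s : ℝ) : ℂ) := by
  rw [← intervalIntegral.integral_ofReal]
  refine intervalIntegral.integral_congr fun s hs => ?_
  rw [uIcc_of_le ht] at hs
  exact corrC_eq_of_nonneg hs.1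

/-- For an even correlation function the double time integral reduces to an iterated integral. -/
theorem double_integral_even {c : ℝ → ℝ} (hc : Continuous c) (t : ℝ) :
    ∫ s in (0 : ℝ)..t, ∫ s' in (0 : ℝ)..t, c |s - s'|
      = 2 * ∫ s in (0 : ℝ)..t, ∫ u in (0 : ℝ)..s, c |u| := by
  set F : ℝ → ℝ := fun s => ∫ u in (0 : ℝ)..s, c |u| with hF
  have hca : Continuous fun u : ℝ => c |u| := by fun_prop
  have hFc : Continuous F :=
    intervalIntegral.continuous_primitive (fun a b => hca.intervalIntegrable a b) 0
  have h1 : ∀ s, ∫ s' in (0 : ℝ)..t, c |s - s'| = F s + F (t - s) := by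
    intro s
    rw [intervalIntegral.integral_comp_sub_left (fun u => c |u|) s, sub_zero,
      ← intervalIntegral.integral_add_adjacent_intervals (hca.intervalIntegrable (s - t) 0)
        (hca.intervalIntegrable 0 s), add_comm]
    congr 1
    have h2 := intervalIntegral.integral_comp_neg (fun u => c |u|) (a := 0) (b := t - s)
    simp only [abs_neg, neg_sub, neg_zero] at h2
    exact h2.symm
  simp_rw [h1]
  rw [intervalIntegral.integral_add (hFc.intervalIntegrable _ _)
    (Continuous.intervalIntegrable (by fun_prop) _ _),
    intervalIntegral.integral_comp_sub_left F t, sub_self, sub_zero]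
  ring

theorem energySpread_eq (D₀ χ : ℝ) {t : ℝ} (ht : 0 ≤ t) :
    energySpread D₀ χ (corrC Ltilde) t = ((D₀ + χ⁻¹ * (2 * ∫ s in (0 : ℝ)..t,
      ∫ u in (0 : ℝ)..s, autocorrelation Ltilde omegaPrime u) : ℝ) : ℂ) := by
  have h1 := double_integral_even (continuous_autocorrelation (T := Ltilde) omegaPrime) t
  have h2 : ∫ s in (0 : ℝ)..t, ∫ u in (0 : ℝ)..s, autocorrelation Ltilde omegaPrime |u|
      = ∫ s in (0 : ℝ)..t, ∫ u in (0 : ℝ)..s, autocorrelation Ltilde omegaPrime u := by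
    refine intervalIntegral.integral_congr fun s hs => ?_
    rw [uIcc_of_le ht] at hs
    refine intervalIntegral.integral_congr fun u hu => ?_
    rw [uIcc_of_le hs.1] at hu
    simp only [abs_of_nonneg hu.1]
  unfold energySpread
  simp_rw [corrC_eq, intervalIntegral.integral_ofReal]
  rw [h1, h2]
  push_cast; ring

theorem tendsto_autocorrelation :
    Tendsto (fun t => t ^ (1 - 2 / 5 : ℝ) * autocorrelation Ltilde omegaPrime t) atTop
      (𝓝 (resolventConst / Gamma (2 / 5))) := by
  refine tendsto_of_tendsto_laplace (continuous_autocorrelation _)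
    ((antitone_autocorrelation isPositive_Ltilde _).antitoneOn _)
    (fun t _ => autocorrelation_nonneg _ t) (by norm_num) (by norm_num) resolventConst_pos ?_
  have h1 := (Complex.continuous_re.tendsto _).comp tendsto_resolventR
  refine h1.congr' ?_
  filter_upwards [self_mem_nhdsWithin] with r hr
  simp only [Function.comp_apply]
  rw [resolventR, inner_inverse_eq_laplace isPositive_Ltilde omegaPrime hr, ← Complex.ofReal_mul,
    Complex.ofReal_re]

end FPU

/-! ### Assembly of the resolvent, correlation and energy spread limits -/

theorem corollary2p4 :
    ∃ Lt : FPU.L2I →L[ℂ] FPU.L2I,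
      FPU.IsLtilde Lt ∧
      (∀ T : FPU.L2I →L[ℂ] FPU.L2I, FPU.IsLtilde T → T = Lt) ∧
      Lt.IsPositive ∧
      (∀ r : ℝ, 0 < r → IsUnit ((r : ℂ) • (1 : FPU.L2I →L[ℂ] FPU.L2I) + Lt)) ∧
      ∃ c₀ : ℝ, 0 < c₀ ∧
        Tendsto (fun r : ℝ => ((r ^ (2 / 5 : ℝ) : ℝ) : ℂ) * FPU.resolventR Lt r)
          (𝓝[>] 0) (𝓝 (c₀ : ℂ)) ∧
        Tendsto (fun t : ℝ => ((t ^ (3 / 5 : ℝ) : ℝ) : ℂ) * FPU.corrC Lt t)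
          atTop (𝓝 ((c₀ / Real.Gamma (2 / 5) : ℝ) : ℂ)) ∧
        Tendsto (fun t : ℝ => ((t ^ (-(2 / 5) : ℝ) : ℝ) : ℂ) * ∫ s in (0 : ℝ)..t, FPU.corrC Lt s)
          atTop (𝓝 ((c₀ / Real.Gamma (7 / 5) : ℝ) : ℂ)) ∧
        ∀ D₀ χ : ℝ, 0 < χ →
          Tendsto (fun t : ℝ => ((t ^ (-(1 + 2 / 5) : ℝ) : ℝ) : ℂ) *
              FPU.energySpread D₀ χ (FPU.corrC Lt) t)
            atTop (𝓝 ((2 * c₀ / (χ * Real.Gamma (12 / 5)) : ℝ) : ℂ)) := by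
  set c := FPU.autocorrelation FPU.Ltilde FPU.omegaPrime with hcdef
  have hc : Continuous c := FPU.continuous_autocorrelation _
  have hanti : AntitoneOn c (Set.Ici 0) :=
    (FPU.antitone_autocorrelation FPU.isPositive_Ltilde _).antitoneOn _
  have h1 := FPU.tendsto_autocorrelation
  obtain ⟨M, hM⟩ := FPU.exists_le_rpow_of_tendsto hanti
    (fun t _ => FPU.autocorrelation_nonneg _ t) (by norm_num) h1
  have h2 := FPU.tendsto_integral_of_tendsto hc (by norm_num) hM h1
  have hM2 : ∀ t, 0 < t → |∫ s in (0 : ℝ)..t, c s| ≤ M / (2 / 5) * t ^ (7 / 5 - 1 : ℝ) := by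
    intro t ht
    have := FPU.abs_integral_le_of_abs_le (by norm_num) hM ht
    rwa [show (7 / 5 - 1 : ℝ) = 2 / 5 by norm_num]
  have hFc : Continuous fun t => ∫ s in (0 : ℝ)..t, c s :=
    intervalIntegral.continuous_primitive (fun a b => hc.intervalIntegrable a b) 0
  have h2' := h2
  -- The first integral has exponent 2/5 = κ - 1 with κ = 7/5, so the same integration lemma applies
  -- a second time. The two integrations divide the constant by 2/5 and then 7/5, which the Gamma
  -- recursion absorbs.
  rw [show (-(2 / 5) : ℝ) = 1 - 7 / 5 by norm_num] at h2'
  have h3 := FPU.tendsto_integral_of_tendsto hFc (by norm_num) hM2 h2'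
  have hG1 : Real.Gamma (7 / 5) = 2 / 5 * Real.Gamma (2 / 5) := by
    rw [show (7 / 5 : ℝ) = 2 / 5 + 1 by norm_num, Real.Gamma_add_one (by norm_num)]
  have hG2 : Real.Gamma (12 / 5) = 7 / 5 * Real.Gamma (7 / 5) := by
    rw [show (12 / 5 : ℝ) = 7 / 5 + 1 by norm_num, Real.Gamma_add_one (by norm_num)]
  refine ⟨FPU.Ltilde, FPU.isLtilde_Ltilde, fun T hT => hT.unique FPU.isLtilde_Ltilde,
    FPU.isPositive_Ltilde, fun r hr => FPU.isUnit_smul_one_add FPU.isPositive_Ltilde hr,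
    FPU.resolventConst, FPU.resolventConst_pos, FPU.tendsto_resolventR, ?_, ?_, ?_⟩
  · refine ((Complex.continuous_ofReal.tendsto _).comp h1).congr' ?_
    filter_upwards [eventually_ge_atTop 0] with t ht
    rw [FPU.corrC_eq_of_nonneg ht, Function.comp_apply, Complex.ofReal_mul]
    norm_num
  · rw [hG1, mul_comm (2 / 5 : ℝ), ← div_div]
    refine ((Complex.continuous_ofReal.tendsto _).comp h2).congr' ?_
    filter_upwards [eventually_ge_atTop 0] with t ht
    rw [FPU.integral_corrC ht, Function.comp_apply, Complex.ofReal_mul]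
  · intro D₀ χ hχ
    -- The initial spread is negligible on the scale t^(7/5).
    have h4 : Tendsto (fun t : ℝ => t ^ (-(7 / 5) : ℝ)) atTop (𝓝 0) :=
      tendsto_rpow_neg_atTop (by norm_num)
    have h5 := (h4.const_mul D₀).add ((h3.const_mul 2).const_mul χ⁻¹)
    have e : D₀ * 0 + χ⁻¹ * (2 * (FPU.resolventConst / Real.Gamma (2 / 5) / (2 / 5) / (7 / 5)))
        = 2 * FPU.resolventConst / (χ * Real.Gamma (12 / 5)) := by
      have := (Real.Gamma_pos_of_pos (by norm_num : (0 : ℝ) < 2 / 5)).ne'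
      rw [hG2, hG1]
      field_simp
      ring
    rw [e] at h5
    refine ((Complex.continuous_ofReal.tendsto _).comp h5).congr' ?_
    filter_upwards [eventually_ge_atTop 0] with t ht
    rw [FPU.energySpread_eq D₀ χ ht, Function.comp_apply, ← Complex.ofReal_mul,
      show (-(1 + 2 / 5) : ℝ) = -(7 / 5) by norm_num]
    congr 1
    ring
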